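/- **Setting.** Let $d\ge 1$, let $\xi$ be a random variable with law $P$ on a measurable space $\Xi$, let $f(\cdot;\xi):\mathbb R^d\to\mathbb R$ be a random function and $F(x)=\mathbb E_\xi f(x;\xi)$. Assume, for constants $L,\rho,\sigma,\Delta>0$: (1) for every $\xi$, $f(\cdot;\xi)$ is twice differentiable, $\|\nabla f(x_1;\xi)-\nabla f(x_2;\xi)\|_2\le L\|x_1-x_2\|_2$ and $\|\nabla^2 f(x_1;\xi)-\nabla^2 f(x_2;\xi)\|_2\le\rho\|x_1-x_2\|_2$ for all $x_1,x_2$; (2) $\|\nabla f(x;\xi)-\nabla F(x)\|_2^2\le\sigma^2$ for all $x,\xi$; (3) $F$ is bounded below and $F(x_1)-\inf_x F(x)\le\Delta$, where $x_1$ is the starting point. A point $x$ is an $(\epsilon,\epsilon_H)$-approximate local minimum if $\|\nabla F(x)\|_2\le\epsilon$ and $\lambda_{\min}(\nabla^2F(x))\ge-\epsilon_H$. **Algorithm (LENA with STORM).** Parameters: $\epsilon,\eta,\eta_H,r,\bar D,a>0$ and positive integers $\ell,b,B$. *Gradient estimator.* $d_1$ is the average of $\nabla f(x_1;\cdot)$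 over $B$ fresh independent samples. For $t\ge1$, once $x_{t+1}$ is known, draw $b$ fresh independent samples $\xi^1,\dots,\xi^b$ and set $d_{t+1}=(1-a)\big[d_t-\frac1b\sum_i\nabla f(x_t;\xi^i)\big]+\frac1b\sum_i\nabla f(x_{t+1};\xi^i)$. The initial call costs $B$ stochastic gradient evaluations, every later call costs $2b$. *Descent phase* (the algorithm starts here, with $t=1$). While $\|d_t\|_2>\epsilon$, set $x_{t+1}=x_t-\eta\, d_t/\|d_t\|_2$. When $\|d_t\|_2\le\epsilon$, set $m=t$, $x_{m+1}=x_m+u$ with an independent $u$ uniform on the ball of radius $r$ around $0$, and enter the Escape phase. *Escape phase.* For $t=m+1,\dots,m+\ell$: put $\eta_t=\eta_H$ and $D=\sum_{i=m+1}^t\eta_i^2\|d_i\|_2^2$. If $D>(t-m+1)\bar D$, decrease $\eta_t$ so that $\sum_{i=m+1}^t\eta_i^2\|d_i\|_2^2=(t-m+1)\bar D$, set $x_{t+1}=x_t-\eta_td_t$, and return to the descent phase; otherwise set $x_{t+1}=x_t-\eta_Hd_t$ and continue. If all $\ell$ iterations are completed without a return, halt and output $x_m$. **Theorem.** There are universal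 constants $C>0$ and $p,q,k,m_0\in\mathbb N$ such that for all $L,\rho,\sigma,\Delta>0$ there is $\epsilon_0=\epsilon_0(L,\rho,\sigma,\Delta)>0$ with the following property. Let $d\ge1$, $P$, $f$, $x_1$ satisfy (1)–(3), and let $0<\epsilon\le\epsilon_0$, $\epsilon_H>0$, $\delta\in(0,1)$ and $r>0$. Put $$\Lambda=\log\frac{4d\,(1+1/\epsilon_H)}{\delta\,\epsilon\, r},\quad b=\Big\lceil C\Lambda^p\Big(\frac{\sigma}{\epsilon}+\frac{\sigma\rho}{\epsilon_H^2}\Big)\Big\rceil,\quad B=b^2,\quad \eta=\frac{\sigma}{2bL},\quad \eta_H=\frac{1}{C\Lambda^qL},$$ $$a=\frac{56^2\log(4/\delta)}{b},\quad \ell=\Big\lceil\frac{C\Lambda^k}{\eta_H\epsilon_H}\Big\rceil,\quad \bar D=\frac{\sigma^2}{4b^2L^2},$$ and suppose that $$r\le\min\Big\{\frac{\sigma}{2bL},\ \frac{\log(4/\delta)^2\eta_H\sigma^2}{\epsilon b^2},\ \sqrt{\frac{2\log(4/\delta)^2\eta_H\sigma^2}{b^2L}}\Big\}.$$ Then, with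 probability at least $1-\delta$, LENA with STORM halts, its output is an $(\epsilon,\epsilon_H)$-approximate local minimum of $F$, and it has used at most $$C\Lambda^{m_0}\Big(\frac{\sigma L\Delta}{\epsilon^3}+\frac{\sigma\rho^3L\Delta}{\epsilon_H^6}\Big)$$ stochastic gradient evaluations. -/

import Mathlib

open MeasureTheory

noncomputable section

namespace LENA

/-- The space `ℝ^d` with its Euclidean norm. -/
abbrev Point (d : ℕ) := EuclideanSpace ℝ (Fin d)

/-- The Hessian of `F` at `x`, as a continuous linear operator (with the operator norm). -/
def hessian {d : ℕ} (F : Point d → ℝ) (x : Point d) : Point d →L[ℝ] Point d :=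
  fderiv ℝ (gradient F) x

/-- The expected objective `F(x) = 𝔼_ξ f(x; ξ)`, where `ξ` has law `P`. -/
def objective {d : ℕ} {Ξ : Type*} [MeasurableSpace Ξ] (P : Measure Ξ)
    (f : Point d → Ξ → ℝ) (x : Point d) : ℝ :=
  ∫ ξ, f x ξ ∂P

/-- `x` is an `(ε, εH)`-approximate local minimum of `F`: the gradient has norm at most `ε`, and
every eigenvalue of the Hessian (hence the smallest one) is at least `-εH`. -/
def IsApproxLocalMin {d : ℕ} (F : Point d → ℝ) (ε εH : ℝ) (x : Point d) : Prop :=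
  ‖gradient F x‖ ≤ ε ∧
    ∀ μ : ℝ, Module.End.HasEigenvalue
      ((hessian F x : Point d →L[ℝ] Point d) : Point d →ₗ[ℝ] Point d) μ → -εH ≤ μ

/-- The standing meaning of the problem: `f(·; ξ)` is a random function whose expectation exists
at every point. -/
structure IsStochasticObjective {d : ℕ} {Ξ : Type*} [MeasurableSpace Ξ] (P : Measure Ξ)
    (f : Point d → Ξ → ℝ) : Prop where
  measurable : ∀ x, Measurable (f x)
  integrable : ∀ x, Integrable (f x) P

/-- For all `ξ`, `f(·; ξ)` is twice differentiable, `L`-smooth, with `ρ`-Lipschitz Hessian. -/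
structure IsSmoothLipschitz {d : ℕ} {Ξ : Type*} (f : Point d → Ξ → ℝ) (L ρ : ℝ) : Prop where
  differentiable : ∀ ξ, Differentiable ℝ (fun x => f x ξ)
  differentiable_gradient : ∀ ξ, Differentiable ℝ (gradient (fun x => f x ξ))
  gradient_lipschitz : ∀ ξ x₁ x₂,
    ‖gradient (fun x => f x ξ) x₁ - gradient (fun x => f x ξ) x₂‖ ≤ L * ‖x₁ - x₂‖
  hessian_lipschitz : ∀ ξ x₁ x₂,
    ‖hessian (fun x => f x ξ) x₁ - hessian (fun x => f x ξ) x₂‖ ≤ ρ * ‖x₁ - x₂‖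

/-- The stochastic gradients deviate from the full gradient by at most `σ`. -/
def HasBoundedDeviation {d : ℕ} {Ξ : Type*} [MeasurableSpace Ξ] (P : Measure Ξ)
    (f : Point d → Ξ → ℝ) (σ : ℝ) : Prop :=
  ∀ x ξ, ‖gradient (fun y => f y ξ) x - gradient (objective P f) x‖ ^ 2 ≤ σ ^ 2

/-- The gap between the initial value and the (finite) infimum of `F` is at most `Δ`. -/
def HasGap {d : ℕ} (F : Point d → ℝ) (x₁ : Point d) (Δ : ℝ) : Prop :=
  BddBelow (Set.range F) ∧ F x₁ - ⨅ x, F x ≤ Δ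

/-! ### The STORM gradient estimator -/

/-- The mini-batch average `(1/n) ∑_{i < n} ∇f(x; ξ^i)`. -/
def batchGradient {d : ℕ} {Ξ : Type*} (f : Point d → Ξ → ℝ) (n : ℕ) (ξ : ℕ → Ξ)
    (x : Point d) : Point d :=
  (n : ℝ)⁻¹ • ∑ i ∈ Finset.range n, gradient (fun y => f y (ξ i)) x

/-- STORM at time `t ≥ 1`: from `d_t`, `x_t`, `x_{t+1}` and a fresh batch `ξ` of `b` samples, each
queried at both points, compute `d_{t+1}`. -/
def stormUpdate {d : ℕ} {Ξ : Type*} (f : Point d → Ξ → ℝ) (a : ℝ) (b : ℕ) (ξ : ℕ → Ξ)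
    (dir x x' : Point d) : Point d :=
  (1 - a) • (dir - batchGradient f b ξ x) + batchGradient f b ξ x'

/-! ### The LENA loop -/

/-- The parameters of LENA with STORM. -/
structure Params where
  /-- the threshold on the norm of the estimated gradient -/
  eps : ℝ
  /-- the step size of the gradient descent phase -/
  eta : ℝ
  /-- the step size of the Escape phase -/
  etaH : ℝ
  /-- the maximal number of iterations of the Escape phase -/
  ell : ℕ
  /-- the average movement -/
  Dbar : ℝ
  /-- the STORM weight -/
  a : ℝ
  /-- the mini-batch size -/
  b : ℕ
  /-- the initial batch size -/
  B : ℕ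

/-- The position in the program: in the gradient descent phase; in the Escape phase that started
at the anchor `x_{m_s}`, with `k` Escape iterations done so far (so `t = m_s + 1 + k`) and
accumulated squared movement `S = ∑_{i = m_s+1}^{t-1} η_i² ‖d_i‖²`; or halted with an output. -/
inductive Phase (d : ℕ) where
  | descent : Phase d
  | escape (k : ℕ) (S : ℝ) (anchor : Point d) : Phase d
  | halted (out : Point d) : Phase d

/-- The current iterate `x_t`, the current estimate `d_t`, the position in the program, and the
number of stochastic gradients evaluated so far. -/
structure State (d : ℕ) where
  x : Point d
  dir : Point d
  phase : Phase d
  evals : ℕ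

/-- The randomness of one time step: a stream of samples, of which the first `b` (or `B`) are used,
and a perturbation, which is used only if an Escape phase starts at this step. -/
abbrev Seed (d : ℕ) (Ξ : Type*) := (ℕ → Ξ) × Point d

/-- The state at time `t = 1`: `d_1` is the average of `B` stochastic gradients at `x_1`. -/
def initState {d : ℕ} {Ξ : Type*} (prm : Params) (f : Point d → Ξ → ℝ) (x₁ : Point d)
    (seed : Seed d Ξ) : State d where
  x := x₁
  dir := batchGradient f prm.B seed.1 x₁
  phase := Phase.descent
  evals := prm.B

/-- Move to `x'`, call STORM with the fresh samples (`b` samples, each queried at the old and at the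
new point, which costs `2 b` stochastic gradients), and continue in phase `ph`. -/
def moveTo {d : ℕ} {Ξ : Type*} (prm : Params) (f : Point d → Ξ → ℝ) (seed : Seed d Ξ)
    (st : State d) (x' : Point d) (ph : Phase d) : State d where
  x := x'
  dir := stormUpdate f prm.a prm.b seed.1 st.dir st.x x'
  phase := ph
  evals := st.evals + 2 * prm.b

/-- One step of LENA with STORM.

* Descent phase: a normalized step of length `eta` while `‖d_t‖ > eps`; otherwise set `m_s = t`,
  perturb `x_t` and start the Escape phase.
* Escape phase, iteration `k < ell`, so that `t - m_s + 1 = k + 2`: let `D` be the accumulated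
  squared movement with the step size `etaH`. If `D > (t - m_s + 1) Dbar`, then shrink the last step
  size so that the accumulated squared movement is exactly `(t - m_s + 1) Dbar`, make the step and
  return to the descent phase; otherwise make the step with step size `etaH` and go on.
* Escape phase completed without a break: halt and output `x_{m_s}`. -/
def step {d : ℕ} {Ξ : Type*} (prm : Params) (f : Point d → Ξ → ℝ) (seed : Seed d Ξ)
    (st : State d) : State d :=
  match st.phase with
  | Phase.descent =>
      if prm.eps < ‖st.dir‖ then
        moveTo prm f seed st (st.x - (prm.eta / ‖st.dir‖) • st.dir) Phase.descent
      else
        moveTo prm f seed st (st.x + seed.2) (Phase.escape 0 0 st.x)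
  | Phase.escape k S anchor =>
      if k < prm.ell then
        let D := S + prm.etaH ^ 2 * ‖st.dir‖ ^ 2
        let cap := ((k : ℝ) + 2) * prm.Dbar
        if cap < D then
          moveTo prm f seed st (st.x - (Real.sqrt (cap - S) / ‖st.dir‖) • st.dir) Phase.descent
        else
          moveTo prm f seed st (st.x - prm.etaH • st.dir) (Phase.escape (k + 1) D anchor)
      else
        { st with phase := Phase.halted anchor }
  | Phase.halted _ => st

/-- The run of LENA with STORM from `x₁`, driven by the sequence `ω` of seeds. -/
def run {d : ℕ} {Ξ : Type*} (prm : Params) (f : Point d → Ξ → ℝ) (x₁ : Point d)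
    (ω : ℕ → Seed d Ξ) : ℕ → State d
  | 0 => initState prm f x₁ (ω 0)
  | n + 1 => step prm f (ω (n + 1)) (run prm f x₁ ω n)

/-- On the seeds `ω`, the run halts with an output that satisfies `Q`, having evaluated at most `N`
stochastic gradients. -/
def FindsWithin {d : ℕ} {Ξ : Type*} (prm : Params) (f : Point d → Ξ → ℝ) (x₁ : Point d)
    (Q : Point d → Prop) (N : ℝ) (ω : ℕ → Seed d Ξ) : Prop :=
  ∃ n out, (run prm f x₁ ω n).phase = Phase.halted out ∧ Q out ∧
    ((run prm f x₁ ω n).evals : ℝ) ≤ N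

/-! ### The randomness -/

/-- The uniform distribution on the Euclidean ball of radius `r` around `0`. -/
def uniformBall (d : ℕ) (r : ℝ) : Measure (Point d) :=
  ProbabilityTheory.cond volume (Metric.closedBall 0 r)

/-- The law of one seed: i.i.d. samples with law `P`, and an independent uniform perturbation. -/
def seedLaw {Ξ : Type*} [MeasurableSpace Ξ] (P : Measure Ξ) (d : ℕ) (r : ℝ) :
    Measure (Seed d Ξ) :=
  (Measure.infinitePi fun _ : ℕ => P).prod (uniformBall d r)

/-- The law of the sequence of independent seeds that drives a run. -/
def runLaw {Ξ : Type*} [MeasurableSpace Ξ] (P : Measure Ξ) (d : ℕ) (r : ℝ) :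
    Measure (ℕ → Seed d Ξ) :=
  Measure.infinitePi fun _ : ℕ => seedLaw P d r

theorem isProbabilityMeasure_uniformBall (d : ℕ) {r : ℝ} (hr : 0 < r) :
    IsProbabilityMeasure (uniformBall d r) := by
  have h0 : volume (Metric.closedBall (0 : Point d) r) ≠ 0 :=
    (Metric.measure_closedBall_pos volume (0 : Point d) hr).ne'
  have h1 : volume (Metric.closedBall (0 : Point d) r) ≠ ⊤ :=
    (isCompact_closedBall (0 : Point d) r).measure_lt_top.ne
  exact ProbabilityTheory.cond_isProbabilityMeasure_of_finite h0 h1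

theorem isProbabilityMeasure_seedLaw {Ξ : Type*} [MeasurableSpace Ξ] (P : Measure Ξ)
    [IsProbabilityMeasure P] (d : ℕ) {r : ℝ} (hr : 0 < r) :
    IsProbabilityMeasure (seedLaw P d r) := by
  have := isProbabilityMeasure_uniformBall d hr
  unfold seedLaw
  infer_instance

theorem isProbabilityMeasure_runLaw {Ξ : Type*} [MeasurableSpace Ξ] (P : Measure Ξ)
    [IsProbabilityMeasure P] (d : ℕ) {r : ℝ} (hr : 0 < r) :
    IsProbabilityMeasure (runLaw P d r) := by
  have := isProbabilityMeasure_seedLaw P d hr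
  unfold runLaw
  infer_instance

/-! ### The prescribed parameters -/

/-- The logarithmic quantity whose powers are the factors hidden by `Õ`. -/
def logFactor (d : ℕ) (δ ε εH r : ℝ) : ℝ :=
  Real.log (4 * d * (1 + 1 / εH) / (δ * ε * r))

/-- Mini-batch size `b = ⌈C Λ^p (σ/ε + σρ/εH²)⌉`. -/
def miniBatch (C : ℝ) (p : ℕ) (Λ ρ σ ε εH : ℝ) : ℕ :=
  ⌈C * Λ ^ p * (σ / ε + σ * ρ / εH ^ 2)⌉₊

/-- Escape phase step size `ηH = 1 / (C Λ^q L)`. -/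
def escapeStep (C : ℝ) (q : ℕ) (Λ L : ℝ) : ℝ :=
  1 / (C * Λ ^ q * L)

/-- Escape phase length `ℓ = ⌈C Λ^k / (ηH εH)⌉`. -/
def escapeLength (C : ℝ) (k : ℕ) (Λ ηH εH : ℝ) : ℕ :=
  ⌈C * Λ ^ k / (ηH * εH)⌉₊

/-- All the parameters in terms of `b`, `ηH` and `ℓ`. -/
def stormParams (L σ δ ε ηH : ℝ) (b ℓ : ℕ) : Params where
  eps := ε
  eta := σ / (2 * b * L)
  etaH := ηH
  ell := ℓ
  Dbar := σ ^ 2 / (4 * (b : ℝ) ^ 2 * L ^ 2)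
  a := 56 ^ 2 * Real.log (4 / δ) / b
  b := b
  B := b ^ 2

/-- The three upper bounds on the perturbation radius. -/
def maxRadius (L σ δ ε ηH : ℝ) (b : ℕ) : ℝ :=
  min (σ / (2 * b * L))
    (min (Real.log (4 / δ) ^ 2 * ηH * σ ^ 2 / (ε * (b : ℝ) ^ 2))
      (Real.sqrt (2 * Real.log (4 / δ) ^ 2 * ηH * σ ^ 2 / ((b : ℝ) ^ 2 * L))))

/-- The bound `C Λ^m (σLΔ/ε³ + σρ³LΔ/εH⁶)` on the number of stochastic gradient evaluations. -/
def evalBound (C : ℝ) (m : ℕ) (Λ L ρ σ Δ ε εH : ℝ) : ℝ :=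
  C * Λ ^ m * (σ * L * Δ / ε ^ 3 + σ * ρ ^ 3 * L * Δ / εH ^ 6)

end LENA

end

/-!
Two quantities are followed along a run of LENA: the error `d_t - ∇F(x_t)` of the STORM estimate
and the decrease of `F`.

*The error.* A STORM update contracts the error by `1 - a` and adds a centered noise, each sample
of which is bounded by `2 L ‖x_{t+1} - x_t‖ + a σ` (`lintegral_cosh_storm_le`). The squared steps
are at most `Dbar` on average, in the Escape phase by its rule for cutting it short, so a
potential of the form `cosh (lam ‖error‖) · exp (- lam² w / 2)`, with a weight `w` that depends on
the accumulated squared movement, is a supermartingale as long as `lam` shrinks to `(1 - a) lam`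
backwards in time (`lintegral_errPotential_step_le`, `lintegral_chain_le_one`). Hence, at every
time before halting, the error is at most `Λ² σ / b`, except with probability `2 exp (- Λ² / 4)`
(`runLaw_error_ge_le`). The use of `cosh` of the norm makes these bounds independent of the
dimension.

*The decrease.* While the errors are that small, each descent step decreases `F` by some `κ`, and
an Escape phase that is cut short after `k + 2` steps has moved so much that it has decreased `F`
by `κ (k + 2)` (`invariant_succ`). As `F` is bounded below, the run halts within `Δ / κ + 2 (ℓ +
1)` steps up to rounding, which gives the cost. The output is then the start of an Escape phase
that was never cut, and the first estimate in this phase is too small for the gradient there to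
exceed `ε` (`findsWithin_of_good`).

*Second order.* It remains to see that an Escape phase that starts at a point whose Hessian has an
eigenvalue below `-εH` is cut short with high probability. Two copies of the phase that use the
same samples, with perturbations that differ by a multiple of a least eigenvector, separate like
`(1 + ηH γ)^n`, where `-γ` is the least eigenvalue (`half_pow_le_norm_of_coupling`): the
difference of their errors is again a contracted sum of centered noises, whose size is
proportional to the difference of the paths. An uncut phase stays within a small radius `R`, so
the two copies are unlikely to be both uncut (`runLaw_both_stuck_le`). Applied to all pairs among
`J` translates of the perturbation by multiples of a tiny vector, which hardly changes the uniform
distribution on the ball, this shows that a random perturbation leads to an uncut phase with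
probability about `1 / J` (`uniformBall_prod_le`, `runLaw_isStuck_le`), where `J` is as large as a
power of `e^Λ`. The Markov property carries this over to each time of the run
(`runLaw_run_isStuck_le`).

*The parameters.* For small `ε`, the logarithmic factor `Λ` exceeds all the constants of the
problem, while `e^Λ` exceeds `d`, `1/δ`, `1/r`, `1/εH` and, up to a power, `1/ε`. All the
conditions on the parameters become comparisons of powers of `Λ` and of `e^Λ` (`Regime`), and a
union bound over the times concludes.
-/

noncomputable section

namespace LENA

set_option linter.unusedSectionVars false

section

/-! ### The hyperbolic cosine of a norm -/

/-- `cosh √t` is a convex and increasing function of `t`. -/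
theorem cosh_convex_sq {A B M α β : ℝ} (hα : 0 ≤ α) (hβ : 0 ≤ β) (hαβ : α + β = 1)
    (hM : M ^ 2 ≤ α * A ^ 2 + β * B ^ 2) :
    Real.cosh M ≤ α * Real.cosh A + β * Real.cosh B := by
  refine hasSum_le (fun n => ?_) (Real.hasSum_cosh M)
    (((Real.hasSum_cosh A).mul_left α).add ((Real.hasSum_cosh B).mul_left β))
  have h1 : M ^ (2 * n) ≤ α * A ^ (2 * n) + β * B ^ (2 * n) := by
    have h2 := (convexOn_pow (𝕜 := ℝ) n).2 (Set.mem_Ici.2 (sq_nonneg A))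
      (Set.mem_Ici.2 (sq_nonneg B)) hα hβ hαβ
    simp only [smul_eq_mul] at h2
    rw [pow_mul, pow_mul, pow_mul]
    exact (pow_le_pow_left₀ (sq_nonneg M) hM n).trans h2
  calc M ^ (2 * n) / ((2 * n).factorial : ℝ)
      ≤ (α * A ^ (2 * n) + β * B ^ (2 * n)) / ((2 * n).factorial : ℝ) := by gcongr
    _ = _ := by ring

variable {E : Type*} [NormedAddCommGroup E] [InnerProductSpace ℝ E]

/-- The bound is the product of the two `cosh` up to a term that is linear in `X`, hence vanishes in
expectation for centered `X`. -/
theorem cosh_norm_add_le (s : E) {c : ℝ} (hc : 0 < c) (lam : ℝ) :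
    ∃ K : ℝ, ∀ X : E, ‖X‖ ≤ c →
      Real.cosh (lam * ‖s + X‖) ≤
        Real.cosh (lam * ‖s‖) * Real.cosh (lam * c) + K * inner ℝ s X := by
  rcases eq_or_ne s 0 with rfl | hs
  · refine ⟨0, fun X hX => ?_⟩
    simp only [zero_add, norm_zero, mul_zero, Real.cosh_zero, one_mul, zero_mul, add_zero]
    rw [Real.cosh_le_cosh, abs_mul, abs_mul, abs_of_nonneg (norm_nonneg X), abs_of_pos hc]
    gcongr
  have hs' : 0 < ‖s‖ := norm_pos_iff.2 hs
  refine ⟨Real.sinh (lam * ‖s‖) * Real.sinh (lam * c) / (‖s‖ * c), fun X hX => ?_⟩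
  set y : ℝ := inner ℝ s X / (‖s‖ * c) with hy
  have habs : |inner ℝ s X| ≤ ‖s‖ * c :=
    (abs_real_inner_le_norm s X).trans (by gcongr)
  have hy1 : y ≤ 1 := by
    rw [hy, div_le_one (by positivity)]; exact (abs_le.1 habs).2
  have hy2 : -1 ≤ y := by
    rw [hy, le_div_iff₀ (by positivity)]; linarith [(abs_le.1 habs).1]
  have hin : inner ℝ s X = y * (‖s‖ * c) := by
    rw [hy]; field_simp
  have hX2 : ‖X‖ ^ 2 ≤ c ^ 2 := by gcongr
  have key := cosh_convex_sq (A := lam * ‖s‖ + lam * c) (B := lam * ‖s‖ - lam * c)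
    (M := lam * ‖s + X‖) (α := (1 + y) / 2) (β := (1 - y) / 2) (by linarith) (by linarith) (by ring)
    (by
      have h3 : ‖s + X‖ ^ 2 ≤ ‖s‖ ^ 2 + 2 * (y * (‖s‖ * c)) + c ^ 2 := by
        rw [norm_add_sq_real, hin]; linarith
      have h4 := mul_le_mul_of_nonneg_left h3 (sq_nonneg lam)
      nlinarith [h4])
  refine key.trans (le_of_eq ?_)
  rw [Real.cosh_add, Real.cosh_sub, hy]
  field_simp
  ring

variable [CompleteSpace E] [MeasurableSpace E] [BorelSpace E] [SecondCountableTopology E]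
variable {Ξ : Type*} [MeasurableSpace Ξ]

/-- A vector-valued Hoeffding lemma: a centered increment of norm at most `c` multiplies the
expectation of `cosh (lam * ‖s‖)` by at most `exp (lam² c² / 2)`, whatever the dimension. -/
theorem lintegral_cosh_add_le (P : Measure Ξ) [IsProbabilityMeasure P] {X : Ξ → E}
    (hX : Measurable X) {c : ℝ} (hc : 0 < c) (hXc : ∀ ξ, ‖X ξ‖ ≤ c) (h0 : ∫ ξ, X ξ ∂P = 0)
    (lam : ℝ) (s : E) :
    ∫⁻ ξ, ENNReal.ofReal (Real.cosh (lam * ‖s + X ξ‖)) ∂P ≤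
      ENNReal.ofReal (Real.exp (lam ^ 2 * c ^ 2 / 2) * Real.cosh (lam * ‖s‖)) := by
  obtain ⟨K, hK⟩ := cosh_norm_add_le s hc lam
  have hXi : Integrable X P :=
    Integrable.of_bound hX.aestronglyMeasurable c (Filter.Eventually.of_forall hXc)
  have hi : Integrable (fun ξ => K * inner ℝ s (X ξ)) P := (hXi.const_inner s).const_mul K
  have hint : Integrable (fun ξ => Real.cosh (lam * ‖s + X ξ‖)) P := by
    refine Integrable.mono' ((integrable_const
      (Real.cosh (lam * ‖s‖) * Real.cosh (lam * c))).add hi) ?_ ?_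
    · exact (Real.measurable_cosh.comp ((hX.const_add s).norm.const_mul lam)).aestronglyMeasurable
    · refine Filter.Eventually.of_forall fun ξ => ?_
      rw [Real.norm_of_nonneg (Real.cosh_pos _).le]
      exact hK _ (hXc ξ)
  rw [← ofReal_integral_eq_lintegral_ofReal hint
    (Filter.Eventually.of_forall fun ξ => (Real.cosh_pos _).le)]
  apply ENNReal.ofReal_le_ofReal
  calc ∫ ξ, Real.cosh (lam * ‖s + X ξ‖) ∂P
      ≤ ∫ ξ, (Real.cosh (lam * ‖s‖) * Real.cosh (lam * c) + K * inner ℝ s (X ξ)) ∂P :=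
        integral_mono hint ((integrable_const _).add hi) fun ξ => hK _ (hXc ξ)
    _ = Real.cosh (lam * ‖s‖) * Real.cosh (lam * c) := by
        rw [integral_add (integrable_const _) hi,
          integral_const_mul K (fun ξ => (inner ℝ s (X ξ) : ℝ)), integral_inner hXi, h0]
        simp
    _ ≤ Real.cosh (lam * ‖s‖) * Real.exp ((lam * c) ^ 2 / 2) := by
        exact mul_le_mul_of_nonneg_left (Real.cosh_le_exp_half_sq _) (Real.cosh_pos _).le
    _ = _ := by rw [mul_comm, mul_pow]

/-! ### Sequences of independent seeds -/

/-- Prepend a term to a sequence. -/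
def seqCons {Θ : Type*} (θ : Θ) (ω : ℕ → Θ) : ℕ → Θ
  | 0 => θ
  | n + 1 => ω n

variable {Θ : Type*} [MeasurableSpace Θ]

theorem measurable_seqCons :
    Measurable (fun q : Θ × (ℕ → Θ) => seqCons q.1 q.2) := by
  refine measurable_pi_lambda _ fun n => ?_
  cases n with
  | zero => exact measurable_fst
  | succ n => exact (measurable_pi_apply n).comp measurable_snd

/-- Prepending an independent term with the same law does not change the law of an i.i.d.
sequence. -/
theorem map_seqCons (μ : Measure Θ) [IsProbabilityMeasure μ] :
    (μ.prod (Measure.infinitePi fun _ : ℕ => μ)).map (fun q => seqCons q.1 q.2) =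
      Measure.infinitePi fun _ : ℕ => μ := by
  refine Measure.eq_infinitePi _ fun s t ht => ?_
  rw [Measure.map_apply measurable_seqCons
    (MeasurableSet.pi s.countable_toSet fun i _ => ht i)]
  classical
  set s' : Finset ℕ := (s.erase 0).image Nat.pred with hs'
  have himg : s.erase 0 = s'.image Nat.succ := by
    ext n
    simp only [hs', Finset.mem_image, Finset.mem_erase]
    constructor
    · rintro ⟨h0, h⟩
      exact ⟨n.pred, ⟨n, ⟨h0, h⟩, rfl⟩, Nat.succ_pred h0⟩
    · rintro ⟨k, ⟨j, ⟨hj0, hj⟩, rfl⟩, rfl⟩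
      rw [Nat.succ_pred hj0]; exact ⟨hj0, hj⟩
  have hpre : (fun q : Θ × (ℕ → Θ) => seqCons q.1 q.2) ⁻¹' ((s : Set ℕ).pi t) =
      (if 0 ∈ s then t 0 else Set.univ) ×ˢ ((s' : Set ℕ).pi fun i => t (i + 1)) := by
    ext ⟨θ, ω⟩
    simp only [Set.mem_preimage, Set.mem_pi, Finset.mem_coe, Set.mem_prod]
    constructor
    · intro h
      refine ⟨?_, fun i hi => ?_⟩
      · split_ifs with h0
        · exact h 0 h0
        · trivial
      · have : i + 1 ∈ s.erase 0 := by rw [himg]; exact Finset.mem_image_of_mem _ hi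
        exact h (i + 1) (Finset.mem_of_mem_erase this)
    · rintro ⟨h0, h⟩ i hi
      cases i with
      | zero => rw [if_pos hi] at h0; exact h0
      | succ i =>
        have h1 : i + 1 ∈ s.erase 0 := Finset.mem_erase.2 ⟨by omega, hi⟩
        rw [himg, Finset.mem_image] at h1
        obtain ⟨j, hj, hji⟩ := h1
        have : j = i := Nat.succ_injective hji
        exact h i (this ▸ hj)
  rw [hpre, Measure.prod_prod, Measure.infinitePi_pi _ fun i _ => ht (i + 1)]
  have hprod : ∏ i ∈ s.erase 0, μ (t i) = ∏ i ∈ s', μ (t (i + 1)) := by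
    rw [himg, Finset.prod_image (fun a _ b _ h => Nat.succ_injective h)]
  rw [← hprod]
  split_ifs with h0
  · exact Finset.mul_prod_erase s (fun i => μ (t i)) h0
  · rw [measure_univ, one_mul, Finset.erase_eq_of_notMem h0]

theorem lintegral_seqCons (μ : Measure Θ) [IsProbabilityMeasure μ] {g : (ℕ → Θ) → ENNReal}
    (hg : Measurable g) :
    ∫⁻ ω, g ω ∂(Measure.infinitePi fun _ : ℕ => μ) =
      ∫⁻ θ, ∫⁻ ω, g (seqCons θ ω) ∂(Measure.infinitePi fun _ : ℕ => μ) ∂μ := by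
  conv_lhs => rw [← map_seqCons μ]
  rw [lintegral_map hg measurable_seqCons,
    lintegral_prod (fun q : Θ × (ℕ → Θ) => g (seqCons q.1 q.2))
      (hg.comp measurable_seqCons).aemeasurable]

theorem lintegral_cosh_add_sum_le (P : Measure Ξ) [IsProbabilityMeasure P] {X : Ξ → E}
    (hX : Measurable X) {c : ℝ} (hc : 0 < c) (hXc : ∀ ξ, ‖X ξ‖ ≤ c) (h0 : ∫ ξ, X ξ ∂P = 0)
    (lam : ℝ) (n : ℕ) (s : E) :
    ∫⁻ ξ, ENNReal.ofReal (Real.cosh (lam * ‖s + ∑ i ∈ Finset.range n, X (ξ i)‖))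
        ∂(Measure.infinitePi fun _ : ℕ => P) ≤
      ENNReal.ofReal (Real.exp (n * (lam ^ 2 * c ^ 2 / 2)) * Real.cosh (lam * ‖s‖)) := by
  have hmeas : ∀ (n : ℕ) (s : E), Measurable fun ξ : ℕ → Ξ =>
      ENNReal.ofReal (Real.cosh (lam * ‖s + ∑ i ∈ Finset.range n, X (ξ i)‖)) := by
    intro n s
    refine (Real.measurable_cosh.comp (Measurable.const_mul (Measurable.norm
      (Measurable.const_add (Finset.measurable_fun_sum _ fun i _ => ?_) s)) lam)).ennreal_ofReal
    exact hX.comp (measurable_pi_apply i)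
  induction n generalizing s with
  | zero => simp
  | succ n ih =>
    rw [lintegral_seqCons P (hmeas (n + 1) s)]
    calc _ ≤ ∫⁻ θ, ENNReal.ofReal (Real.exp (n * (lam ^ 2 * c ^ 2 / 2))) *
          ENNReal.ofReal (Real.cosh (lam * ‖s + X θ‖)) ∂P := by
          refine lintegral_mono fun θ => ?_
          rw [← ENNReal.ofReal_mul (Real.exp_pos _).le]
          refine le_trans (le_of_eq ?_) (ih (s + X θ))
          refine lintegral_congr fun ω => ?_
          rw [Finset.sum_range_succ']
          simp only [seqCons]
          rw [add_assoc, add_comm (X θ)]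
      _ ≤ ENNReal.ofReal (Real.exp (n * (lam ^ 2 * c ^ 2 / 2))) *
          ENNReal.ofReal (Real.exp (lam ^ 2 * c ^ 2 / 2) * Real.cosh (lam * ‖s‖)) := by
          rw [lintegral_const_mul' _ _ ENNReal.ofReal_ne_top]
          gcongr
          exact lintegral_cosh_add_le P hX hc hXc h0 lam s
      _ = _ := by
          rw [← ENNReal.ofReal_mul (Real.exp_pos _).le, ← mul_assoc, ← Real.exp_add]
          congr 3
          push_cast
          ring_nf

/-! ### Markov chains driven by independent seeds -/

/-- The Markov chain with initial state `g₀ (ω 0)` and transitions `Φ (ω (n + 1))`. -/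
def chain {S : Type*} (g₀ : Θ → S) (Φ : Θ → S → S) (ω : ℕ → Θ) : ℕ → S
  | 0 => g₀ (ω 0)
  | n + 1 => Φ (ω (n + 1)) (chain g₀ Φ ω n)

variable {S : Type*} [MeasurableSpace S] {g₀ : Θ → S} {Φ : Θ → S → S}

theorem measurable_chain (hg₀ : Measurable g₀) (hΦ : Measurable (Function.uncurry Φ)) (n : ℕ) :
    Measurable fun ω => chain g₀ Φ ω n := by
  induction n with
  | zero => exact hg₀.comp (measurable_pi_apply 0)
  | succ n ih => exact hΦ.comp ((measurable_pi_apply (n + 1)).prodMk ih)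

/-- Markov property: given the state at time `n`, the later seeds are a fresh i.i.d. sequence. -/
theorem lintegral_chain_shift (μ : Measure Θ) [IsProbabilityMeasure μ]
    (hg₀ : Measurable g₀) (hΦ : Measurable (Function.uncurry Φ)) (n : ℕ)
    {g : S → (ℕ → Θ) → ENNReal} (hg : Measurable (Function.uncurry g)) :
    ∫⁻ ω, g (chain g₀ Φ ω n) (fun i => ω (n + 1 + i)) ∂(Measure.infinitePi fun _ : ℕ => μ) =
      ∫⁻ ω, ∫⁻ ω', g (chain g₀ Φ ω n) ω' ∂(Measure.infinitePi fun _ : ℕ => μ)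
        ∂(Measure.infinitePi fun _ : ℕ => μ) := by
  induction n generalizing g with
  | zero =>
    have h1 : Measurable fun ω : ℕ → Θ => g (g₀ (ω 0)) (fun i => ω (0 + 1 + i)) :=
      hg.comp ((hg₀.comp (measurable_pi_apply 0)).prodMk
        (measurable_pi_lambda _ fun i => measurable_pi_apply _))
    have h2 : Measurable fun ω : ℕ → Θ =>
        ∫⁻ ω', g (g₀ (ω 0)) ω' ∂(Measure.infinitePi fun _ : ℕ => μ) :=
      (Measurable.lintegral_prod_right' (f := Function.uncurry g) hg).comp
        (hg₀.comp (measurable_pi_apply 0))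
    simp only [chain]
    rw [lintegral_seqCons μ h1, lintegral_seqCons μ h2]
    refine lintegral_congr fun θ => ?_
    have h3 : ∀ (ω : ℕ → Θ), (fun i => seqCons θ ω (0 + 1 + i)) = ω := by
      intro ω; funext i; rw [zero_add, add_comm]; rfl
    simp only [h3]
    simp [seqCons]
  | succ n ih =>
    set Q := Measure.infinitePi fun _ : ℕ => μ with hQ
    have hev : Measurable fun q : S × (ℕ → Θ) => q.2 0 :=
      (measurable_pi_apply 0).comp measurable_snd
    have hm1 : Measurable (Function.uncurry
        fun (s : S) (ω : ℕ → Θ) => g (Φ (ω 0) s) (fun i => ω (i + 1))) := by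
      refine hg.comp (Measurable.prodMk ?_ ?_)
      · exact hΦ.comp (hev.prodMk measurable_fst)
      · exact measurable_pi_lambda _ fun i => (measurable_pi_apply _).comp measurable_snd
    have hin : Measurable (fun s : S => ∫⁻ ω', g s ω' ∂Q) :=
      Measurable.lintegral_prod_right' (f := Function.uncurry g) hg
    have hm2 : Measurable (Function.uncurry
        fun (s : S) (ω : ℕ → Θ) => ∫⁻ ω', g (Φ (ω 0) s) ω' ∂Q) :=
      hin.comp (hΦ.comp (hev.prodMk measurable_fst))
    have e1 := ih hm1
    have e2 := ih hm2
    have lhs : (fun ω : ℕ → Θ => g (chain g₀ Φ ω (n + 1)) (fun i => ω (n + 1 + 1 + i))) =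
        fun ω => g (Φ (ω (n + 1 + 0)) (chain g₀ Φ ω n)) (fun i => ω (n + 1 + (i + 1))) := by
      funext ω
      simp only [chain, add_zero]
      congr 2
      funext i
      congr 1
      ring
    rw [lhs, e1]
    have rhs : (fun ω : ℕ → Θ => ∫⁻ ω', g (chain g₀ Φ ω (n + 1)) ω' ∂Q) =
        fun ω => ∫⁻ ω', g (Φ (ω (n + 1 + 0)) (chain g₀ Φ ω n)) ω' ∂Q := by
      funext ω; simp only [chain, add_zero]
    rw [rhs, e2]
    refine lintegral_congr fun ω => ?_
    have k1 : Measurable fun ω' : ℕ → Θ =>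
        g (Φ (ω' 0) (chain g₀ Φ ω n)) (fun i => ω' (i + 1)) :=
      hm1.comp (measurable_const.prodMk measurable_id)
    have k2 : Measurable fun ω' : ℕ → Θ => ∫⁻ ω'', g (Φ (ω' 0) (chain g₀ Φ ω n)) ω'' ∂Q :=
      hm2.comp (measurable_const.prodMk measurable_id)
    rw [lintegral_seqCons μ k1, lintegral_seqCons μ k2]
    refine lintegral_congr fun θ => ?_
    simp [seqCons, hQ]

theorem lintegral_chain_succ (μ : Measure Θ) [IsProbabilityMeasure μ]
    (hg₀ : Measurable g₀) (hΦ : Measurable (Function.uncurry Φ)) (n : ℕ)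
    {G : S → ENNReal} (hG : Measurable G) :
    ∫⁻ ω, G (chain g₀ Φ ω (n + 1)) ∂(Measure.infinitePi fun _ : ℕ => μ) =
      ∫⁻ ω, ∫⁻ θ, G (Φ θ (chain g₀ Φ ω n)) ∂μ ∂(Measure.infinitePi fun _ : ℕ => μ) := by
  have hev : Measurable fun q : S × (ℕ → Θ) => q.2 0 :=
    (measurable_pi_apply 0).comp measurable_snd
  have hm : Measurable (Function.uncurry fun (s : S) (ω : ℕ → Θ) => G (Φ (ω 0) s)) :=
    hG.comp (hΦ.comp (hev.prodMk measurable_fst))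
  have h := lintegral_chain_shift μ hg₀ hΦ n hm
  simp only [add_zero] at h
  simp only [chain]
  rw [h]
  refine lintegral_congr fun ω => ?_
  have k1 : Measurable fun ω' : ℕ → Θ => G (Φ (ω' 0) (chain g₀ Φ ω n)) :=
    hm.comp (measurable_const.prodMk measurable_id)
  rw [lintegral_seqCons μ k1]
  simp [seqCons]

/-- The law of the chain satisfies an exponential bound for all exponents, provided that the
one-step bound contracts the exponent by a factor `κ`. -/
theorem lintegral_chain_le_one (μ : Measure Θ) [IsProbabilityMeasure μ]
    (hg₀ : Measurable g₀) (hΦ : Measurable (Function.uncurry Φ))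
    {G : ℝ → S → ENNReal} (hG : ∀ lam, Measurable (G lam)) (κ : ℝ)
    (h0 : ∀ lam, ∫⁻ θ, G lam (g₀ θ) ∂μ ≤ 1)
    (h1 : ∀ lam ω n, ∫⁻ θ, G lam (Φ θ (chain g₀ Φ ω n)) ∂μ ≤ G (κ * lam) (chain g₀ Φ ω n))
    (lam : ℝ) (n : ℕ) :
    ∫⁻ ω, G lam (chain g₀ Φ ω n) ∂(Measure.infinitePi fun _ : ℕ => μ) ≤ 1 := by
  induction n generalizing lam with
  | zero =>
    have hm : Measurable fun ω : ℕ → Θ => G lam (g₀ (ω 0)) :=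
      (hG lam).comp (hg₀.comp (measurable_pi_apply 0))
    simp only [chain]
    rw [lintegral_seqCons μ hm]
    simpa [seqCons] using h0 lam
  | succ n ih =>
    rw [lintegral_chain_succ μ hg₀ hΦ n (hG lam)]
    exact (lintegral_mono fun ω => h1 lam ω n).trans (ih (κ * lam))

end

section

/-! ### Smooth functions and differentiation under the integral sign -/

section Taylor

variable {E F : Type*} [NormedAddCommGroup E] [NormedSpace ℝ E] [NormedAddCommGroup F]
  [NormedSpace ℝ F]

theorem norm_sub_sub_apply_le {G : E → F} {G' : E → E →L[ℝ] F} {K : ℝ}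
    (hG : ∀ x, HasFDerivAt G (G' x) x) (hK : ∀ x y, ‖G' x - G' y‖ ≤ K * ‖x - y‖) (hK0 : 0 ≤ K)
    {x₀ x y : E} {R : ℝ} (hx : ‖x - x₀‖ ≤ R) (hy : ‖y - x₀‖ ≤ R) :
    ‖G y - G x - G' x₀ (y - x)‖ ≤ K * R * ‖y - x‖ := by
  refine (convex_closedBall x₀ R).norm_image_sub_le_of_norm_hasFDerivWithin_le'
    (fun z _ => (hG z).hasFDerivWithinAt) (fun z hz => (hK z x₀).trans ?_) ?_ ?_
  · gcongr
    exact mem_closedBall_iff_norm.1 hz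
  · exact mem_closedBall_iff_norm.2 hx
  · exact mem_closedBall_iff_norm.2 hy

theorem norm_sub_sub_apply_le_sq {G : E → F} {G' : E → E →L[ℝ] F} {K : ℝ}
    (hG : ∀ x, HasFDerivAt G (G' x) x) (hK : ∀ x y, ‖G' x - G' y‖ ≤ K * ‖x - y‖) (hK0 : 0 ≤ K)
    (x y : E) : ‖G y - G x - G' x (y - x)‖ ≤ K * ‖y - x‖ ^ 2 := by
  have h := norm_sub_sub_apply_le hG hK hK0 (x₀ := x) (x := x) (y := y) (R := ‖y - x‖)
    (by simp) le_rfl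
  rwa [mul_assoc, ← sq] at h

theorem hasFDerivAt_of_norm_sub_sub_le_sq {G : E → F} {A : E →L[ℝ] F} {K : ℝ} {x : E}
    (h : ∀ y, ‖G y - G x - A (y - x)‖ ≤ K * ‖y - x‖ ^ 2) : HasFDerivAt G A x := by
  have h1 : HasFDerivAt (fun y => G y - G x - A (y - x)) (0 : E →L[ℝ] F) x := by
    refine Asymptotics.IsBigO.hasFDerivAt (n := 2)
      (Asymptotics.IsBigO.of_bound K (Filter.Eventually.of_forall fun y => ?_)) (by norm_num)
    simpa using h y
  have h2 : HasFDerivAt (fun y => A (y - x)) A x :=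
    A.hasFDerivAt.comp x ((hasFDerivAt_id x).sub_const x)
  have h3 := (h1.add h2).add_const (G x)
  rw [zero_add] at h3
  convert h3 using 1
  funext y
  simp

/-- Comparison of the increments of `G` over two nearby segments. -/
theorem norm_four_point_le {G : E → F} {G' : E → E →L[ℝ] F} {K L : ℝ}
    (hG : ∀ x, HasFDerivAt G (G' x) x) (hK : ∀ x y, ‖G' x - G' y‖ ≤ K * ‖x - y‖) (hK0 : 0 ≤ K)
    (hL : ∀ x, ‖G' x‖ ≤ L) (x₀ x₀' x₁ x₁' : E) :
    ‖(G x₁ - G x₁') - (G x₀ - G x₀')‖ ≤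
      L * ‖(x₁ - x₁') - (x₀ - x₀')‖ + K * (‖x₁ - x₀‖ + ‖x₁' - x₀'‖) * ‖x₀ - x₀'‖ := by
  set γ₀ : ℝ → E := fun t => x₀' + t • (x₀ - x₀') with hγ₀
  set γ₁ : ℝ → E := fun t => x₁' + t • (x₁ - x₁') with hγ₁
  have hd : ∀ (a v : E) (t : ℝ), HasDerivAt (fun t : ℝ => a + t • v) v t := by
    intro a v t
    simpa using ((hasDerivAt_id t).smul_const v).const_add a
  have hdiff : ∀ t ∈ Set.Icc (0 : ℝ) 1, HasDerivWithinAt (fun t => G (γ₁ t) - G (γ₀ t))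
      (G' (γ₁ t) (x₁ - x₁') - G' (γ₀ t) (x₀ - x₀')) (Set.Icc 0 1) t := fun t _ =>
    (((hG _).comp_hasDerivAt t (hd x₁' (x₁ - x₁') t)).sub
      ((hG _).comp_hasDerivAt t (hd x₀' (x₀ - x₀') t))).hasDerivWithinAt
  have hb : ∀ t ∈ Set.Ico (0 : ℝ) 1,
      ‖G' (γ₁ t) (x₁ - x₁') - G' (γ₀ t) (x₀ - x₀')‖ ≤
        L * ‖(x₁ - x₁') - (x₀ - x₀')‖ + K * (‖x₁ - x₀‖ + ‖x₁' - x₀'‖) * ‖x₀ - x₀'‖ := by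
    intro t ht
    have e : G' (γ₁ t) (x₁ - x₁') - G' (γ₀ t) (x₀ - x₀') =
        G' (γ₁ t) ((x₁ - x₁') - (x₀ - x₀')) + (G' (γ₁ t) - G' (γ₀ t)) (x₀ - x₀') := by
      simp only [map_sub, sub_apply]; abel
    have hγ : γ₁ t - γ₀ t = t • (x₁ - x₀) + (1 - t) • (x₁' - x₀') := by
      simp only [hγ₀, hγ₁]; module
    have hn : ‖γ₁ t - γ₀ t‖ ≤ ‖x₁ - x₀‖ + ‖x₁' - x₀'‖ := by
      rw [hγ]
      refine (norm_add_le _ _).trans ?_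
      rw [norm_smul, norm_smul, Real.norm_of_nonneg ht.1, Real.norm_of_nonneg (by linarith [ht.2])]
      nlinarith [norm_nonneg (x₁ - x₀), norm_nonneg (x₁' - x₀'), ht.1, ht.2]
    rw [e]
    refine (norm_add_le _ _).trans (add_le_add ?_ ?_)
    · exact (ContinuousLinearMap.le_opNorm _ _).trans (by gcongr; exact hL _)
    · refine (ContinuousLinearMap.le_opNorm _ _).trans ?_
      gcongr
      exact (hK _ _).trans (by gcongr)
  have h := norm_image_sub_le_of_norm_deriv_le_segment' hdiff hb 1 (by simp)
  simp only [hγ₀, hγ₁, one_smul, zero_smul, add_zero, add_sub_cancel, sub_zero, mul_one] at h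
  convert h using 2
  abel

theorem measurable_hasFDerivAt_apply [MeasurableSpace F] [BorelSpace F]
    [SecondCountableTopology F] {Ξ : Type*} [MeasurableSpace Ξ]
    {G : E → Ξ → F} {G' : E → Ξ → E →L[ℝ] F} (hG : ∀ x ξ, HasFDerivAt (fun y => G y ξ) (G' x ξ) x)
    (hm : ∀ x, Measurable (G x)) (x v : E) : Measurable fun ξ => G' x ξ v := by
  refine measurable_of_tendsto_metrizable' (f := fun (n : ℕ) ξ =>
    (n : ℝ) • (G (x + (n : ℝ)⁻¹ • v) ξ - G x ξ)) Filter.atTop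
    (fun n => ((hm _).sub (hm _)).const_smul _) ?_
  rw [tendsto_pi_nhds]
  intro ξ
  exact ((hG x ξ).lim_real v).comp tendsto_natCast_atTop_atTop

end Taylor

variable {d : ℕ}

theorem fderiv_eq_inner_gradient (φ : Point d → ℝ) (x v : Point d) :
    fderiv ℝ φ x v = inner ℝ (gradient φ x) v := by
  rw [gradient, InnerProductSpace.toDual_symm_apply]

theorem norm_fderiv_sub_eq (φ : Point d → ℝ) (x y : Point d) :
    ‖fderiv ℝ φ x - fderiv ℝ φ y‖ = ‖gradient φ x - gradient φ y‖ := by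
  rw [gradient, gradient, ← map_sub, LinearIsometryEquiv.norm_map]

/-- A function with `L`-Lipschitz gradient and `ρ`-Lipschitz Hessian. -/
structure IsSmooth (F : Point d → ℝ) (L ρ : ℝ) : Prop where
  differentiable : Differentiable ℝ F
  differentiable_gradient : Differentiable ℝ (gradient F)
  gradient_lipschitz : ∀ x y, ‖gradient F x - gradient F y‖ ≤ L * ‖x - y‖
  hessian_lipschitz : ∀ x y, ‖hessian F x - hessian F y‖ ≤ ρ * ‖x - y‖

namespace IsSmooth

variable {F : Point d → ℝ} {L ρ : ℝ} (hF : IsSmooth F L ρ)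
include hF

theorem hasFDerivAt_gradient (x : Point d) : HasFDerivAt (gradient F) (hessian F x) x :=
  (hF.differentiable_gradient x).hasFDerivAt

theorem norm_hessian_le (hL : 0 ≤ L) (x : Point d) : ‖hessian F x‖ ≤ L := by
  have h : LipschitzWith L.toNNReal (gradient F) := by
    refine LipschitzWith.of_dist_le_mul fun x y => ?_
    rw [dist_eq_norm, dist_eq_norm, Real.coe_toNNReal _ hL]
    exact hF.gradient_lipschitz x y
  have := norm_fderiv_le_of_lipschitz ℝ (x₀ := x) h
  rwa [Real.coe_toNNReal _ hL] at this

theorem abs_sub_sub_inner_le (hL : 0 ≤ L) (x y : Point d) :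
    |F y - F x - inner ℝ (gradient F x) (y - x)| ≤ L * ‖y - x‖ ^ 2 := by
  have h := norm_sub_sub_apply_le_sq (fun x => (hF.differentiable x).hasFDerivAt)
    (fun x y => (norm_fderiv_sub_eq F x y).trans_le (hF.gradient_lipschitz x y)) hL x y
  rwa [fderiv_eq_inner_gradient, Real.norm_eq_abs] at h

theorem le_add_inner_add_sq (hL : 0 ≤ L) (x y : Point d) :
    F y ≤ F x + inner ℝ (gradient F x) (y - x) + L * ‖y - x‖ ^ 2 := by
  linarith [(abs_le.1 (hF.abs_sub_sub_inner_le hL x y)).2]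

theorem hessian_symmetric (x v w : Point d) :
    inner ℝ (hessian F x v) w = inner ℝ v (hessian F x w) := by
  have h1 : ∀ y, HasFDerivAt F (fderiv ℝ F y) y := fun y => (hF.differentiable y).hasFDerivAt
  have e : fderiv ℝ F = fun y => InnerProductSpace.toDual ℝ (Point d) (gradient F y) := by
    funext y
    simp [gradient]
  let T : Point d →L[ℝ] (Point d →L[ℝ] ℝ) := LinearMap.toContinuousLinearMap
    { toFun := fun v => InnerProductSpace.toDual ℝ (Point d) v
      map_add' := fun v w => map_add _ v w
      map_smul' := fun c v => by simp }
  have h2 : HasFDerivAt (fderiv ℝ F) (T.comp (hessian F x)) x := by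
    rw [e]
    exact T.hasFDerivAt.comp x (hF.hasFDerivAt_gradient x)
  have h3 := second_derivative_symmetric h1 h2 v w
  have h4 : inner ℝ (hessian F x v) w = inner ℝ (hessian F x w) v := by
    simpa [T] using h3
  rw [h4, real_inner_comm]

end IsSmooth

section Stochastic

variable {Ξ : Type*} [MeasurableSpace Ξ] {P : Measure Ξ} [IsProbabilityMeasure P]
  {f : Point d → Ξ → ℝ} {L ρ σ : ℝ}

theorem IsSmoothLipschitz.isSmooth (hf : IsSmoothLipschitz f L ρ) (ξ : Ξ) :
    IsSmooth (fun x => f x ξ) L ρ :=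
  ⟨hf.differentiable ξ, hf.differentiable_gradient ξ, hf.gradient_lipschitz ξ,
    hf.hessian_lipschitz ξ⟩

theorem measurable_gradient (ho : IsStochasticObjective P f) (hf : IsSmoothLipschitz f L ρ)
    (x : Point d) : Measurable fun ξ => gradient (fun y => f y ξ) x := by
  have h : Measurable fun ξ => WithLp.ofLp (gradient (fun y => f y ξ) x) := by
    refine measurable_pi_lambda _ fun i => ?_
    have h1 := measurable_hasFDerivAt_apply
      (G' := fun x ξ => fderiv ℝ (fun y => f y ξ) x)
      (fun x ξ => (hf.differentiable ξ x).hasFDerivAt) ho.measurable x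
      (EuclideanSpace.single i (1 : ℝ))
    simp only [fderiv_eq_inner_gradient, EuclideanSpace.inner_single_right] at h1
    simpa using h1
  exact (WithLp.measurable_toLp 2 (Fin d → ℝ)).comp h

theorem measurable_uncurry_gradient (ho : IsStochasticObjective P f)
    (hf : IsSmoothLipschitz f L ρ) :
    Measurable fun q : Point d × Ξ => gradient (fun y => f y q.2) q.1 :=
  measurable_uncurry_of_continuous_of_measurable
    (u := fun x ξ => gradient (fun y => f y ξ) x)
    (fun ξ => (hf.differentiable_gradient ξ).continuous) (measurable_gradient ho hf)

theorem norm_gradient_sub_le (hσ : 0 ≤ σ) (hd : HasBoundedDeviation P f σ) (x : Point d) (ξ : Ξ) :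
    ‖gradient (fun y => f y ξ) x - gradient (objective P f) x‖ ≤ σ :=
  (sq_le_sq₀ (norm_nonneg _) hσ).1 (hd x ξ)

theorem integrable_gradient (ho : IsStochasticObjective P f) (hf : IsSmoothLipschitz f L ρ)
    (hσ : 0 ≤ σ) (hd : HasBoundedDeviation P f σ) (x : Point d) :
    Integrable (fun ξ => gradient (fun y => f y ξ) x) P := by
  refine Integrable.of_bound (measurable_gradient ho hf x).aestronglyMeasurable
    (σ + ‖gradient (objective P f) x‖) (Filter.Eventually.of_forall fun ξ => ?_)
  have h := norm_gradient_sub_le hσ hd x ξ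
  calc ‖gradient (fun y => f y ξ) x‖ = ‖(gradient (fun y => f y ξ) x -
        gradient (objective P f) x) + gradient (objective P f) x‖ := by rw [sub_add_cancel]
    _ ≤ _ := (norm_add_le _ _).trans (by gcongr)

theorem hasGradientAt_objective (ho : IsStochasticObjective P f) (hf : IsSmoothLipschitz f L ρ)
    (hL : 0 ≤ L) (hσ : 0 ≤ σ) (hd : HasBoundedDeviation P f σ) (x : Point d) :
    HasGradientAt (objective P f) (∫ ξ, gradient (fun y => f y ξ) x ∂P) x := by
  rw [hasGradientAt_iff_hasFDerivAt]
  refine hasFDerivAt_of_norm_sub_sub_le_sq (K := L) fun y => ?_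
  have hgi := integrable_gradient ho hf hσ hd x
  have e : objective P f y - objective P f x - (InnerProductSpace.toDual ℝ (Point d)
      (∫ ξ, gradient (fun y => f y ξ) x ∂P)) (y - x) =
      ∫ ξ, (f y ξ - f x ξ - inner ℝ (gradient (fun y => f y ξ) x) (y - x)) ∂P := by
    have h1 : Integrable (fun ξ => f y ξ - f x ξ) P := (ho.integrable y).sub (ho.integrable x)
    rw [integral_sub h1 (hgi.inner_const (y - x)),
      integral_sub (ho.integrable y) (ho.integrable x), InnerProductSpace.toDual_apply_apply,
      real_inner_comm, ← integral_inner hgi]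
    simp only [objective, real_inner_comm]
  rw [e]
  refine (norm_integral_le_of_norm_le_const (C := L * ‖y - x‖ ^ 2)
    (Filter.Eventually.of_forall fun ξ => ?_)).trans (by simp)
  exact (hf.isSmooth ξ).abs_sub_sub_inner_le hL x y

theorem gradient_objective (ho : IsStochasticObjective P f) (hf : IsSmoothLipschitz f L ρ)
    (hL : 0 ≤ L) (hσ : 0 ≤ σ) (hd : HasBoundedDeviation P f σ) (x : Point d) :
    gradient (objective P f) x = ∫ ξ, gradient (fun y => f y ξ) x ∂P :=
  (hasGradientAt_objective ho hf hL hσ hd x).gradient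

theorem integrable_hessian_apply (ho : IsStochasticObjective P f) (hf : IsSmoothLipschitz f L ρ)
    (hL : 0 ≤ L) (x v : Point d) :
    Integrable (fun ξ => hessian (fun y => f y ξ) x v) P := by
  refine Integrable.of_bound (C := L * ‖v‖) ?_ (Filter.Eventually.of_forall fun ξ => ?_)
  · exact (measurable_hasFDerivAt_apply (G' := fun x ξ => hessian (fun y => f y ξ) x)
      (fun x ξ => (hf.isSmooth ξ).hasFDerivAt_gradient x)
      (measurable_gradient ho hf) x v).aestronglyMeasurable
  · exact (ContinuousLinearMap.le_opNorm _ _).trans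
      (by gcongr; exact (hf.isSmooth ξ).norm_hessian_le hL x)

/-- The expectation of the random Hessian. -/
def meanHessian (ho : IsStochasticObjective P f) (hf : IsSmoothLipschitz f L ρ)
    (hL : 0 ≤ L) (x : Point d) : Point d →L[ℝ] Point d :=
  LinearMap.toContinuousLinearMap
    { toFun := fun v => ∫ ξ, hessian (fun y => f y ξ) x v ∂P
      map_add' := fun v w => by
        simp only [map_add]
        exact integral_add (integrable_hessian_apply ho hf hL x v)
          (integrable_hessian_apply ho hf hL x w)
      map_smul' := fun c v => by
        simp only [map_smul, RingHom.id_apply]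
        exact integral_smul c _ }

theorem meanHessian_apply (ho : IsStochasticObjective P f) (hf : IsSmoothLipschitz f L ρ)
    (hL : 0 ≤ L) (x v : Point d) :
    meanHessian ho hf hL x v = ∫ ξ, hessian (fun y => f y ξ) x v ∂P := rfl

theorem hasFDerivAt_gradient_objective (ho : IsStochasticObjective P f)
    (hf : IsSmoothLipschitz f L ρ) (hL : 0 ≤ L) (hρ : 0 ≤ ρ) (hσ : 0 ≤ σ)
    (hd : HasBoundedDeviation P f σ) (x : Point d) :
    HasFDerivAt (gradient (objective P f)) (meanHessian ho hf hL x) x := by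
  refine hasFDerivAt_of_norm_sub_sub_le_sq (K := ρ) fun y => ?_
  have h1 : Integrable (fun ξ => gradient (fun z => f z ξ) y - gradient (fun z => f z ξ) x) P :=
    (integrable_gradient ho hf hσ hd y).sub (integrable_gradient ho hf hσ hd x)
  rw [gradient_objective ho hf hL hσ hd, gradient_objective ho hf hL hσ hd, meanHessian_apply,
    ← integral_sub (integrable_gradient ho hf hσ hd y) (integrable_gradient ho hf hσ hd x),
    ← integral_sub h1
      (integrable_hessian_apply ho hf hL x (y - x))]
  refine (norm_integral_le_of_norm_le_const (C := ρ * ‖y - x‖ ^ 2)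
    (Filter.Eventually.of_forall fun ξ => ?_)).trans (by simp)
  exact norm_sub_sub_apply_le_sq (hf.isSmooth ξ).hasFDerivAt_gradient (hf.hessian_lipschitz ξ) hρ x y

theorem isSmooth_objective (ho : IsStochasticObjective P f)
    (hf : IsSmoothLipschitz f L ρ) (hL : 0 ≤ L) (hρ : 0 ≤ ρ) (hσ : 0 ≤ σ)
    (hd : HasBoundedDeviation P f σ) : IsSmooth (objective P f) L ρ where
  differentiable x := (hasGradientAt_objective ho hf hL hσ hd x).differentiableAt
  differentiable_gradient x :=
    (hasFDerivAt_gradient_objective ho hf hL hρ hσ hd x).differentiableAt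
  gradient_lipschitz x y := by
    rw [gradient_objective ho hf hL hσ hd, gradient_objective ho hf hL hσ hd,
      ← integral_sub (integrable_gradient ho hf hσ hd x) (integrable_gradient ho hf hσ hd y)]
    exact (norm_integral_le_of_norm_le_const (C := L * ‖x - y‖)
      (Filter.Eventually.of_forall fun ξ => hf.gradient_lipschitz ξ x y)).trans (by simp)
  hessian_lipschitz x y := by
    have e : ∀ x, hessian (objective P f) x = meanHessian ho hf hL x := fun x =>
      (hasFDerivAt_gradient_objective ho hf hL hρ hσ hd x).fderiv
    refine ContinuousLinearMap.opNorm_le_bound _ (by positivity) fun v => ?_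
    rw [e, e, sub_apply, meanHessian_apply, meanHessian_apply,
      ← integral_sub (integrable_hessian_apply ho hf hL x v)
        (integrable_hessian_apply ho hf hL y v)]
    refine (norm_integral_le_of_norm_le_const (C := ρ * ‖x - y‖ * ‖v‖)
      (Filter.Eventually.of_forall fun ξ => ?_)).trans (by simp)
    rw [← sub_apply]
    exact (ContinuousLinearMap.le_opNorm _ _).trans
      (by gcongr; exact hf.hessian_lipschitz ξ x y)

end Stochastic

end

section

/-! ### The error of the STORM estimator -/

variable {d : ℕ} {Ξ : Type*} [MeasurableSpace Ξ] {P : Measure Ξ} [IsProbabilityMeasure P]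
  {f : Point d → Ξ → ℝ} {L ρ σ : ℝ}

theorem lintegral_cosh_add_batch_le (P : Measure Ξ) [IsProbabilityMeasure P] {Z : Ξ → Point d}
    (hZ : Measurable Z) {c : ℝ} (hc : 0 ≤ c) (hZc : ∀ ξ, ‖Z ξ‖ ≤ c) (h0 : ∫ ξ, Z ξ ∂P = 0)
    (lam : ℝ) {n : ℕ} (hn : 0 < n) (s : Point d) :
    ∫⁻ ξ, ENNReal.ofReal
        (Real.cosh (lam * ‖s + (n : ℝ)⁻¹ • ∑ i ∈ Finset.range n, Z (ξ i)‖))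
        ∂(Measure.infinitePi fun _ : ℕ => P) ≤
      ENNReal.ofReal (Real.exp (lam ^ 2 * (c ^ 2 / n) / 2) * Real.cosh (lam * ‖s‖)) := by
  have hn' : (0 : ℝ) < n := by exact_mod_cast hn
  rcases hc.eq_or_lt with rfl | hc
  · simp [fun ξ => norm_le_zero_iff.1 (hZc ξ)]
  have h := lintegral_cosh_add_sum_le P (X := fun ξ => (n : ℝ)⁻¹ • Z ξ)
    (hZ.const_smul (n : ℝ)⁻¹) (c := (n : ℝ)⁻¹ * c) (by positivity) (fun ξ => by
      rw [norm_smul, Real.norm_of_nonneg (by positivity)]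
      gcongr
      exact hZc ξ) (by rw [integral_smul, h0, smul_zero]) lam n s
  simp only [← Finset.smul_sum] at h
  refine h.trans (le_of_eq ?_)
  congr 3
  field_simp

theorem measurable_batchGradient (ho : IsStochasticObjective P f) (hf : IsSmoothLipschitz f L ρ)
    (n : ℕ) : Measurable fun q : (ℕ → Ξ) × Point d => batchGradient f n q.1 q.2 := by
  unfold batchGradient
  have h : ∀ i : ℕ, Measurable fun q : (ℕ → Ξ) × Point d =>
      gradient (fun y => f y (q.1 i)) q.2 := fun i =>
    (measurable_uncurry_gradient ho hf).comp
      (measurable_snd.prodMk ((measurable_pi_apply i).comp measurable_fst))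
  exact (Finset.measurable_fun_sum _ fun i _ => h i).fun_const_smul _

theorem measurable_batchGradient_comp {α : Type*} [MeasurableSpace α]
    (ho : IsStochasticObjective P f) (hf : IsSmoothLipschitz f L ρ) (n : ℕ)
    {ξ : α → ℕ → Ξ} {x : α → Point d} (hξ : Measurable ξ) (hx : Measurable x) :
    Measurable fun q => batchGradient f n (ξ q) (x q) := by
  have h := (measurable_batchGradient ho hf n).comp (hξ.prodMk hx)
  exact h

theorem measurable_stormUpdate {α : Type*} [MeasurableSpace α]
    (ho : IsStochasticObjective P f) (hf : IsSmoothLipschitz f L ρ) (a : ℝ) (b : ℕ)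
    {ξ : α → ℕ → Ξ} {v x x' : α → Point d} (hξ : Measurable ξ) (hv : Measurable v)
    (hx : Measurable x) (hx' : Measurable x') :
    Measurable fun q => stormUpdate f a b (ξ q) (v q) (x q) (x' q) := by
  unfold stormUpdate
  have h1 := measurable_batchGradient_comp ho hf b hξ hx
  have h2 := measurable_batchGradient_comp ho hf b hξ hx'
  exact ((hv.sub h1).fun_const_smul _).add h2

theorem stormUpdate_sub_eq (F : Point d → ℝ) (a : ℝ) {b : ℕ} (hb : 0 < b) (ξ : ℕ → Ξ)
    (v x x' : Point d) :
    stormUpdate f a b ξ v x x' - gradient F x' = (1 - a) • (v - gradient F x) +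
      (b : ℝ)⁻¹ • ∑ i ∈ Finset.range b,
        ((gradient (fun y => f y (ξ i)) x' - gradient F x') -
          (1 - a) • (gradient (fun y => f y (ξ i)) x - gradient F x)) := by
  have hb' : (b : ℝ) ≠ 0 := by exact_mod_cast hb.ne'
  have h : ∀ v : Point d, (b : ℝ)⁻¹ • ∑ _i ∈ Finset.range b, v = v := by
    intro v
    rw [Finset.sum_const, Finset.card_range, ← Nat.cast_smul_eq_nsmul ℝ, smul_smul,
      inv_mul_cancel₀ hb', one_smul]
  rw [Finset.sum_sub_distrib, ← Finset.smul_sum, Finset.sum_sub_distrib, Finset.sum_sub_distrib,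
    smul_sub, smul_sub, smul_comm (b : ℝ)⁻¹ (1 - a), smul_sub (b : ℝ)⁻¹,
    smul_sub (b : ℝ)⁻¹, h, h]
  unfold stormUpdate batchGradient
  module

theorem integral_gradient_sub (ho : IsStochasticObjective P f) (hf : IsSmoothLipschitz f L ρ)
    (hL : 0 ≤ L) (hσ : 0 ≤ σ) (hd : HasBoundedDeviation P f σ) (x : Point d) :
    ∫ ξ, (gradient (fun y => f y ξ) x - gradient (objective P f) x) ∂P = 0 := by
  rw [integral_sub (integrable_gradient ho hf hσ hd x) (integrable_const _),
    ← gradient_objective ho hf hL hσ hd]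
  simp

theorem integrable_gradient_sub (ho : IsStochasticObjective P f) (hf : IsSmoothLipschitz f L ρ)
    (hσ : 0 ≤ σ) (hd : HasBoundedDeviation P f σ) (x : Point d) :
    Integrable (fun ξ => gradient (fun y => f y ξ) x - gradient (objective P f) x) P :=
  (integrable_gradient ho hf hσ hd x).sub (integrable_const _)

/-- One STORM update contracts the error by `1 - a` and adds a mean zero noise, whose samples are
bounded by `2 L ‖x' - x‖ + a σ`. -/
theorem lintegral_cosh_storm_le (ho : IsStochasticObjective P f) (hf : IsSmoothLipschitz f L ρ)
    (hρ : 0 ≤ ρ) (hL : 0 ≤ L) (hσ : 0 < σ) (hd : HasBoundedDeviation P f σ)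
    {a : ℝ} (ha : 0 < a) (ha1 : a ≤ 1) {b : ℕ} (hb : 0 < b) (lam : ℝ) (v x x' : Point d) :
    ∫⁻ ξ, ENNReal.ofReal (Real.cosh (lam *
        ‖stormUpdate f a b ξ v x x' - gradient (objective P f) x'‖))
        ∂(Measure.infinitePi fun _ : ℕ => P) ≤
      ENNReal.ofReal (Real.exp (lam ^ 2 * ((2 * L * ‖x' - x‖ + a * σ) ^ 2 / b) / 2) *
        Real.cosh ((1 - a) * lam * ‖v - gradient (objective P f) x‖)) := by
  set F := objective P f with hF
  have hFs : IsSmooth F L ρ := isSmooth_objective ho hf hL hρ hσ.le hd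
  set Z : Ξ → Point d := fun ξ => (gradient (fun y => f y ξ) x' - gradient F x') -
    (1 - a) • (gradient (fun y => f y ξ) x - gradient F x) with hZ
  have hZm : Measurable Z := ((measurable_gradient ho hf x').sub_const _).sub
    (((measurable_gradient ho hf x).sub_const _).fun_const_smul _)
  have hZ0 : ∫ ξ, Z ξ ∂P = 0 := by
    have h1 : Integrable (fun ξ => (1 - a) • (gradient (fun y => f y ξ) x - gradient F x)) P :=
      (integrable_gradient_sub ho hf hσ.le hd x).smul (1 - a)
    rw [hZ, integral_sub (integrable_gradient_sub ho hf hσ.le hd x') h1, integral_smul,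
      integral_gradient_sub ho hf hL hσ.le hd, integral_gradient_sub ho hf hL hσ.le hd]
    simp
  have hZc : ∀ ξ, ‖Z ξ‖ ≤ 2 * L * ‖x' - x‖ + a * σ := by
    intro ξ
    have e : Z ξ = (1 - a) • ((gradient (fun y => f y ξ) x' - gradient (fun y => f y ξ) x) -
        (gradient F x' - gradient F x)) + a • (gradient (fun y => f y ξ) x' - gradient F x') := by
      simp only [hZ]; module
    rw [e]
    refine (norm_add_le _ _).trans (add_le_add ?_ ?_)
    · rw [norm_smul, Real.norm_of_nonneg (by linarith)]
      have h1 := hf.gradient_lipschitz ξ x' x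
      have h2 := hFs.gradient_lipschitz x' x
      have h3 := norm_sub_le (gradient (fun y => f y ξ) x' - gradient (fun y => f y ξ) x)
        (gradient F x' - gradient F x)
      calc _ ≤ 1 * ‖_‖ := by gcongr; linarith
        _ ≤ _ := by linarith
    · rw [norm_smul, Real.norm_of_nonneg ha.le]
      gcongr
      exact norm_gradient_sub_le hσ.le hd x' ξ
  have h := lintegral_cosh_add_batch_le P hZm (c := 2 * L * ‖x' - x‖ + a * σ)
    (by positivity) hZc hZ0 lam hb ((1 - a) • (v - gradient F x))
  simp only [stormUpdate_sub_eq F a hb]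
  refine h.trans (le_of_eq ?_)
  rw [norm_smul, Real.norm_of_nonneg (by linarith : 0 ≤ 1 - a)]
  congr 3
  ring

theorem lintegral_cosh_batchGradient_le (ho : IsStochasticObjective P f)
    (hf : IsSmoothLipschitz f L ρ) (hL : 0 ≤ L) (hσ : 0 < σ) (hd : HasBoundedDeviation P f σ)
    {B : ℕ} (hB : 0 < B) (lam : ℝ) (x : Point d) :
    ∫⁻ ξ, ENNReal.ofReal (Real.cosh (lam *
        ‖batchGradient f B ξ x - gradient (objective P f) x‖))
        ∂(Measure.infinitePi fun _ : ℕ => P) ≤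
      ENNReal.ofReal (Real.exp (lam ^ 2 * (σ ^ 2 / B) / 2)) := by
  have h := lintegral_cosh_add_batch_le P
    (Z := fun ξ => gradient (fun y => f y ξ) x - gradient (objective P f) x)
    ((measurable_gradient ho hf x).sub_const _) hσ.le (norm_gradient_sub_le hσ.le hd x)
    (integral_gradient_sub ho hf hL hσ.le hd x) lam hB 0
  simp only [norm_zero, mul_zero, Real.cosh_zero, mul_one, zero_add] at h
  refine le_trans (le_of_eq (lintegral_congr fun ξ => ?_)) h
  have hB' : (B : ℝ) ≠ 0 := by exact_mod_cast hB.ne'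
  rw [Finset.sum_sub_distrib, Finset.sum_const, Finset.card_range, smul_sub,
    ← Nat.cast_smul_eq_nsmul ℝ, smul_smul, inv_mul_cancel₀ hB', one_smul]
  rfl

/-! ### The run as a Markov chain -/

/-- The data on which the continuation of a run depends: the iterate, the estimate, a tag for the
phase, and the contents of the phase (zero where the phase has none). The number of evaluations is
left out, because the continuation does not depend on it. -/
abbrev Code (d : ℕ) := Point d × Point d × ℕ × ℕ × ℝ × Point d

/-- The code of a state. -/
def State.code (st : State d) : Code d :=
  match st.phase with
  | Phase.descent => (st.x, st.dir, 0, 0, 0, 0)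
  | Phase.escape k S anchor => (st.x, st.dir, 1, k, S, anchor)
  | Phase.halted out => (st.x, st.dir, 2, 0, 0, out)

/-- The σ-algebra on the states is generated by the code. -/
instance : MeasurableSpace (State d) := MeasurableSpace.comap State.code inferInstance

theorem measurable_code : Measurable (State.code : State d → Code d) :=
  comap_measurable _

theorem measurable_state_iff {α : Type*} [MeasurableSpace α] {g : α → State d} :
    Measurable g ↔ Measurable fun q => (g q).code :=
  measurable_comap_iff

theorem measurable_state_x : Measurable fun st : State d => st.x := by
  have : (fun st : State d => st.x) = fun st => st.code.1 := by
    funext st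
    rcases st with ⟨x, v, _ | _ | _, N⟩ <;> rfl
  rw [this]
  exact measurable_fst.comp measurable_code

theorem measurable_state_dir : Measurable fun st : State d => st.dir := by
  have : (fun st : State d => st.dir) = fun st => st.code.2.1 := by
    funext st
    rcases st with ⟨x, v, _ | _ | _, N⟩ <;> rfl
  rw [this]
  exact (measurable_fst.comp measurable_snd).comp measurable_code

/-- The code of the state after a move. -/
def moveCode (prm : Params) (f : Point d → Ξ → ℝ) (ξ : ℕ → Ξ) (c : Code d) (x' : Point d)
    (t : ℕ × ℕ × ℝ × Point d) : Code d :=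
  (x', stormUpdate f prm.a prm.b ξ c.2.1 c.1 x', t)

/-- The transition of the run in terms of codes. -/
def stepCode (prm : Params) (f : Point d → Ξ → ℝ) (seed : Seed d Ξ) (c : Code d) : Code d :=
  if c.2.2.1 = 0 then
    if prm.eps < ‖c.2.1‖ then
      moveCode prm f seed.1 c (c.1 - (prm.eta / ‖c.2.1‖) • c.2.1) (0, 0, 0, 0)
    else
      moveCode prm f seed.1 c (c.1 + seed.2) (1, 0, 0, c.1)
  else if c.2.2.1 = 1 then
    if c.2.2.2.1 < prm.ell then
      if ((c.2.2.2.1 : ℝ) + 2) * prm.Dbar < c.2.2.2.2.1 + prm.etaH ^ 2 * ‖c.2.1‖ ^ 2 then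
        moveCode prm f seed.1 c (c.1 - (Real.sqrt (((c.2.2.2.1 : ℝ) + 2) * prm.Dbar -
          c.2.2.2.2.1) / ‖c.2.1‖) • c.2.1) (0, 0, 0, 0)
      else
        moveCode prm f seed.1 c (c.1 - prm.etaH • c.2.1)
          (1, c.2.2.2.1 + 1, c.2.2.2.2.1 + prm.etaH ^ 2 * ‖c.2.1‖ ^ 2, c.2.2.2.2.2)
    else (c.1, c.2.1, 2, 0, 0, c.2.2.2.2.2)
  else c

theorem code_step (prm : Params) (f : Point d → Ξ → ℝ) (seed : Seed d Ξ) (st : State d) :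
    (step prm f seed st).code = stepCode prm f seed st.code := by
  rcases st with ⟨x, v, _ | ⟨k, S, anc⟩ | out, N⟩
  · by_cases h : prm.eps < ‖v‖ <;> simp [step, State.code, stepCode, moveTo, moveCode, h]
  · by_cases h : k < prm.ell
    · by_cases h' : ((k : ℝ) + 2) * prm.Dbar < S + prm.etaH ^ 2 * ‖v‖ ^ 2 <;>
        simp [step, State.code, stepCode, moveTo, moveCode, h, h']
    · simp [step, State.code, stepCode, h]
  · simp [step, State.code, stepCode]

theorem measurable_stepCode (prm : Params) (ho : IsStochasticObjective P f)
    (hf : IsSmoothLipschitz f L ρ) :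
    Measurable fun q : Seed d Ξ × Code d => stepCode prm f q.1 q.2 := by
  have hx : Measurable fun q : Seed d Ξ × Code d => q.2.1 := by fun_prop
  have hv : Measurable fun q : Seed d Ξ × Code d => q.2.2.1 := by fun_prop
  have ht : Measurable fun q : Seed d Ξ × Code d => q.2.2.2.1 := by fun_prop
  have hk : Measurable fun q : Seed d Ξ × Code d => q.2.2.2.2.1 := by fun_prop
  have hS : Measurable fun q : Seed d Ξ × Code d => q.2.2.2.2.2.1 := by fun_prop
  have hc : Measurable fun q : Seed d Ξ × Code d => q.2.2.2.2.2.2 := by fun_prop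
  have hkr : Measurable fun q : Seed d Ξ × Code d => ((q.2.2.2.2.1 : ℕ) : ℝ) :=
    (measurable_from_top (f := fun n : ℕ => (n : ℝ))).comp hk
  have hξ : Measurable fun q : Seed d Ξ × Code d => q.1.1 := by fun_prop
  have hu : Measurable fun q : Seed d Ξ × Code d => q.1.2 := by fun_prop
  have hmove : ∀ {x' : Seed d Ξ × Code d → Point d}
      {t : Seed d Ξ × Code d → ℕ × ℕ × ℝ × Point d}, Measurable x' → Measurable t →
      Measurable fun q => moveCode prm f q.1.1 q.2 (x' q) (t q) := fun hx' ht' =>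
    hx'.prodMk ((measurable_stormUpdate ho hf _ _ hξ hv hx hx').prodMk ht')
  have hD : Measurable fun q : Seed d Ξ × Code d =>
      q.2.2.2.2.2.1 + prm.etaH ^ 2 * ‖q.2.2.1‖ ^ 2 := by fun_prop
  have hcap : Measurable fun q : Seed d Ξ × Code d =>
      ((q.2.2.2.2.1 : ℝ) + 2) * prm.Dbar := (hkr.add_const 2).mul_const _
  unfold stepCode
  refine Measurable.ite (ht (measurableSet_singleton 0)) ?_ ?_
  · refine Measurable.ite (measurableSet_lt measurable_const hv.norm) ?_ ?_
    · exact hmove (hx.sub ((measurable_const.div hv.norm).smul hv)) measurable_const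
    · exact hmove (hx.add hu) (by fun_prop)
  · refine Measurable.ite (ht (measurableSet_singleton 1)) ?_ (by fun_prop)
    refine Measurable.ite (measurableSet_lt hk measurable_const) ?_ (by fun_prop)
    refine Measurable.ite (measurableSet_lt hcap hD) ?_ ?_
    · exact hmove (hx.sub (((hcap.sub hS).sqrt.div hv.norm).smul hv)) measurable_const
    · refine hmove (hx.sub (hv.fun_const_smul _)) (measurable_const.prodMk (Measurable.prodMk ?_ ?_))
      · exact (measurable_from_top (f := fun n : ℕ => n + 1)).comp hk
      · exact hD.prodMk hc

theorem measurable_step (prm : Params) (ho : IsStochasticObjective P f)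
    (hf : IsSmoothLipschitz f L ρ) :
    Measurable (Function.uncurry (step prm f : Seed d Ξ → State d → State d)) := by
  rw [measurable_state_iff]
  have : (fun q : Seed d Ξ × State d => (Function.uncurry (step prm f) q).code) =
      fun q => stepCode prm f q.1 q.2.code := by
    funext q; exact code_step prm f q.1 q.2
  rw [this]
  exact (measurable_stepCode prm ho hf).comp
    (measurable_fst.prodMk (measurable_code.comp measurable_snd))

theorem measurable_initState (prm : Params) (ho : IsStochasticObjective P f)
    (hf : IsSmoothLipschitz f L ρ) (x₁ : Point d) :
    Measurable (initState prm f x₁ : Seed d Ξ → State d) := by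
  rw [measurable_state_iff]
  have : (fun q : Seed d Ξ => (initState prm f x₁ q).code) =
      fun q => (x₁, batchGradient f prm.B q.1 x₁, 0, 0, 0, 0) := by
    funext q; rfl
  rw [this]
  have h : Measurable fun q : Seed d Ξ => batchGradient f prm.B q.1 x₁ :=
    measurable_batchGradient_comp ho hf prm.B measurable_fst measurable_const
  exact measurable_const.prodMk (h.prodMk measurable_const)

theorem run_eq_chain (prm : Params) (f : Point d → Ξ → ℝ) (x₁ : Point d)
    (ω : ℕ → Seed d Ξ) (n : ℕ) :
    run prm f x₁ ω n = chain (initState prm f x₁) (step prm f) ω n := by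
  induction n with
  | zero => rfl
  | succ n ih => rw [run, chain, ih]

end

section

/-! ### An exponential supermartingale for the estimation error -/

variable {d : ℕ} {Ξ : Type*} [MeasurableSpace Ξ] {P : Measure Ξ} [IsProbabilityMeasure P]
  {f : Point d → Ξ → ℝ} {L ρ σ : ℝ}

theorem ae_norm_le_uniformBall (d : ℕ) (r : ℝ) : ∀ᵐ u ∂uniformBall d r, ‖u‖ ≤ r := by
  have h := ProbabilityTheory.ae_cond_mem (μ := (volume : Measure (Point d)))
    (measurableSet_closedBall (x := (0 : Point d)) (ε := r))
  filter_upwards [h] with u hu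
  simpa using hu

/-- One STORM update, averaged over the samples and the perturbation, when the squared movement is
at most `m` and the weight of the potential passes from `w` to `w'`. -/
theorem lintegral_cosh_seed_le (ho : IsStochasticObjective P f) (hf : IsSmoothLipschitz f L ρ)
    (hρ : 0 ≤ ρ) (hL : 0 ≤ L) (hσ : 0 < σ) (hd : HasBoundedDeviation P f σ)
    {a : ℝ} (ha : 0 < a) (ha1 : a ≤ 1) {b : ℕ} (hb : 0 < b) {r : ℝ} (hr : 0 < r) (lam : ℝ)
    (v x : Point d) {x' : Point d → Point d} (hx' : Measurable x') {m w w' : ℝ}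
    (hm : ∀ u, ‖u‖ ≤ r → ‖x' u - x‖ ^ 2 ≤ m)
    (hw : (1 - a) ^ 2 * w + (8 * L ^ 2 * m + 2 * a ^ 2 * σ ^ 2) / b ≤ w') :
    ∫⁻ seed : Seed d Ξ, ENNReal.ofReal (Real.cosh (lam * ‖stormUpdate f a b seed.1 v x (x' seed.2) -
        gradient (objective P f) (x' seed.2)‖) * Real.exp (-(lam ^ 2 / 2 * w')))
        ∂seedLaw P d r ≤
      ENNReal.ofReal (Real.cosh ((1 - a) * lam * ‖v - gradient (objective P f) x‖) *
        Real.exp (-(((1 - a) * lam) ^ 2 / 2 * w))) := by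
  have hprob := isProbabilityMeasure_uniformBall d hr
  have hFs : IsSmooth (objective P f) L ρ := isSmooth_objective ho hf hL hρ hσ.le hd
  have hmeas : Measurable fun seed : Seed d Ξ =>
      ENNReal.ofReal (Real.cosh (lam * ‖stormUpdate f a b seed.1 v x (x' seed.2) -
        gradient (objective P f) (x' seed.2)‖) * Real.exp (-(lam ^ 2 / 2 * w'))) := by
    have h1 : Measurable fun seed : Seed d Ξ => x' seed.2 := hx'.comp measurable_snd
    have h2 := measurable_stormUpdate ho hf a b (measurable_fst (α := ℕ → Ξ) (β := Point d))
      (measurable_const (a := v)) (measurable_const (a := x)) h1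
    have h3 : Measurable fun seed : Seed d Ξ => gradient (objective P f) (x' seed.2) :=
      hFs.differentiable_gradient.continuous.measurable.comp h1
    exact ((Real.measurable_cosh.comp ((h2.sub h3).norm.const_mul lam)).mul_const _).ennreal_ofReal
  unfold seedLaw
  rw [lintegral_prod_symm _ hmeas.aemeasurable]
  calc _ ≤ ∫⁻ _u, ENNReal.ofReal (Real.cosh ((1 - a) * lam * ‖v - gradient (objective P f) x‖) *
        Real.exp (-(((1 - a) * lam) ^ 2 / 2 * w))) ∂uniformBall d r := by
        refine lintegral_mono_ae ?_
        filter_upwards [ae_norm_le_uniformBall d r] with u hu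
        simp only [ENNReal.ofReal_mul (Real.cosh_pos _).le]
        rw [lintegral_mul_const' _ _ ENNReal.ofReal_ne_top]
        refine (mul_le_mul_left (lintegral_cosh_storm_le ho hf hρ hL hσ hd ha ha1 hb lam v x
          (x' u)) _).trans ?_
        rw [← ENNReal.ofReal_mul (by positivity), ← ENNReal.ofReal_mul (by positivity)]
        apply ENNReal.ofReal_le_ofReal
        rw [mul_comm (Real.exp _), mul_assoc, ← Real.exp_add]
        refine mul_le_mul_of_nonneg_left (Real.exp_le_exp.2 ?_) (Real.cosh_pos _).le
        have hb' : (0 : ℝ) < b := by exact_mod_cast hb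
        have h1 : (2 * L * ‖x' u - x‖ + a * σ) ^ 2 / b ≤
            (8 * L ^ 2 * m + 2 * a ^ 2 * σ ^ 2) / b := by
          gcongr
          nlinarith [hm u hu, sq_nonneg (2 * L * ‖x' u - x‖ - a * σ), sq_nonneg L]
        have h2 : lam ^ 2 / 2 * ((1 - a) ^ 2 * w + (2 * L * ‖x' u - x‖ + a * σ) ^ 2 / b) ≤
            lam ^ 2 / 2 * w' := by gcongr; linarith
        linarith
    _ = _ := by simp

/-- The parameters are compatible with the weight `A` of the exponential supermartingale: `A`
dominates the variance of the initial batch, and a decay of `A` by the factor `1 - a` absorbs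
(four times) the noise of one step of mean squared length `Dbar`. -/
structure Params.IsBalanced (prm : Params) (L σ r A : ℝ) : Prop where
  a_pos : 0 < prm.a
  b_pos : 0 < prm.b
  B_pos : 0 < prm.B
  Dbar_nonneg : 0 ≤ prm.Dbar
  eta_sq_le : prm.eta ^ 2 ≤ prm.Dbar
  r_sq_le : r ^ 2 ≤ prm.Dbar
  a_mul_ell_le : prm.a * (prm.ell + 2) ≤ 1
  init_le : σ ^ 2 / prm.B ≤ A
  noise_le : (32 * L ^ 2 * prm.Dbar + 4 * prm.a ^ 2 * σ ^ 2) / prm.b ≤ prm.a * A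

/-- A bound for the conditional variance of the error in a state, in terms of the code: constant
in the descent phase, and with the accumulated squared movement in the escape phase. -/
def errWeight (prm : Params) (L σ A : ℝ) (t k : ℕ) (S : ℝ) : ℝ :=
  if t = 0 then A
  else A * (1 - prm.a * (k + 1) / 2) + 8 * L ^ 2 / prm.b * (S + prm.Dbar) +
    2 * prm.a ^ 2 * σ ^ 2 / prm.b * (k + 1)

/-- The exponential potential of the error of the estimate; zero after halting. -/
def errPotential (prm : Params) (F : Point d → ℝ) (L σ A lam : ℝ) (c : Code d) : ENNReal :=
  if c.2.2.1 = 2 then 0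
  else ENNReal.ofReal (Real.cosh (lam * ‖c.2.1 - gradient F c.1‖) *
    Real.exp (-(lam ^ 2 / 2 * errWeight prm L σ A c.2.2.1 c.2.2.2.1 c.2.2.2.2.1)))

theorem measurable_errPotential (prm : Params) {F : Point d → ℝ} (hF : IsSmooth F L ρ)
    (A lam : ℝ) : Measurable (errPotential prm F L σ A lam) := by
  have hx : Measurable fun c : Code d => c.1 := by fun_prop
  have hv : Measurable fun c : Code d => c.2.1 := by fun_prop
  have ht : Measurable fun c : Code d => c.2.2.1 := by fun_prop
  have hk : Measurable fun c : Code d => c.2.2.2.1 := by fun_prop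
  have hS : Measurable fun c : Code d => c.2.2.2.2.1 := by fun_prop
  have hkr : Measurable fun c : Code d => ((c.2.2.2.1 : ℕ) : ℝ) :=
    (measurable_from_top (f := fun n : ℕ => (n : ℝ))).comp hk
  have hg : Measurable fun c : Code d => gradient F c.1 :=
    hF.differentiable_gradient.continuous.measurable.comp hx
  have hw : Measurable fun c : Code d =>
      errWeight prm L σ A c.2.2.1 c.2.2.2.1 c.2.2.2.2.1 := by
    unfold errWeight
    refine Measurable.ite (ht (measurableSet_singleton 0)) measurable_const ?_
    fun_prop
  unfold errPotential
  refine Measurable.ite (ht (measurableSet_singleton 2)) measurable_const ?_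
  exact ((Real.measurable_cosh.comp ((hv.sub hg).norm.const_mul lam)).mul
    (Real.measurable_exp.comp (hw.const_mul _).neg)).ennreal_ofReal

/-- In the Escape phase, the number of iterations is at most `ell` and the accumulated squared
movement is within its budget. -/
def State.IsWithinBudget (prm : Params) (st : State d) : Prop :=
  match st.phase with
  | Phase.escape k S _ => k ≤ prm.ell ∧ 0 ≤ S ∧ S ≤ ((k : ℝ) + 1) * prm.Dbar
  | _ => True

theorem isWithinBudget_step (prm : Params) (hD : 0 ≤ prm.Dbar) (f : Point d → Ξ → ℝ)
    (seed : Seed d Ξ) {st : State d} (h : st.IsWithinBudget prm) :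
    (step prm f seed st).IsWithinBudget prm := by
  rcases st with ⟨x, v, _ | ⟨k, S, anc⟩ | out, N⟩
  · simp only [step]
    split_ifs
    · simp [moveTo, State.IsWithinBudget]
    · simpa [moveTo, State.IsWithinBudget] using hD
  · simp only [State.IsWithinBudget] at h
    simp only [step]
    split_ifs with h1 h2
    · simp [moveTo, State.IsWithinBudget]
    · simp only [moveTo, State.IsWithinBudget]
      refine ⟨h1, by have := h.2.1; positivity, ?_⟩
      push_cast
      linarith
    · simp [State.IsWithinBudget]
  · simp [step, State.IsWithinBudget]

theorem isWithinBudget_run (prm : Params) (hD : 0 ≤ prm.Dbar) (f : Point d → Ξ → ℝ)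
    (x₁ : Point d) (ω : ℕ → Seed d Ξ) (n : ℕ) :
    (run prm f x₁ ω n).IsWithinBudget prm := by
  induction n with
  | zero => simp [run, initState, State.IsWithinBudget]
  | succ n ih => exact isWithinBudget_step prm hD f _ ih

theorem norm_div_norm_smul_sq_le {s : ℝ} (v : Point d) :
    ‖(s / ‖v‖) • v‖ ^ 2 ≤ s ^ 2 := by
  rcases eq_or_ne v 0 with rfl | hv
  · simp [sq_nonneg]
  · rw [norm_smul, norm_div, norm_norm, div_mul_cancel₀ _ (norm_ne_zero_iff.2 hv),
      Real.norm_eq_abs, sq_abs]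

theorem sq_mul_weight_le {a A X κ : ℝ} (ha : 0 ≤ a) (ha1 : a ≤ 1) (hA : 0 ≤ A) (hX : 0 ≤ X)
    (hκ : a * (κ + 1) ≤ 1) :
    (1 - a) ^ 2 * (A * (1 - a * (κ + 1) / 2) + X) ≤ A * (1 - a * (κ + 2) / 2) + X := by
  have hA1 : 0 ≤ A * (1 - a * (κ + 1) / 2) := mul_nonneg hA (by linarith)
  have e1 : (1 - a) ^ 2 * (A * (1 - a * (κ + 1) / 2)) ≤ (1 - a) * (A * (1 - a * (κ + 1) / 2)) := by
    have : (1 - a) ^ 2 ≤ 1 - a := by nlinarith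
    gcongr
  have e2 : (1 - a) * (A * (1 - a * (κ + 1) / 2)) ≤ A * (1 - a * (κ + 2) / 2) := by
    have h : 0 ≤ A * a * (1 - a * (κ + 1)) := mul_nonneg (mul_nonneg hA ha) (by linarith)
    have h2 : A * (1 - a * (κ + 2) / 2) - (1 - a) * (A * (1 - a * (κ + 1) / 2)) =
      A * a * (1 - a * (κ + 1)) / 2 := by ring
    linarith
  have e3 : (1 - a) ^ 2 * X ≤ X := mul_le_of_le_one_left hX (by nlinarith)
  rw [mul_add]
  linarith

set_option maxHeartbeats 1000000 in
/-- The supermartingale property of the error potential. The contraction of the error by `1 - a`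
turns the exponent `lam` into `(1 - a) * lam`. -/
theorem lintegral_errPotential_step_le (ho : IsStochasticObjective P f)
    (hf : IsSmoothLipschitz f L ρ) (hρ : 0 ≤ ρ) (hL : 0 ≤ L) (hσ : 0 < σ)
    (hd : HasBoundedDeviation P f σ) {prm : Params} {r A : ℝ} (hr : 0 < r)
    (hprm : prm.IsBalanced L σ r A) {st : State d} (hst : st.IsWithinBudget prm) (lam : ℝ) :
    ∫⁻ seed, errPotential prm (objective P f) L σ A lam (step prm f seed st).code
        ∂seedLaw P d r ≤
      errPotential prm (objective P f) L σ A ((1 - prm.a) * lam) st.code := by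
  obtain ⟨ha, hb, hB, hD, heta, hr2, hell, hinit, hnoise⟩ := hprm
  have hell0 : (0 : ℝ) ≤ prm.ell := Nat.cast_nonneg _
  have ha1 : prm.a ≤ 1 := by nlinarith
  have hb' : (0 : ℝ) < prm.b := by exact_mod_cast hb
  set α := 8 * L ^ 2 / prm.b with hα
  set β := 2 * prm.a ^ 2 * σ ^ 2 / prm.b with hβ
  have hα0 : 0 ≤ α := by positivity
  have hβ0 : 0 ≤ β := by positivity
  have hn : ∀ m : ℝ, (8 * L ^ 2 * m + 2 * prm.a ^ 2 * σ ^ 2) / prm.b = α * m + β := by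
    intro m; rw [hα, hβ]; ring
  have hN : 4 * (α * prm.Dbar) + 2 * β ≤ prm.a * A := by
    refine le_trans (le_of_eq ?_) hnoise
    rw [hα, hβ]; ring
  have hαD : 0 ≤ α * prm.Dbar := by positivity
  have hA : 0 ≤ A := by
    by_contra h
    push Not at h
    nlinarith
  have hq : (1 - prm.a) ^ 2 ≤ 1 - prm.a := by nlinarith
  have hqA : (1 - prm.a) ^ 2 * A ≤ (1 - prm.a) * A := by gcongr
  rcases st with ⟨x, v, _ | ⟨k, S, anc⟩ | out, N⟩
  · by_cases h : prm.eps < ‖v‖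
    · have key := lintegral_cosh_seed_le ho hf hρ hL hσ hd ha ha1 hb hr lam v x
        (x' := fun _ => x - (prm.eta / ‖v‖) • v) measurable_const (m := prm.Dbar) (w := A)
        (w' := A) (fun u _ => by
          rw [sub_sub_cancel_left, norm_neg]
          exact (norm_div_norm_smul_sq_le v).trans heta) (by
          rw [hn]; nlinarith)
      simpa [step, State.code, errPotential, moveTo, h, errWeight] using key
    · have key := lintegral_cosh_seed_le ho hf hρ hL hσ hd ha ha1 hb hr lam v x
        (x' := fun u => x + u) (measurable_id.const_add x) (m := prm.Dbar) (w := A)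
        (w' := A * (1 - prm.a * (0 + 1) / 2) + α * (0 + prm.Dbar) + β * (0 + 1))
        (fun u hu => by
          rw [add_sub_cancel_left]
          exact le_trans (by gcongr) hr2) (by
          rw [hn]; nlinarith)
      simpa [step, State.code, errPotential, moveTo, h, errWeight, hα, hβ] using key
  · obtain ⟨hk, hS0, hS1⟩ := hst
    have hkr : (k : ℝ) ≤ prm.ell := by exact_mod_cast hk
    have hk0 : (0 : ℝ) ≤ k := Nat.cast_nonneg _
    have hak : prm.a * (k + 1) ≤ 1 := le_trans (by gcongr; linarith) hell
    have hX : 0 ≤ α * (S + prm.Dbar) + β * (k + 1) := by positivity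
    have hw1 := sq_mul_weight_le ha.le ha1 hA hX hak
    rw [← add_assoc, ← add_assoc] at hw1
    by_cases h1 : k < prm.ell
    · by_cases h2 : ((k : ℝ) + 2) * prm.Dbar < S + prm.etaH ^ 2 * ‖v‖ ^ 2
      · have hcap : 0 ≤ ((k : ℝ) + 2) * prm.Dbar - S := by linarith
        have key := lintegral_cosh_seed_le ho hf hρ hL hσ hd ha ha1 hb hr lam v x
          (x' := fun _ => x - (Real.sqrt (((k : ℝ) + 2) * prm.Dbar - S) / ‖v‖) • v)
          measurable_const (m := ((k : ℝ) + 2) * prm.Dbar - S)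
          (w := A * (1 - prm.a * (k + 1) / 2) + α * (S + prm.Dbar) + β * (k + 1))
          (w' := A) (fun u _ => by
            rw [sub_sub_cancel_left, norm_neg]
            exact (norm_div_norm_smul_sq_le v).trans_eq (Real.sq_sqrt hcap)) (by
            rw [hn]
            have e4 : (k + 2) * (4 * (α * prm.Dbar) + 2 * β) ≤ (k + 2) * (prm.a * A) :=
              mul_le_mul_of_nonneg_left hN (by linarith)
            have e5 : 0 ≤ k * (α * prm.Dbar) := mul_nonneg hk0 hαD
            linarith)
        simpa [step, State.code, errPotential, moveTo, h1, h2, errWeight, hα, hβ] using key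
      · have key := lintegral_cosh_seed_le ho hf hρ hL hσ hd ha ha1 hb hr lam v x
          (x' := fun _ => x - prm.etaH • v)
          measurable_const (m := prm.etaH ^ 2 * ‖v‖ ^ 2)
          (w := A * (1 - prm.a * (k + 1) / 2) + α * (S + prm.Dbar) + β * (k + 1))
          (w' := A * (1 - prm.a * ((k + 1 : ℕ) + 1) / 2) +
            α * (S + prm.etaH ^ 2 * ‖v‖ ^ 2 + prm.Dbar) + β * ((k + 1 : ℕ) + 1)) (fun u _ => by
            rw [sub_sub_cancel_left, norm_neg, norm_smul, mul_pow, Real.norm_eq_abs, sq_abs]) (by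
            rw [hn]
            push_cast
            linarith)
        simpa [step, State.code, errPotential, moveTo, h1, h2, errWeight, hα, hβ] using key
    · simp [step, State.code, errPotential, h1]
  · simp [step, State.code, errPotential]

theorem lintegral_errPotential_initState_le (ho : IsStochasticObjective P f)
    (hf : IsSmoothLipschitz f L ρ) (hL : 0 ≤ L) (hσ : 0 < σ)
    (hd : HasBoundedDeviation P f σ) {prm : Params} {r A : ℝ} (hr : 0 < r)
    (hprm : prm.IsBalanced L σ r A) (x₁ : Point d) (lam : ℝ) :
    ∫⁻ seed, errPotential prm (objective P f) L σ A lam (initState prm f x₁ seed).code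
        ∂seedLaw P d r ≤ 1 := by
  have hprob := isProbabilityMeasure_uniformBall d hr
  have h := lintegral_cosh_batchGradient_le ho hf hL hσ hd hprm.B_pos lam x₁
  have hm : Measurable fun seed : Seed d Ξ => ENNReal.ofReal (Real.cosh (lam *
      ‖batchGradient f prm.B seed.1 x₁ - gradient (objective P f) x₁‖) *
      Real.exp (-(lam ^ 2 / 2 * A))) := by
    have h1 := measurable_batchGradient_comp ho hf prm.B
      (measurable_fst (α := ℕ → Ξ) (β := Point d)) (measurable_const (a := x₁))
    exact ((Real.measurable_cosh.comp
      ((h1.sub_const _).norm.const_mul lam)).mul_const _).ennreal_ofReal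
  simp only [errPotential, initState, State.code, errWeight]
  simp only [OfNat.zero_ne_ofNat, if_false, if_true]
  unfold seedLaw
  rw [lintegral_prod_symm _ hm.aemeasurable]
  simp only [ENNReal.ofReal_mul (Real.cosh_pos _).le]
  simp only [lintegral_mul_const' _ _ ENNReal.ofReal_ne_top, lintegral_const, measure_univ, mul_one]
  refine (mul_le_mul_left h _).trans ?_
  rw [← ENNReal.ofReal_mul (Real.exp_pos _).le, ← Real.exp_add, ENNReal.ofReal_le_one]
  apply Real.exp_le_one_iff.2
  have h2 : lam ^ 2 / 2 * (σ ^ 2 / prm.B) ≤ lam ^ 2 / 2 * A := by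
    gcongr; exact hprm.init_le
  linarith

/-- Chernoff bound for a potential of the form `cosh · exp`. -/
theorem measure_le_of_lintegral_cosh_le {Ω : Type*} [MeasurableSpace Ω] {μ : Measure Ω}
    {G : Ω → ENNReal} (hG : Measurable G) (h1 : ∫⁻ ω, G ω ∂μ ≤ 1) {s : Set Ω} {lam τ V : ℝ}
    (hs : ∀ ω ∈ s, ∃ y w : ℝ, lam * τ ≤ y ∧ w ≤ V ∧
      ENNReal.ofReal (Real.cosh y * Real.exp (-w)) ≤ G ω) :
    μ s ≤ ENNReal.ofReal (2 * Real.exp (V - lam * τ)) := by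
  set c := Real.exp (lam * τ - V) / 2 with hc
  have hc0 : 0 < c := by positivity
  have hsub : s ⊆ {ω | ENNReal.ofReal c ≤ G ω} := by
    intro ω hω
    obtain ⟨y, w, hy, hw, hG'⟩ := hs ω hω
    refine le_trans (ENNReal.ofReal_le_ofReal ?_) hG'
    have h2 : Real.exp (lam * τ) / 2 ≤ Real.cosh y := by
      rw [Real.cosh_eq]
      have := Real.exp_le_exp.2 hy
      have := Real.exp_pos (-y)
      linarith
    calc c = Real.exp (lam * τ) / 2 * Real.exp (-V) := by
          rw [hc, sub_eq_add_neg, Real.exp_add]; ring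
      _ ≤ Real.cosh y * Real.exp (-w) := by
          gcongr
  have h3 := mul_meas_ge_le_lintegral hG (μ := μ) (ENNReal.ofReal c)
  have h4 : ENNReal.ofReal c * μ s ≤ 1 := (by gcongr : _ ≤ _).trans (h3.trans h1)
  have h5 : (2 * Real.exp (V - lam * τ)) = c⁻¹ := by
    rw [hc, inv_div, ← neg_sub, Real.exp_neg]; rfl
  rw [h5, ENNReal.ofReal_inv_of_pos hc0]
  rw [ENNReal.le_inv_iff_mul_le, mul_comm]
  exact h4

/-- With high probability, the error of the estimate is small at a given time before halting. -/
theorem runLaw_error_ge_le (ho : IsStochasticObjective P f)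
    (hf : IsSmoothLipschitz f L ρ) (hρ : 0 ≤ ρ) (hL : 0 ≤ L) (hσ : 0 < σ)
    (hd : HasBoundedDeviation P f σ) {prm : Params} {r A : ℝ} (hr : 0 < r)
    (hprm : prm.IsBalanced L σ r A) (x₁ : Point d) {lam : ℝ} (hlam : 0 ≤ lam) (τ : ℝ) (n : ℕ) :
    runLaw P d r {ω | (∀ out, (run prm f x₁ ω n).phase ≠ Phase.halted out) ∧
        τ < ‖(run prm f x₁ ω n).dir - gradient (objective P f) (run prm f x₁ ω n).x‖} ≤
      ENNReal.ofReal (2 * Real.exp (lam ^ 2 * A - lam * τ)) := by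
  have hprob := isProbabilityMeasure_seedLaw P d hr
  have hFs : IsSmooth (objective P f) L ρ := isSmooth_objective ho hf hL hρ hσ.le hd
  have hGm : ∀ lam, Measurable fun st : State d =>
      errPotential prm (objective P f) L σ A lam st.code := fun lam =>
    (measurable_errPotential prm hFs A lam).comp measurable_code
  have hi := measurable_initState prm ho hf x₁
  have hs := measurable_step prm ho hf
  have key := lintegral_chain_le_one (seedLaw P d r) hi hs hGm (1 - prm.a)
    (lintegral_errPotential_initState_le ho hf hL hσ hd hr hprm x₁)
    (fun lam ω n => by
      rw [← run_eq_chain]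
      exact lintegral_errPotential_step_le ho hf hρ hL hσ hd hr hprm
        (isWithinBudget_run prm hprm.Dbar_nonneg f x₁ ω n) lam) lam n
  refine measure_le_of_lintegral_cosh_le ((hGm lam).comp (measurable_chain hi hs n)) key ?_
  rintro ω ⟨hω1, hω2⟩
  obtain ⟨ha, hb, hB, hD, heta, hr2, hell, hinit, hnoise⟩ := hprm
  have hbud := isWithinBudget_run prm hD f x₁ ω n
  simp only [Function.comp]
  rw [← run_eq_chain]
  generalize run prm f x₁ ω n = st at hω1 hω2 hbud
  have hell0 : (0 : ℝ) ≤ prm.ell := Nat.cast_nonneg _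
  have hb' : (0 : ℝ) < prm.b := by exact_mod_cast hb
  have hA : 0 ≤ A := hinit.trans' (by positivity)
  have hy : lam * τ ≤ lam * ‖st.dir - gradient (objective P f) st.x‖ := by gcongr
  rcases st with ⟨x, v, _ | ⟨k, S, anc⟩ | out, N⟩
  · refine ⟨_, lam ^ 2 / 2 * A, hy, by nlinarith [sq_nonneg lam], ?_⟩
    simp [State.code, errPotential, errWeight]
  · refine ⟨_, lam ^ 2 / 2 * errWeight prm L σ A 1 k S, hy, ?_, ?_⟩
    · have hw : errWeight prm L σ A 1 k S ≤ 2 * A := by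
        obtain ⟨hk, hS0, hS1⟩ := hbud
        have hkr : (k : ℝ) ≤ prm.ell := by exact_mod_cast hk
        have hk0 : (0 : ℝ) ≤ k := Nat.cast_nonneg _
        simp only [errWeight, one_ne_zero, if_false]
        set α := 8 * L ^ 2 / prm.b with hα
        set β := 2 * prm.a ^ 2 * σ ^ 2 / prm.b with hβ
        have hα0 : 0 ≤ α := by positivity
        have hβ0 : 0 ≤ β := by positivity
        have hN : 4 * (α * prm.Dbar) + 2 * β ≤ prm.a * A := by
          refine le_trans (le_of_eq ?_) hnoise
          rw [hα, hβ]; ring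
        have hαD : 0 ≤ α * prm.Dbar := by positivity
        have e1 : α * S ≤ α * (((k : ℝ) + 1) * prm.Dbar) := by gcongr
        have e2 : (k + 2) * (α * prm.Dbar + β) ≤ (prm.ell + 2) * (prm.a * A) := by
          gcongr
          linarith
        have e3 : (prm.a * (prm.ell + 2)) * A ≤ 1 * A := by gcongr
        have e4 : 0 ≤ A * (prm.a * (k + 1) / 2) := by positivity
        nlinarith
      nlinarith [sq_nonneg lam]
    · simp [State.code, errPotential]
  · exact absurd rfl (hω1 out)

end

section

/-! ### Growth of the difference of two coupled paths -/

section Growth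

variable {E : Type*} [NormedAddCommGroup E] [InnerProductSpace ℝ E]

/-- A gradient step for a quadratic form with eigenvalues in `[-γ, L]` expands by at most
`1 + h γ`. -/
theorem norm_sub_smul_le_of_symmetric {H : E →L[ℝ] E} {L γ h : ℝ}
    (hsymm : ∀ v w, inner ℝ (H v) w = inner ℝ v (H w)) (hL : ∀ v, ‖H v‖ ≤ L * ‖v‖)
    (hlow : ∀ v, -(γ * ‖v‖ ^ 2) ≤ inner ℝ (H v) v) (hh : 0 ≤ h) (hhL : h * L ≤ 1) (hγ : 0 ≤ γ)
    (v : E) : ‖v - h • H v‖ ≤ (1 + h * γ) * ‖v‖ := by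
  set B : E →L[ℝ] E := ContinuousLinearMap.id ℝ E - h • H with hB
  have hBa : ∀ v, B v = v - h • H v := fun v => by simp [hB]
  set G := 1 + h * γ with hG
  have hG1 : 1 ≤ G := by rw [hG]; nlinarith
  have hup : ∀ v, inner ℝ (B v) v ≤ G * ‖v‖ ^ 2 := by
    intro v
    rw [hBa, inner_sub_left, real_inner_smul_left, real_inner_self_eq_norm_sq, hG]
    nlinarith [mul_le_mul_of_nonneg_left (hlow v) hh]
  have hpos : ∀ v, 0 ≤ inner ℝ (B v) v := by
    intro v
    rw [hBa, inner_sub_left, real_inner_smul_left, real_inner_self_eq_norm_sq]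
    have h1 : inner ℝ (H v) v ≤ L * ‖v‖ ^ 2 := by
      have := real_inner_le_norm (H v) v
      nlinarith [hL v, norm_nonneg v]
    have h2 := mul_le_mul_of_nonneg_left h1 hh
    nlinarith [sq_nonneg ‖v‖, mul_le_mul_of_nonneg_right hhL (sq_nonneg ‖v‖)]
  have hBs : ∀ v w, inner ℝ (B v) w = inner ℝ v (B w) := by
    intro v w
    rw [hBa, hBa, inner_sub_left, inner_sub_right, real_inner_smul_left, real_inner_smul_right,
      hsymm]
  rw [← hBa]
  -- Positivity of the quadratic form of `B` at `v - B v / G` is the Cauchy–Schwarz inequality.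
  have key := hpos (v - G⁻¹ • B v)
  have e : inner ℝ (B (v - G⁻¹ • B v)) (v - G⁻¹ • B v) =
      inner ℝ (B v) v - 2 * G⁻¹ * ‖B v‖ ^ 2 + G⁻¹ ^ 2 * inner ℝ (B (B v)) (B v) := by
    rw [map_sub, map_smul, inner_sub_left, inner_sub_right, inner_sub_right, real_inner_smul_left,
      real_inner_smul_right, real_inner_smul_left, real_inner_smul_right, hBs (B v) v,
      real_inner_self_eq_norm_sq]
    ring
  rw [e] at key
  have hG0 : 0 < G := by linarith
  have h1 := hup v
  have h2 : G⁻¹ ^ 2 * inner ℝ (B (B v)) (B v) ≤ G⁻¹ * ‖B v‖ ^ 2 := by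
    calc G⁻¹ ^ 2 * inner ℝ (B (B v)) (B v) ≤ G⁻¹ ^ 2 * (G * ‖B v‖ ^ 2) := by
          gcongr; exact hup _
      _ = _ := by field_simp
  have h3 : G⁻¹ * ‖B v‖ ^ 2 ≤ G * ‖v‖ ^ 2 := by linarith
  have h4 : ‖B v‖ ^ 2 ≤ (G * ‖v‖) ^ 2 := by
    rw [inv_mul_le_iff₀ hG0] at h3
    linarith
  exact (sq_le_sq₀ (norm_nonneg _) (by positivity)).1 h4

/-- Along a perturbed gradient step for a quadratic form, the squared displacement is controlled by
the decrease of the form. -/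
theorem norm_sq_step_le {H : E →L[ℝ] E} {L h : ℝ}
    (hsymm : ∀ v w, inner ℝ (H v) w = inner ℝ v (H w)) (hL : ∀ v, ‖H v‖ ≤ L * ‖v‖)
    (hh : 0 < h) (hhL : h * L ≤ 1 / 2) {w w' p : E} (hw : w' = w - h • (H w + p)) :
    ‖w' - w‖ ^ 2 ≤ h * (inner ℝ (H w) w - inner ℝ (H w') w') + 2 * (h * ‖p‖) ^ 2 := by
  set δ := w' - w with hδ
  have e1 : δ = -(h • (H w + p)) := by rw [hδ, hw]; abel
  have e2 : w' = w + δ := by rw [hδ]; abel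
  have e3 : h * inner ℝ (H w) δ = -‖δ‖ ^ 2 - h * inner ℝ p δ := by
    have : inner ℝ (h • (H w + p)) δ = -‖δ‖ ^ 2 := by
      rw [← real_inner_self_eq_norm_sq, ← inner_neg_left, e1, neg_neg]
    rw [real_inner_smul_left, inner_add_left] at this
    linarith
  have e4 : inner ℝ (H w') w' = inner ℝ (H w) w + 2 * inner ℝ (H w) δ + inner ℝ (H δ) δ := by
    rw [e2, map_add, inner_add_left, inner_add_right, inner_add_right, hsymm δ w,
      real_inner_comm (H w) δ]
    ring
  have h1 : h * inner ℝ (H δ) δ ≤ 1 / 2 * ‖δ‖ ^ 2 := by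
    have h2 : inner ℝ (H δ) δ ≤ L * ‖δ‖ ^ 2 := by
      have := real_inner_le_norm (H δ) δ
      nlinarith [hL δ, norm_nonneg δ]
    nlinarith [mul_le_mul_of_nonneg_left h2 hh.le, mul_le_mul_of_nonneg_right hhL (sq_nonneg ‖δ‖)]
  have h2 : -(h * inner ℝ p δ) ≤ h * ‖p‖ * ‖δ‖ := by
    have := (abs_le.1 (abs_real_inner_le_norm p δ)).1
    nlinarith
  rw [e4]
  nlinarith [sq_nonneg (‖δ‖ / 2 - 2 * (h * ‖p‖)), sq_nonneg (‖δ‖ - 2 * (h * ‖p‖)),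
    sq_nonneg (‖δ‖)]

/-- Two coupled paths near a strict saddle separate exponentially: their difference `w` follows the
unstable direction `w 0`, because the curvature errors `p - y` and the noise `y` stay small
relative to it. The noise is only assumed to be small as long as its variance `V` is. -/
theorem half_pow_le_norm_of_coupling {H : E →L[ℝ] E} {L γ h ϑ β κ a ρ b : ℝ} {N : ℕ}
    (hsymm : ∀ v w, inner ℝ (H v) w = inner ℝ v (H w)) (hL : ∀ v, ‖H v‖ ≤ L * ‖v‖)
    (hlow : ∀ v, -(γ * ‖v‖ ^ 2) ≤ inner ℝ (H v) v) (hh : 0 < h) (hhL : h * L ≤ 1 / 2)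
    (hγ : 0 ≤ γ) (hγL : γ ≤ L) (hκ : 0 ≤ κ) (hb : 0 < b)
    {w p y : ℕ → E} {V m : ℕ → ℝ} (hw0 : H (w 0) = -(γ • w 0))
    (hrec : ∀ n < N, w (n + 1) = w n - h • (H (w n) + p n))
    (hp : ∀ n < N, ‖p n‖ ≤ κ * ‖w n‖ + ‖y n‖)
    (hV : ∀ n ≤ N, V n ≤ (16 * L ^ 2 * ‖w 0‖ ^ 2 + ∑ i ∈ Finset.range n,
      12 * (L ^ 2 * ‖w (i + 1) - w i‖ ^ 2 + ρ ^ 2 * m i ^ 2 * ‖w i‖ ^ 2 +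
        a ^ 2 * L ^ 2 * ‖w (i + 1)‖ ^ 2)) / b)
    (hm : ∑ i ∈ Finset.range N, ρ ^ 2 * m i ^ 2 ≤ L ^ 2) (ha : a ^ 2 * N ≤ 1)
    (hy : ∀ n ≤ N, V n ≤ 100 * L ^ 2 / b * ((1 + h * γ) ^ n * ‖w 0‖) ^ 2 →
      ‖y n‖ ≤ β * ((1 + h * γ) ^ n * ‖w 0‖))
    (hϑ : ϑ = 3 / 2 * κ + β) (hβ : 0 ≤ β) (hN : N * h * ϑ ≤ 1 / 2) :
    1 / 2 * ((1 + h * γ) ^ N * ‖w 0‖) ≤ ‖w N‖ := by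
  set G := 1 + h * γ with hG
  have hG1 : 1 ≤ G := by rw [hG]; nlinarith
  have hL0 : 0 ≤ L := hγ.trans hγL
  have hϑ0 : 0 ≤ ϑ := by rw [hϑ]; positivity
  set W := ‖w 0‖ with hW
  have hW0 : 0 ≤ W := norm_nonneg _
  have hGm : ∀ {i j : ℕ}, i ≤ j → G ^ i * W ≤ G ^ j * W := fun hij => by
    have := pow_le_pow_right₀ hG1 hij
    gcongr
  have hA := norm_sub_smul_le_of_symmetric hsymm hL hlow hh.le (by linarith) hγ
  have hnN : ∀ {n : ℕ}, n ≤ N → n * h * ϑ ≤ 1 / 2 := fun hn => by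
    refine le_trans ?_ hN
    have : (_ : ℝ) ≤ _ := Nat.cast_le.2 hn
    gcongr
  have hhL1 : h * γ ≤ 1 / 2 := le_trans (by gcongr) hhL
  have hsize : ∀ {n : ℕ}, n ≤ N → ‖w n - G ^ n • w 0‖ ≤ n * h * ϑ * (G ^ n * W) →
      ‖w n‖ ≤ 3 / 2 * (G ^ n * W) := by
    intro n hn h1
    have h2 : ‖w n‖ ≤ ‖w n - G ^ n • w 0‖ + ‖G ^ n • w 0‖ := by
      simpa using norm_add_le (w n - G ^ n • w 0) (G ^ n • w 0)
    rw [norm_smul, Real.norm_of_nonneg (by positivity)] at h2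
    have h3 : n * h * ϑ * (G ^ n * W) ≤ 1 / 2 * (G ^ n * W) := by
      have := hnN hn
      gcongr
    linarith
  have main : ∀ n ≤ N, ‖w n - G ^ n • w 0‖ ≤ n * h * ϑ * (G ^ n * W) ∧
      ‖y n‖ ≤ β * (G ^ n * W) := by
    intro n
    induction n using Nat.strong_induction_on with
    | _ n ih =>
    intro hn
    have hwn : ‖w n - G ^ n • w 0‖ ≤ n * h * ϑ * (G ^ n * W) := by
      cases n with
      | zero => simp
      | succ k =>
        obtain ⟨ih1, ih2⟩ := ih k (by omega) (by omega)
        have hpk : ‖p k‖ ≤ ϑ * (G ^ k * W) := by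
          have h1 := hp k (by omega)
          have h2 : κ * ‖w k‖ ≤ κ * (3 / 2 * (G ^ k * W)) := by
            have := hsize (by omega) ih1
            gcongr
          rw [hϑ]
          linarith
        have e : w (k + 1) - G ^ (k + 1) • w 0 =
            ((w k - G ^ k • w 0) - h • H (w k - G ^ k • w 0)) - h • p k := by
          rw [hrec k (by omega), map_sub, map_smul, hw0, hG, pow_succ]
          module
        rw [e]
        refine (norm_sub_le _ _).trans ?_
        have h1 := hA (w k - G ^ k • w 0)
        rw [norm_smul, Real.norm_of_nonneg hh.le]
        have h2 : G * ‖w k - G ^ k • w 0‖ ≤ G * (k * h * ϑ * (G ^ k * W)) := by gcongr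
        have h3 : h * ‖p k‖ ≤ h * (ϑ * (G ^ (k + 1) * W)) := by
          have := hpk.trans (mul_le_mul_of_nonneg_left (hGm (Nat.le_succ k)) hϑ0)
          gcongr
        push_cast
        calc _ ≤ G * (k * h * ϑ * (G ^ k * W)) + h * (ϑ * (G ^ (k + 1) * W)) := by linarith
          _ = _ := by rw [pow_succ]; ring
    refine ⟨hwn, hy n hn ?_⟩
    have hall : ∀ i ≤ n, ‖w i‖ ≤ 3 / 2 * (G ^ n * W) := by
      intro i hi
      have h1 : ‖w i‖ ≤ 3 / 2 * (G ^ i * W) := by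
        rcases hi.eq_or_lt with rfl | hi'
        · exact hsize hn hwn
        · exact hsize (by omega) (ih i hi' (by omega)).1
      have := hGm hi
      linarith
    set R := G ^ n * W with hR
    have hR0 : 0 ≤ R := by positivity
    have hpall : ∀ i < n, ‖p i‖ ≤ ϑ * R := by
      intro i hi
      have h1 := hp i (by omega)
      have h2 : κ * ‖w i‖ ≤ κ * (3 / 2 * R) := by
        have := hall i hi.le
        gcongr
      have h3 : ‖y i‖ ≤ β * R :=
        (ih i hi (by omega)).2.trans (mul_le_mul_of_nonneg_left (hGm hi.le) hβ)
      rw [hϑ]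
      linarith
    have hδ : ∑ i ∈ Finset.range n, ‖w (i + 1) - w i‖ ^ 2 ≤ 2 * R ^ 2 := by
      have h1 : ∀ i ∈ Finset.range n, ‖w (i + 1) - w i‖ ^ 2 ≤
          (h * inner ℝ (H (w i)) (w i) - h * inner ℝ (H (w (i + 1))) (w (i + 1))) +
            2 * (h * (ϑ * R)) ^ 2 := by
        intro i hi
        have hi' := Finset.mem_range.1 hi
        have h2 := norm_sq_step_le hsymm hL hh hhL (hrec i (by omega))
        have h3 : 2 * (h * ‖p i‖) ^ 2 ≤ 2 * (h * (ϑ * R)) ^ 2 := by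
          have := hpall i hi'
          gcongr
        linarith
      refine (Finset.sum_le_sum h1).trans ?_
      rw [Finset.sum_add_distrib, Finset.sum_range_sub' (fun i => h * inner ℝ (H (w i)) (w i)),
        Finset.sum_const, Finset.card_range, nsmul_eq_mul]
      have h4 : inner ℝ (H (w 0)) (w 0) ≤ 0 := by
        rw [hw0, inner_neg_left, real_inner_smul_left, real_inner_self_eq_norm_sq]
        have : 0 ≤ γ * ‖w 0‖ ^ 2 := by positivity
        linarith
      have h5 : -(γ * (3 / 2 * R) ^ 2) ≤ inner ℝ (H (w n)) (w n) := by
        refine le_trans ?_ (hlow (w n))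
        have := hall n le_rfl
        apply neg_le_neg
        gcongr
      have h6 : h * (γ * (3 / 2 * R) ^ 2) ≤ 9 / 8 * R ^ 2 := by
        have := mul_le_mul_of_nonneg_right hhL1 (sq_nonneg R)
        linarith
      have h7 : (n : ℝ) * (2 * (h * (ϑ * R)) ^ 2) ≤ 1 / 2 * R ^ 2 := by
        rcases Nat.eq_zero_or_pos n with rfl | hn0
        · simp; positivity
        · have h8 := hnN hn
          have h9 : (1 : ℝ) ≤ n := by exact_mod_cast hn0
          have h10 : h * ϑ ≤ 1 / 2 := by
            have : 0 ≤ h * ϑ := by positivity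
            nlinarith
          have h11 : (n * h * ϑ) * (h * ϑ) ≤ 1 / 2 * (1 / 2) := by gcongr
          have h12 := mul_le_mul_of_nonneg_right h11 (sq_nonneg R)
          linarith
      have h13 := mul_le_mul_of_nonneg_left h4 hh.le
      have h14 := mul_le_mul_of_nonneg_left h5 hh.le
      have : 0 ≤ R ^ 2 := by positivity
      linarith
    have hmn : ∑ i ∈ Finset.range n, ρ ^ 2 * m i ^ 2 ≤ L ^ 2 :=
      (Finset.sum_le_sum_of_subset_of_nonneg (Finset.range_mono hn)
        fun i _ _ => by positivity).trans hm
    have hsum : ∑ i ∈ Finset.range n,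
        12 * (L ^ 2 * ‖w (i + 1) - w i‖ ^ 2 + ρ ^ 2 * m i ^ 2 * ‖w i‖ ^ 2 +
          a ^ 2 * L ^ 2 * ‖w (i + 1)‖ ^ 2) ≤ 78 * L ^ 2 * R ^ 2 := by
      have h1 : ∀ i ∈ Finset.range n,
          12 * (L ^ 2 * ‖w (i + 1) - w i‖ ^ 2 + ρ ^ 2 * m i ^ 2 * ‖w i‖ ^ 2 +
            a ^ 2 * L ^ 2 * ‖w (i + 1)‖ ^ 2) ≤
          12 * L ^ 2 * ‖w (i + 1) - w i‖ ^ 2 + 27 * R ^ 2 * (ρ ^ 2 * m i ^ 2) +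
            27 * (a ^ 2 * L ^ 2 * R ^ 2) := by
        intro i hi
        have hi' := Finset.mem_range.1 hi
        have h2 : ‖w i‖ ^ 2 ≤ (3 / 2 * R) ^ 2 := by
          have := hall i hi'.le
          gcongr
        have h3 : ‖w (i + 1)‖ ^ 2 ≤ (3 / 2 * R) ^ 2 := by
          have := hall (i + 1) hi'
          gcongr
        have h4 : ρ ^ 2 * m i ^ 2 * ‖w i‖ ^ 2 ≤ ρ ^ 2 * m i ^ 2 * (3 / 2 * R) ^ 2 := by gcongr
        have h5 : a ^ 2 * L ^ 2 * ‖w (i + 1)‖ ^ 2 ≤ a ^ 2 * L ^ 2 * (3 / 2 * R) ^ 2 := by gcongr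
        linarith
      refine (Finset.sum_le_sum h1).trans ?_
      rw [Finset.sum_add_distrib, Finset.sum_add_distrib, ← Finset.mul_sum, ← Finset.mul_sum,
        Finset.sum_const, Finset.card_range, nsmul_eq_mul]
      have h6 : 12 * L ^ 2 * ∑ i ∈ Finset.range n, ‖w (i + 1) - w i‖ ^ 2 ≤
          12 * L ^ 2 * (2 * R ^ 2) := by gcongr
      have h7 : 27 * R ^ 2 * ∑ i ∈ Finset.range n, ρ ^ 2 * m i ^ 2 ≤ 27 * R ^ 2 * L ^ 2 := by
        gcongr
      have h8 : a ^ 2 * n ≤ 1 := by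
        refine le_trans ?_ ha
        have : (n : ℝ) ≤ N := by exact_mod_cast hn
        gcongr
      have h9 : (n : ℝ) * (27 * (a ^ 2 * L ^ 2 * R ^ 2)) ≤ 27 * (L ^ 2 * R ^ 2) := by
        have := mul_le_mul_of_nonneg_right h8 (by positivity : 0 ≤ L ^ 2 * R ^ 2)
        linarith
      linarith
    refine (hV n hn).trans ?_
    rw [div_mul_eq_mul_div]
    have h10 : W ≤ R := by
      have := hGm (Nat.zero_le n)
      simpa using this
    have h11 : 16 * L ^ 2 * W ^ 2 ≤ 16 * L ^ 2 * R ^ 2 := by gcongr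
    have h12 : 0 ≤ L ^ 2 * R ^ 2 := by positivity
    gcongr
    linarith
  have h1 := (main N le_rfl).1
  have h2 : ‖G ^ N • w 0‖ ≤ ‖w N‖ + ‖w N - G ^ N • w 0‖ := by
    have := norm_sub_le (w N) (w N - G ^ N • w 0)
    simpa using this
  rw [norm_smul, Real.norm_of_nonneg (by positivity)] at h2
  have h3 : N * h * ϑ * (G ^ N * W) ≤ 1 / 2 * (G ^ N * W) := by gcongr
  linarith

end Growth

/-! ### The least eigenvalue of the Hessian -/

/-- If the symmetric operator `H` has an eigenvalue below `-εH`, then its least eigenvalue `-γ` is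
attained at a unit eigenvector `e`, and `-γ` bounds the quadratic form from below. -/
theorem exists_least_eigenvector {d : ℕ} {H : Point d →L[ℝ] Point d} {L εH μ : ℝ}
    (hsymm : ∀ v w, inner ℝ (H v) w = inner ℝ v (H w)) (hL : ∀ v, ‖H v‖ ≤ L * ‖v‖)
    (hμ : Module.End.HasEigenvalue (H : Point d →ₗ[ℝ] Point d) μ) (hμH : μ < -εH) :
    ∃ γ e, εH < γ ∧ γ ≤ L ∧ ‖e‖ = 1 ∧ H e = -(γ • e) ∧
      ∀ v, -(γ * ‖v‖ ^ 2) ≤ inner ℝ (H v) v := by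
  obtain ⟨v₀, hv₀⟩ := hμ.exists_hasEigenvector
  have : Nontrivial (Point d) := ⟨⟨v₀, 0, hv₀.2⟩⟩
  have hs : (H : Point d →ₗ[ℝ] Point d).IsSymmetric := hsymm
  set q : {x : Point d // x ≠ 0} → ℝ := fun x => inner ℝ (H x) (x : Point d) / ‖(x : Point d)‖ ^ 2
    with hq
  have hqb : BddBelow (Set.range q) := by
    refine ⟨-L, ?_⟩
    rintro _ ⟨⟨x, hx⟩, rfl⟩
    have hx' : 0 < ‖x‖ := norm_pos_iff.2 hx
    simp only [hq]
    rw [le_div_iff₀ (by positivity)]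
    have := (abs_le.1 (abs_real_inner_le_norm (H x) x)).1
    nlinarith [hL x]
  have heig : Module.End.HasEigenvalue (H : Point d →ₗ[ℝ] Point d) (⨅ x, q x) := by
    simpa using hs.hasEigenvalue_iInf_of_finiteDimensional
  obtain ⟨v₁, hv₁⟩ := heig.exists_hasEigenvector
  set γ := -(⨅ x, q x) with hγ
  have hv₁' : H v₁ = -(γ • v₁) := by
    have := hv₁.apply_eq_smul
    rw [hγ, neg_smul, neg_neg]
    exact this
  have hn₁ : ‖v₁‖ ≠ 0 := norm_ne_zero_iff.2 hv₁.2
  have hn₁' : 0 < ‖v₁‖ := norm_pos_iff.2 hv₁.2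
  refine ⟨γ, ‖v₁‖⁻¹ • v₁, ?_, ?_, ?_, ?_, ?_⟩
  · have h1 : ⨅ x, q x ≤ q ⟨v₀, hv₀.2⟩ := ciInf_le hqb _
    have h2 : q ⟨v₀, hv₀.2⟩ = μ := by
      have h3 : H v₀ = μ • v₀ := hv₀.apply_eq_smul
      have h4 : ‖v₀‖ ≠ 0 := norm_ne_zero_iff.2 hv₀.2
      simp only [hq]
      rw [h3, real_inner_smul_left, real_inner_self_eq_norm_sq]
      field_simp
    linarith
  · have h1 := hL v₁
    rw [hv₁', norm_neg, norm_smul] at h1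
    have h2 := le_of_mul_le_mul_right h1 hn₁'
    exact (le_abs_self γ).trans h2
  · rw [norm_smul, norm_inv, norm_norm, inv_mul_cancel₀ hn₁]
  · rw [map_smul, hv₁', smul_neg, smul_comm]
  · intro v
    rcases eq_or_ne v 0 with rfl | hv
    · simp
    · have h1 : ⨅ x, q x ≤ q ⟨v, hv⟩ := ciInf_le hqb _
      have hv' : 0 < ‖v‖ := norm_pos_iff.2 hv
      simp only [hq] at h1
      rw [le_div_iff₀ (by positivity)] at h1
      rw [hγ, neg_mul, neg_neg]
      exact h1

end

section

/-! ### Two coupled Escape phases -/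

variable {d : ℕ} {Ξ : Type*} [MeasurableSpace Ξ] {P : Measure Ξ} [IsProbabilityMeasure P]
  {f : Point d → Ξ → ℝ} {L ρ σ : ℝ}

/-- The iterate and the estimate after the perturbation `u` of `x`, where the estimate was `v`. -/
def escInit (prm : Params) (f : Point d → Ξ → ℝ) (x v u : Point d) (seed : Seed d Ξ) :
    Point d × Point d :=
  (x + u, stormUpdate f prm.a prm.b seed.1 v x (x + u))

/-- A full step of the Escape phase, for the pair of the iterate and the estimate. -/
def escNext (prm : Params) (f : Point d → Ξ → ℝ) (seed : Seed d Ξ) (q : Point d × Point d) :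
    Point d × Point d :=
  (q.1 - prm.etaH • q.2, stormUpdate f prm.a prm.b seed.1 q.2 q.1 (q.1 - prm.etaH • q.2))

/-- The path of the Escape phase when it is never cut short. Only the samples of the seeds are
used; the perturbation `u` is a separate argument. -/
def escPath (prm : Params) (f : Point d → Ξ → ℝ) (x v u : Point d) (ω : ℕ → Seed d Ξ) (n : ℕ) :
    Point d × Point d :=
  chain (escInit prm f x v u) (escNext prm f) ω n

/-- The Escape phase completes all its iterations: the squared movement stays within budget. -/
def IsStuck (prm : Params) (f : Point d → Ξ → ℝ) (x v u : Point d) (ω : ℕ → Seed d Ξ) : Prop :=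
  ∀ j < prm.ell, ∑ i ∈ Finset.range (j + 1), prm.etaH ^ 2 * ‖(escPath prm f x v u ω i).2‖ ^ 2 ≤
    ((j : ℝ) + 2) * prm.Dbar

/-- The bound for the variance of the difference of the noises of two coupled STORM updates, one
from `x₀` to `x₁`, the other from `x₀'` to `x₁'`. -/
def pairNoise (L ρ a : ℝ) (b : ℕ) (x₀ x₀' x₁ x₁' : Point d) : ℝ :=
  (2 * (L * ‖(x₁ - x₁') - (x₀ - x₀')‖ + ρ * (‖x₁ - x₀‖ + ‖x₁' - x₀'‖) * ‖x₀ - x₀'‖ +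
    a * L * ‖x₁ - x₁'‖)) ^ 2 / b

/-- The difference of the errors of two coupled STORM updates, which use the same samples, is
contracted by `1 - a` and receives a centered noise that is proportional to the difference of the
paths. -/
theorem lintegral_cosh_storm_pair_le (ho : IsStochasticObjective P f)
    (hf : IsSmoothLipschitz f L ρ) (hρ : 0 ≤ ρ) (hL : 0 ≤ L) (hσ : 0 < σ)
    (hd : HasBoundedDeviation P f σ) {a : ℝ} (ha : 0 < a) (ha1 : a ≤ 1) {b : ℕ} (hb : 0 < b)
    (lam : ℝ) (v v' x₀ x₀' x₁ x₁' : Point d) :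
    ∫⁻ ξ, ENNReal.ofReal (Real.cosh (lam *
        ‖(stormUpdate f a b ξ v x₀ x₁ - gradient (objective P f) x₁) -
          (stormUpdate f a b ξ v' x₀' x₁' - gradient (objective P f) x₁')‖))
        ∂(Measure.infinitePi fun _ : ℕ => P) ≤
      ENNReal.ofReal (Real.exp (lam ^ 2 * pairNoise L ρ a b x₀ x₀' x₁ x₁' / 2) *
        Real.cosh ((1 - a) * lam * ‖(v - gradient (objective P f) x₀) -
          (v' - gradient (objective P f) x₀')‖)) := by
  set F := objective P f with hF
  have hFs : IsSmooth F L ρ := isSmooth_objective ho hf hL hρ hσ.le hd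
  set c := 2 * (L * ‖(x₁ - x₁') - (x₀ - x₀')‖ + ρ * (‖x₁ - x₀‖ + ‖x₁' - x₀'‖) * ‖x₀ - x₀'‖ +
    a * L * ‖x₁ - x₁'‖) with hc
  have hc0 : 0 ≤ c := by positivity
  set Z₁ : Ξ → Point d := fun ξ => (gradient (fun y => f y ξ) x₁ - gradient F x₁) -
    (1 - a) • (gradient (fun y => f y ξ) x₀ - gradient F x₀) with hZ₁
  set Z₂ : Ξ → Point d := fun ξ => (gradient (fun y => f y ξ) x₁' - gradient F x₁') -
    (1 - a) • (gradient (fun y => f y ξ) x₀' - gradient F x₀') with hZ₂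
  have hm : ∀ x x' : Point d, Measurable fun ξ => (gradient (fun y => f y ξ) x' - gradient F x') -
      (1 - a) • (gradient (fun y => f y ξ) x - gradient F x) := fun x x' =>
    ((measurable_gradient ho hf x').sub_const _).sub
      (((measurable_gradient ho hf x).sub_const _).fun_const_smul _)
  have hi : ∀ x x' : Point d, Integrable (fun ξ =>
      (gradient (fun y => f y ξ) x' - gradient F x') -
      (1 - a) • (gradient (fun y => f y ξ) x - gradient F x)) P := fun x x' =>
    (integrable_gradient_sub ho hf hσ.le hd x').sub
      ((integrable_gradient_sub ho hf hσ.le hd x).smul (1 - a))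
  have h0 : ∀ x x' : Point d, ∫ ξ, ((gradient (fun y => f y ξ) x' - gradient F x') -
      (1 - a) • (gradient (fun y => f y ξ) x - gradient F x)) ∂P = 0 := by
    intro x x'
    have h1 : Integrable (fun ξ => (1 - a) • (gradient (fun y => f y ξ) x - gradient F x)) P :=
      (integrable_gradient_sub ho hf hσ.le hd x).smul (1 - a)
    rw [integral_sub (integrable_gradient_sub ho hf hσ.le hd x') h1, integral_smul,
      integral_gradient_sub ho hf hL hσ.le hd, integral_gradient_sub ho hf hL hσ.le hd]
    simp
  have hbound : ∀ {φ : Point d → ℝ}, IsSmooth φ L ρ →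
      ‖(1 - a) • ((gradient φ x₁ - gradient φ x₁') - (gradient φ x₀ - gradient φ x₀')) +
        a • (gradient φ x₁ - gradient φ x₁')‖ ≤ c / 2 := by
    intro φ hφ
    have h1 := norm_four_point_le hφ.hasFDerivAt_gradient hφ.hessian_lipschitz hρ
      (hφ.norm_hessian_le hL) x₀ x₀' x₁ x₁'
    have h2 := hφ.gradient_lipschitz x₁ x₁'
    refine (norm_add_le _ _).trans ?_
    rw [norm_smul, norm_smul, Real.norm_of_nonneg ha.le, Real.norm_of_nonneg (by linarith)]
    have h3 : a * ‖gradient φ x₁ - gradient φ x₁'‖ ≤ a * (L * ‖x₁ - x₁'‖) := by gcongr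
    have h4 : (1 - a) * ‖(gradient φ x₁ - gradient φ x₁') - (gradient φ x₀ - gradient φ x₀')‖ ≤
        1 * ‖(gradient φ x₁ - gradient φ x₁') - (gradient φ x₀ - gradient φ x₀')‖ := by
      gcongr; linarith
    rw [hc]
    linarith
  have hZc : ∀ ξ, ‖Z₁ ξ - Z₂ ξ‖ ≤ c := by
    intro ξ
    have e : Z₁ ξ - Z₂ ξ =
        ((1 - a) • ((gradient (fun y => f y ξ) x₁ - gradient (fun y => f y ξ) x₁') -
          (gradient (fun y => f y ξ) x₀ - gradient (fun y => f y ξ) x₀')) +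
          a • (gradient (fun y => f y ξ) x₁ - gradient (fun y => f y ξ) x₁')) -
        ((1 - a) • ((gradient F x₁ - gradient F x₁') - (gradient F x₀ - gradient F x₀')) +
          a • (gradient F x₁ - gradient F x₁')) := by
      simp only [hZ₁, hZ₂]; module
    rw [e]
    refine (norm_sub_le _ _).trans ?_
    have h1 := hbound (hf.isSmooth ξ)
    have h2 := hbound hFs
    linarith
  have h := lintegral_cosh_add_batch_le P (Z := fun ξ => Z₁ ξ - Z₂ ξ)
    ((hm x₀ x₁).sub (hm x₀' x₁')) hc0 hZc
    (by rw [integral_sub (hi x₀ x₁) (hi x₀' x₁'), h0, h0, sub_zero]) lam hb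
    ((1 - a) • ((v - gradient F x₀) - (v' - gradient F x₀')))
  have e : ∀ ξ : ℕ → Ξ, (stormUpdate f a b ξ v x₀ x₁ - gradient F x₁) -
      (stormUpdate f a b ξ v' x₀' x₁' - gradient F x₁') =
      (1 - a) • ((v - gradient F x₀) - (v' - gradient F x₀')) +
        (b : ℝ)⁻¹ • ∑ i ∈ Finset.range b, (Z₁ (ξ i) - Z₂ (ξ i)) := by
    intro ξ
    rw [stormUpdate_sub_eq F a hb, stormUpdate_sub_eq F a hb,
      Finset.sum_sub_distrib (fun i => Z₁ (ξ i)) fun i => Z₂ (ξ i)]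
    simp only [hZ₁, hZ₂]
    module
  simp only [e]
  refine h.trans (le_of_eq ?_)
  rw [norm_smul, Real.norm_of_nonneg (by linarith : 0 ≤ 1 - a), pairNoise]
  congr 3
  ring

/-- The state of two coupled escape paths, together with the variance of the difference of their
errors. -/
abbrev PairState (d : ℕ) := (Point d × Point d) × (Point d × Point d) × ℝ

/-- The initial state of two coupled escape paths with perturbations `u` and `u'`. -/
def pairInit (prm : Params) (f : Point d → Ξ → ℝ) (L ρ : ℝ) (x v u u' : Point d)
    (seed : Seed d Ξ) : PairState d :=
  (escInit prm f x v u seed, escInit prm f x v u' seed,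
    pairNoise L ρ prm.a prm.b x x (x + u) (x + u'))

/-- A simultaneous step of two coupled escape paths. -/
def pairNext (prm : Params) (f : Point d → Ξ → ℝ) (L ρ : ℝ) (seed : Seed d Ξ)
    (q : PairState d) : PairState d :=
  (escNext prm f seed q.1, escNext prm f seed q.2.1,
    (1 - prm.a) ^ 2 * q.2.2 + pairNoise L ρ prm.a prm.b q.1.1 q.2.1.1
      (q.1.1 - prm.etaH • q.1.2) (q.2.1.1 - prm.etaH • q.2.1.2))

/-- The path of two coupled escape paths. -/
def pairPath (prm : Params) (f : Point d → Ξ → ℝ) (L ρ : ℝ) (x v u u' : Point d)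
    (ω : ℕ → Seed d Ξ) (n : ℕ) : PairState d :=
  chain (pairInit prm f L ρ x v u u') (pairNext prm f L ρ) ω n

theorem pairPath_eq (prm : Params) (f : Point d → Ξ → ℝ) (L ρ : ℝ) (x v u u' : Point d)
    (ω : ℕ → Seed d Ξ) (n : ℕ) :
    (pairPath prm f L ρ x v u u' ω n).1 = escPath prm f x v u ω n ∧
      (pairPath prm f L ρ x v u u' ω n).2.1 = escPath prm f x v u' ω n := by
  induction n with
  | zero => exact ⟨rfl, rfl⟩
  | succ n ih =>
    unfold pairPath escPath at ih ⊢
    simp only [chain, pairNext, ih.1, ih.2, and_self]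

theorem measurable_escInit (prm : Params) (ho : IsStochasticObjective P f)
    (hf : IsSmoothLipschitz f L ρ) :
    Measurable fun q : (Point d × Point d × Point d) × Seed d Ξ =>
      escInit prm f q.1.1 q.1.2.1 q.1.2.2 q.2 := by
  have hx : Measurable fun q : (Point d × Point d × Point d) × Seed d Ξ => q.1.1 := by fun_prop
  have hv : Measurable fun q : (Point d × Point d × Point d) × Seed d Ξ => q.1.2.1 := by fun_prop
  have hx' : Measurable fun q : (Point d × Point d × Point d) × Seed d Ξ =>
      q.1.1 + q.1.2.2 := by fun_prop
  have hξ : Measurable fun q : (Point d × Point d × Point d) × Seed d Ξ => q.2.1 := by fun_prop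
  exact hx'.prodMk (measurable_stormUpdate ho hf prm.a prm.b hξ hv hx hx')

theorem measurable_escNext (prm : Params) (ho : IsStochasticObjective P f)
    (hf : IsSmoothLipschitz f L ρ) :
    Measurable (Function.uncurry
      (escNext prm f : Seed d Ξ → Point d × Point d → Point d × Point d)) := by
  have hx : Measurable fun q : Seed d Ξ × (Point d × Point d) => q.2.1 := by fun_prop
  have hv : Measurable fun q : Seed d Ξ × (Point d × Point d) => q.2.2 := by fun_prop
  have hξ : Measurable fun q : Seed d Ξ × (Point d × Point d) => q.1.1 := by fun_prop
  have hx' : Measurable fun q : Seed d Ξ × (Point d × Point d) =>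
      q.2.1 - prm.etaH • q.2.2 := hx.sub (hv.fun_const_smul _)
  exact hx'.prodMk (measurable_stormUpdate ho hf prm.a prm.b hξ hv hx hx')

theorem measurable_escPath (prm : Params) (ho : IsStochasticObjective P f)
    (hf : IsSmoothLipschitz f L ρ) (n : ℕ) :
    Measurable fun q : (Point d × Point d × Point d) × (ℕ → Seed d Ξ) =>
      escPath prm f q.1.1 q.1.2.1 q.1.2.2 q.2 n := by
  induction n with
  | zero =>
    have h : Measurable fun q : (Point d × Point d × Point d) × (ℕ → Seed d Ξ) => (q.1, q.2 0) :=
      measurable_fst.prodMk ((measurable_pi_apply 0).comp measurable_snd)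
    exact (measurable_escInit prm ho hf).comp h
  | succ n ih =>
    have h : Measurable fun q : (Point d × Point d × Point d) × (ℕ → Seed d Ξ) =>
        (q.2 (n + 1), escPath prm f q.1.1 q.1.2.1 q.1.2.2 q.2 n) :=
      ((measurable_pi_apply (n + 1)).comp measurable_snd).prodMk ih
    exact (measurable_escNext prm ho hf).comp h

theorem measurableSet_isStuck (prm : Params) (ho : IsStochasticObjective P f)
    (hf : IsSmoothLipschitz f L ρ) :
    MeasurableSet {q : (Point d × Point d × Point d) × (ℕ → Seed d Ξ) |
      IsStuck prm f q.1.1 q.1.2.1 q.1.2.2 q.2} := by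
  unfold IsStuck
  simp only [Set.ofPred_forall]
  refine MeasurableSet.iInter fun j => MeasurableSet.iInter fun _ => ?_
  refine measurableSet_le (Finset.measurable_fun_sum _ fun i _ => ?_) measurable_const
  exact ((measurable_snd.comp (measurable_escPath prm ho hf i)).norm.pow_const 2).const_mul _

theorem measurable_pairNoise {α : Type*} [MeasurableSpace α] (L ρ a : ℝ) (b : ℕ)
    {x₀ x₀' x₁ x₁' : α → Point d} (h₀ : Measurable x₀) (h₀' : Measurable x₀')
    (h₁ : Measurable x₁) (h₁' : Measurable x₁') :
    Measurable fun q => pairNoise L ρ a b (x₀ q) (x₀' q) (x₁ q) (x₁' q) := by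
  unfold pairNoise
  fun_prop

theorem measurable_pairInit (prm : Params) (ho : IsStochasticObjective P f)
    (hf : IsSmoothLipschitz f L ρ) (x v u u' : Point d) :
    Measurable (pairInit prm f L ρ x v u u' : Seed d Ξ → PairState d) := by
  have h : ∀ u : Point d, Measurable (escInit prm f x v u : Seed d Ξ → _) := fun u =>
    (measurable_escInit prm ho hf).comp
      ((measurable_const (a := (x, v, u))).prodMk measurable_id)
  exact (h u).prodMk ((h u').prodMk measurable_const)

theorem measurable_pairNext (prm : Params) (ho : IsStochasticObjective P f)
    (hf : IsSmoothLipschitz f L ρ) :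
    Measurable (Function.uncurry
      (pairNext prm f L ρ : Seed d Ξ → PairState d → PairState d)) := by
  have hs : Measurable fun q : Seed d Ξ × PairState d => q.1 := measurable_fst
  have h1 : Measurable fun q : Seed d Ξ × PairState d => q.2.1 := by fun_prop
  have h2 : Measurable fun q : Seed d Ξ × PairState d => q.2.2.1 := by fun_prop
  have hV : Measurable fun q : Seed d Ξ × PairState d => q.2.2.2 := by fun_prop
  have e1 := (measurable_escNext prm ho hf).comp (hs.prodMk h1)
  have e2 := (measurable_escNext prm ho hf).comp (hs.prodMk h2)
  have hx : Measurable fun q : Seed d Ξ × PairState d => q.2.1.1 - prm.etaH • q.2.1.2 :=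
    (measurable_fst.comp h1).sub ((measurable_snd.comp h1).fun_const_smul _)
  have hx' : Measurable fun q : Seed d Ξ × PairState d => q.2.2.1.1 - prm.etaH • q.2.2.1.2 :=
    (measurable_fst.comp h2).sub ((measurable_snd.comp h2).fun_const_smul _)
  exact e1.prodMk (e2.prodMk ((hV.const_mul _).add
    (measurable_pairNoise L ρ prm.a prm.b (measurable_fst.comp h1) (measurable_fst.comp h2)
      hx hx')))

/-- The difference of the errors of two coupled paths. -/
def pairErr (F : Point d → ℝ) (q : PairState d) : Point d :=
  (q.1.2 - gradient F q.1.1) - (q.2.1.2 - gradient F q.2.1.1)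

/-- The exponential potential of the difference of the errors of two coupled paths. -/
def pairPotential (F : Point d → ℝ) (lam : ℝ) (q : PairState d) : ENNReal :=
  ENNReal.ofReal (Real.cosh (lam * ‖pairErr F q‖) * Real.exp (-(lam ^ 2 / 2 * q.2.2)))

theorem measurable_pairPotential {F : Point d → ℝ} (hF : IsSmooth F L ρ) (lam : ℝ) :
    Measurable (pairPotential F lam) := by
  have hg : Measurable (gradient F) := hF.differentiable_gradient.continuous.measurable
  have h1 : Measurable fun q : PairState d => pairErr F q := by
    unfold pairErr
    have a1 : Measurable fun q : PairState d => gradient F q.1.1 := hg.comp (by fun_prop)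
    have a2 : Measurable fun q : PairState d => gradient F q.2.1.1 := hg.comp (by fun_prop)
    have a3 : Measurable fun q : PairState d => q.1.2 := by fun_prop
    have a4 : Measurable fun q : PairState d => q.2.1.2 := by fun_prop
    exact (a3.sub a1).sub (a4.sub a2)
  have h2 : Measurable fun q : PairState d => q.2.2 := by fun_prop
  exact ((Real.measurable_cosh.comp (h1.norm.const_mul lam)).mul
    (Real.measurable_exp.comp (h2.const_mul _).neg)).ennreal_ofReal

theorem lintegral_pair_storm_le (ho : IsStochasticObjective P f)
    (hf : IsSmoothLipschitz f L ρ) (hρ : 0 ≤ ρ) (hL : 0 ≤ L) (hσ : 0 < σ)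
    (hd : HasBoundedDeviation P f σ) {a : ℝ} (ha : 0 < a) (ha1 : a ≤ 1) {b : ℕ} (hb : 0 < b)
    {r : ℝ} (hr : 0 < r) (lam V : ℝ) (v v' x₀ x₀' x₁ x₁' : Point d) :
    ∫⁻ seed : Seed d Ξ, ENNReal.ofReal (Real.cosh (lam *
        ‖(stormUpdate f a b seed.1 v x₀ x₁ - gradient (objective P f) x₁) -
          (stormUpdate f a b seed.1 v' x₀' x₁' - gradient (objective P f) x₁')‖) *
        Real.exp (-(lam ^ 2 / 2 * ((1 - a) ^ 2 * V + pairNoise L ρ a b x₀ x₀' x₁ x₁'))))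
        ∂seedLaw P d r ≤
      ENNReal.ofReal (Real.cosh ((1 - a) * lam * ‖(v - gradient (objective P f) x₀) -
          (v' - gradient (objective P f) x₀')‖) * Real.exp (-(((1 - a) * lam) ^ 2 / 2 * V))) := by
  have hprob := isProbabilityMeasure_uniformBall d hr
  set N := pairNoise L ρ a b x₀ x₀' x₁ x₁' with hN
  have hmeas : Measurable fun seed : Seed d Ξ => ENNReal.ofReal (Real.cosh (lam *
        ‖(stormUpdate f a b seed.1 v x₀ x₁ - gradient (objective P f) x₁) -
          (stormUpdate f a b seed.1 v' x₀' x₁' - gradient (objective P f) x₁')‖) *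
        Real.exp (-(lam ^ 2 / 2 * ((1 - a) ^ 2 * V + N)))) := by
    have h2 : ∀ v x x' : Point d, Measurable fun seed : Seed d Ξ =>
        stormUpdate f a b seed.1 v x x' := fun v x x' =>
      measurable_stormUpdate ho hf a b (measurable_fst (α := ℕ → Ξ) (β := Point d))
        measurable_const measurable_const measurable_const
    exact ((Real.measurable_cosh.comp (((((h2 v x₀ x₁).sub_const _).sub
      ((h2 v' x₀' x₁').sub_const _))).norm.const_mul lam)).mul_const _).ennreal_ofReal
  unfold seedLaw
  rw [lintegral_prod_symm _ hmeas.aemeasurable]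
  simp only [ENNReal.ofReal_mul (Real.cosh_pos _).le]
  simp only [lintegral_mul_const' _ _ ENNReal.ofReal_ne_top, lintegral_const, measure_univ, mul_one]
  refine (mul_le_mul_left (lintegral_cosh_storm_pair_le ho hf hρ hL hσ hd ha ha1 hb lam v v'
    x₀ x₀' x₁ x₁') _).trans (le_of_eq ?_)
  rw [← ENNReal.ofReal_mul (by positivity), ← ENNReal.ofReal_mul (by positivity),
    mul_comm (Real.exp _), mul_assoc, ← Real.exp_add]
  congr 3
  ring

/-- With high probability, the difference of the errors of two coupled paths is small, as long as
its variance is. -/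
theorem runLaw_pairErr_gt_le (ho : IsStochasticObjective P f)
    (hf : IsSmoothLipschitz f L ρ) (hρ : 0 ≤ ρ) (hL : 0 ≤ L) (hσ : 0 < σ)
    (hd : HasBoundedDeviation P f σ) {prm : Params} (ha : 0 < prm.a) (ha1 : prm.a ≤ 1)
    (hb : 0 < prm.b) {r : ℝ} (hr : 0 < r) (x v u u' : Point d) (n : ℕ) {τ V : ℝ} (hV : 0 < V)
    (hτ : 0 ≤ τ) :
    runLaw P d r {ω | (pairPath prm f L ρ x v u u' ω n).2.2 ≤ V ∧
        τ < ‖pairErr (objective P f) (pairPath prm f L ρ x v u u' ω n)‖} ≤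
      ENNReal.ofReal (2 * Real.exp (-(τ ^ 2 / (2 * V)))) := by
  have hprob := isProbabilityMeasure_seedLaw P d hr
  have hFs : IsSmooth (objective P f) L ρ := isSmooth_objective ho hf hL hρ hσ.le hd
  have hi := measurable_pairInit prm ho hf x v u u'
  have hs := measurable_pairNext prm ho hf
  have key := lintegral_chain_le_one (seedLaw P d r) hi hs (measurable_pairPotential hFs)
    (1 - prm.a)
    (fun lam => by
      have h := lintegral_pair_storm_le ho hf hρ hL hσ hd ha ha1 hb hr lam 0 v v x x
        (x + u) (x + u')
      simpa [pairPotential, pairErr, pairInit, escInit] using h)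
    (fun lam ω n => by
      generalize chain (pairInit prm f L ρ x v u u') (pairNext prm f L ρ) ω n = q
      exact lintegral_pair_storm_le ho hf hρ hL hσ hd ha ha1 hb hr lam q.2.2 q.1.2 q.2.1.2
        q.1.1 q.2.1.1 (q.1.1 - prm.etaH • q.1.2) (q.2.1.1 - prm.etaH • q.2.1.2)) (τ / V) n
  refine (measure_le_of_lintegral_cosh_le (lam := τ / V) (τ := τ) (V := (τ / V) ^ 2 / 2 * V)
    ((measurable_pairPotential hFs (τ / V)).comp (measurable_chain hi hs n)) key ?_).trans_eq ?_
  · rintro ω ⟨h1, h2⟩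
    refine ⟨τ / V * ‖pairErr (objective P f) (pairPath prm f L ρ x v u u' ω n)‖,
      (τ / V) ^ 2 / 2 * (pairPath prm f L ρ x v u u' ω n).2.2, by gcongr, by gcongr, le_rfl⟩
  · congr 3
    field_simp
    ring

theorem two_mul_add_sq_le (A B C : ℝ) : (2 * (A + B + C)) ^ 2 ≤ 12 * (A ^ 2 + B ^ 2 + C ^ 2) := by
  nlinarith [sq_nonneg (A - B), sq_nonneg (B - C), sq_nonneg (A - C)]

/-- The variance of the difference of the errors, in terms of the difference of the paths. -/
theorem pairPath_variance_le {prm : Params} (hL : 0 ≤ L) (ha : 0 < prm.a)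
    (ha1 : prm.a ≤ 1) (x v u u' : Point d) (ω : ℕ → Seed d Ξ)
    (n : ℕ) :
    let X := fun i => (escPath prm f x v u ω i).1
    let X' := fun i => (escPath prm f x v u' ω i).1
    0 ≤ (pairPath prm f L ρ x v u u' ω n).2.2 ∧
    (pairPath prm f L ρ x v u u' ω n).2.2 ≤
      (16 * L ^ 2 * ‖X 0 - X' 0‖ ^ 2 + ∑ i ∈ Finset.range n,
        12 * (L ^ 2 * ‖(X (i + 1) - X' (i + 1)) - (X i - X' i)‖ ^ 2 +
          ρ ^ 2 * (‖X (i + 1) - X i‖ + ‖X' (i + 1) - X' i‖) ^ 2 * ‖X i - X' i‖ ^ 2 +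
          prm.a ^ 2 * L ^ 2 * ‖X (i + 1) - X' (i + 1)‖ ^ 2)) / prm.b := by
  intro X X'
  induction n with
  | zero =>
    have e : (pairPath prm f L ρ x v u u' ω 0).2.2 =
        pairNoise L ρ prm.a prm.b x x (x + u) (x + u') := rfl
    rw [e, pairNoise]
    refine ⟨by positivity, ?_⟩
    have e2 : X 0 - X' 0 = (x + u) - (x + u') := rfl
    rw [e2]
    simp only [sub_self, sub_zero, norm_zero, mul_zero, add_zero, Finset.range_zero,
      Finset.sum_empty]
    gcongr
    have h1 : prm.a * L * ‖(x + u) - (x + u')‖ ≤ 1 * L * ‖(x + u) - (x + u')‖ := by gcongr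
    calc (2 * (L * ‖(x + u) - (x + u')‖ + prm.a * L * ‖(x + u) - (x + u')‖)) ^ 2
        ≤ (2 * (L * ‖(x + u) - (x + u')‖ + 1 * L * ‖(x + u) - (x + u')‖)) ^ 2 := by gcongr
      _ = _ := by ring
  | succ n ih =>
    obtain ⟨ih0, ih1⟩ := ih
    have e1 := (pairPath_eq prm f L ρ x v u u' ω n).1
    have e2 := (pairPath_eq prm f L ρ x v u u' ω n).2
    have e : (pairPath prm f L ρ x v u u' ω (n + 1)).2.2 =
        (1 - prm.a) ^ 2 * (pairPath prm f L ρ x v u u' ω n).2.2 +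
          pairNoise L ρ prm.a prm.b (X n) (X' n) (X (n + 1)) (X' (n + 1)) := by
      show (1 - prm.a) ^ 2 * (pairPath prm f L ρ x v u u' ω n).2.2 + pairNoise L ρ prm.a prm.b
        (pairPath prm f L ρ x v u u' ω n).1.1 (pairPath prm f L ρ x v u u' ω n).2.1.1
        ((pairPath prm f L ρ x v u u' ω n).1.1 - prm.etaH •
          (pairPath prm f L ρ x v u u' ω n).1.2)
        ((pairPath prm f L ρ x v u u' ω n).2.1.1 - prm.etaH •
          (pairPath prm f L ρ x v u u' ω n).2.1.2) = _
      rw [e1, e2]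
      rfl
    rw [e]
    have hnoise : 0 ≤ pairNoise L ρ prm.a prm.b (X n) (X' n) (X (n + 1)) (X' (n + 1)) := by
      unfold pairNoise; positivity
    refine ⟨by positivity, ?_⟩
    have h1 : (1 - prm.a) ^ 2 * (pairPath prm f L ρ x v u u' ω n).2.2 ≤
        (pairPath prm f L ρ x v u u' ω n).2.2 :=
      mul_le_of_le_one_left ih0 (by nlinarith)
    rw [Finset.sum_range_succ, ← add_assoc, add_div]
    refine add_le_add (h1.trans ih1) ?_
    unfold pairNoise
    gcongr
    refine (two_mul_add_sq_le _ _ _).trans (le_of_eq ?_)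
    ring

/-- A stuck path stays close to its starting point. -/
theorem norm_escPath_sub_le {prm : Params} (hD : 0 ≤ prm.Dbar)
    {x v u : Point d} {ω : ℕ → Seed d Ξ} (h : IsStuck prm f x v u ω) {n : ℕ} (hn : n ≤ prm.ell) :
    ∑ i ∈ Finset.range n, ‖(escPath prm f x v u ω (i + 1)).1 - (escPath prm f x v u ω i).1‖ ^ 2 ≤
        (prm.ell + 1) * prm.Dbar ∧
      ‖(escPath prm f x v u ω n).1 - x‖ ≤ ‖u‖ + (prm.ell + 1) * Real.sqrt prm.Dbar := by
  have hstep : ∀ i, (escPath prm f x v u ω (i + 1)).1 - (escPath prm f x v u ω i).1 =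
      -(prm.etaH • (escPath prm f x v u ω i).2) := by
    intro i
    have e : (escPath prm f x v u ω (i + 1)).1 =
      (escPath prm f x v u ω i).1 - prm.etaH • (escPath prm f x v u ω i).2 := rfl
    rw [e]; abel
  have hsq : ∀ i, ‖(escPath prm f x v u ω (i + 1)).1 - (escPath prm f x v u ω i).1‖ ^ 2 =
      prm.etaH ^ 2 * ‖(escPath prm f x v u ω i).2‖ ^ 2 := by
    intro i
    rw [hstep, norm_neg, norm_smul, mul_pow, Real.norm_eq_abs, sq_abs]
  have h1 : ∑ i ∈ Finset.range n,
      ‖(escPath prm f x v u ω (i + 1)).1 - (escPath prm f x v u ω i).1‖ ^ 2 ≤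
        (prm.ell + 1) * prm.Dbar := by
    simp only [hsq]
    cases n with
    | zero => simp; positivity
    | succ j =>
      refine (h j (by omega)).trans ?_
      have : ((j + 1 : ℕ) : ℝ) ≤ prm.ell := by exact_mod_cast hn
      push_cast at this
      gcongr ?_ * _
      linarith
  refine ⟨h1, ?_⟩
  have h2 : (escPath prm f x v u ω n).1 - x = u + ∑ i ∈ Finset.range n,
      ((escPath prm f x v u ω (i + 1)).1 - (escPath prm f x v u ω i).1) := by
    rw [Finset.sum_range_sub (fun i => (escPath prm f x v u ω i).1)]
    have e : (escPath prm f x v u ω 0).1 = x + u := rfl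
    rw [e]; abel
  rw [h2]
  refine (norm_add_le _ _).trans (add_le_add le_rfl ?_)
  refine (norm_sum_le _ _).trans ?_
  have h3 := sq_sum_le_card_mul_sum_sq (s := Finset.range n)
    (f := fun i => ‖(escPath prm f x v u ω (i + 1)).1 - (escPath prm f x v u ω i).1‖)
  rw [Finset.card_range] at h3
  refine abs_le_of_sq_le_sq' ?_ (by positivity) |>.2
  rw [mul_pow, Real.sq_sqrt hD]
  refine h3.trans ?_
  have h4 : (n : ℝ) ≤ prm.ell + 1 := by
    have : (n : ℝ) ≤ prm.ell := by exact_mod_cast hn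
    linarith
  calc (n : ℝ) * _ ≤ (prm.ell + 1) * ((prm.ell + 1) * prm.Dbar) := by gcongr
    _ = _ := by ring

/-- Near a strict saddle, two coupled Escape phases whose perturbations differ along the most
unstable direction are unlikely to be both stuck. -/
theorem runLaw_both_stuck_le (ho : IsStochasticObjective P f)
    (hf : IsSmoothLipschitz f L ρ) (hρ : 0 ≤ ρ) (hL : 0 < L) (hσ : 0 < σ)
    (hd : HasBoundedDeviation P f σ) {prm : Params} (ha : 0 < prm.a) (ha1 : prm.a ≤ 1)
    (hb : 0 < prm.b) {r : ℝ} (hr : 0 < r) {x v u u' e : Point d} {γ εH s R β : ℝ}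
    (hε : 0 < εH) (hγε : εH < γ) (hγL : γ ≤ L) (he1 : ‖e‖ = 1)
    (he : hessian (objective P f) x e = -(γ • e))
    (hlow : ∀ v, -(γ * ‖v‖ ^ 2) ≤ inner ℝ (hessian (objective P f) x v) v)
    (hη : 0 < prm.etaH) (hηL : prm.etaH * L ≤ 1 / 2) (hD : 0 ≤ prm.Dbar)
    (huu : u - u' = s • e) (hs : s ≠ 0)
    (hu : ‖u‖ + (prm.ell + 1) * Real.sqrt prm.Dbar ≤ R)
    (hu' : ‖u'‖ + (prm.ell + 1) * Real.sqrt prm.Dbar ≤ R)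
    (hM : 4 * ρ ^ 2 * ((prm.ell + 1) * prm.Dbar) ≤ L ^ 2) (hal : prm.a ^ 2 * prm.ell ≤ 1)
    (hβ : 0 ≤ β) (hsmall : prm.ell * prm.etaH * (3 / 2 * (ρ * R) + β) ≤ 1 / 2)
    (hbig : 4 * R < (1 + prm.etaH * εH) ^ prm.ell * |s|) :
    runLaw P d r {ω | IsStuck prm f x v u ω ∧ IsStuck prm f x v u' ω} ≤
      ENNReal.ofReal ((prm.ell + 1) * (2 * Real.exp (-(β ^ 2 * prm.b / (200 * L ^ 2))))) := by
  set F := objective P f with hF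
  have hFs : IsSmooth F L ρ := isSmooth_objective ho hf hL.le hρ hσ.le hd
  set H := hessian F x with hH
  set G := 1 + prm.etaH * γ with hG
  have hγ0 : 0 < γ := hε.trans hγε
  have hb' : (0 : ℝ) < prm.b := by exact_mod_cast hb
  have hW : ‖s • e‖ = |s| := by rw [norm_smul, he1, mul_one, Real.norm_eq_abs]
  have hs0 : 0 < |s| := abs_pos.2 hs
  set bad : ℕ → Set (ℕ → Seed d Ξ) := fun n =>
    {ω | (pairPath prm f L ρ x v u u' ω n).2.2 ≤ 100 * L ^ 2 / prm.b * (G ^ n * |s|) ^ 2 ∧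
      β * (G ^ n * |s|) < ‖pairErr F (pairPath prm f L ρ x v u u' ω n)‖} with hbad
  have hsub : {ω | IsStuck prm f x v u ω ∧ IsStuck prm f x v u' ω} ⊆
      ⋃ n ∈ Finset.range (prm.ell + 1), bad n := by
    rintro ω ⟨h1, h2⟩
    by_contra hω
    simp only [Set.mem_iUnion, not_exists, hbad, Set.mem_ofPred_eq, not_and, not_lt,
      Finset.mem_range] at hω
    set X := fun i => (escPath prm f x v u ω i).1 with hX
    set X' := fun i => (escPath prm f x v u' ω i).1 with hX'
    set w := fun i => X i - X' i with hw
    set y := fun i => pairErr F (pairPath prm f L ρ x v u u' ω i) with hy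
    set p := fun i => (gradient F (X i) - gradient F (X' i) - H (w i)) + y i with hp
    have hw0 : w 0 = s • e := by
      have : w 0 = (x + u) - (x + u') := rfl
      rw [this, ← huu]; abel
    have hyi : ∀ i, y i = ((escPath prm f x v u ω i).2 - gradient F (X i)) -
        ((escPath prm f x v u' ω i).2 - gradient F (X' i)) := by
      intro i
      simp only [hy, pairErr, (pairPath_eq prm f L ρ x v u u' ω i).1,
        (pairPath_eq prm f L ρ x v u u' ω i).2]
      rfl
    have hXR : ∀ i ≤ prm.ell, ‖X i - x‖ ≤ R := fun i hi =>
      (norm_escPath_sub_le hD h1 hi).2.trans hu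
    have hXR' : ∀ i ≤ prm.ell, ‖X' i - x‖ ≤ R := fun i hi =>
      (norm_escPath_sub_le hD h2 hi).2.trans hu'
    have hR0 : 0 ≤ R := (norm_nonneg _).trans (hXR 0 (Nat.zero_le _))
    have hgrow := half_pow_le_norm_of_coupling (H := H) (L := L) (γ := γ) (h := prm.etaH)
      (ϑ := 3 / 2 * (ρ * R) + β) (β := β) (κ := ρ * R) (a := prm.a) (ρ := ρ) (b := prm.b)
      (N := prm.ell) (fun v w => hFs.hessian_symmetric x v w)
      (fun v => (H.le_opNorm v).trans (by gcongr; exact hFs.norm_hessian_le hL.le x))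
      hlow hη hηL hγ0.le hγL (by positivity) hb' (w := w) (p := p) (y := y)
      (V := fun n => (pairPath prm f L ρ x v u u' ω n).2.2)
      (m := fun i => ‖X (i + 1) - X i‖ + ‖X' (i + 1) - X' i‖)
      (by rw [hw0, map_smul, he, smul_neg, smul_comm])
      (fun n _ => by
        have e1 : X (n + 1) = X n - prm.etaH • (escPath prm f x v u ω n).2 := rfl
        have e2 : X' (n + 1) = X' n - prm.etaH • (escPath prm f x v u' ω n).2 := rfl
        simp only [hw, hp]
        rw [e1, e2, hyi]
        module)
      (fun n hn => by
        refine (norm_add_le _ _).trans (add_le_add ?_ le_rfl)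
        exact norm_sub_sub_apply_le hFs.hasFDerivAt_gradient hFs.hessian_lipschitz hρ
          (hXR' n hn.le) (hXR n hn.le))
      (fun n _ => (pairPath_variance_le hL.le ha ha1 x v u u' ω n).2)
      (by
        have a1 := (norm_escPath_sub_le hD h1 le_rfl).1
        have a2 := (norm_escPath_sub_le hD h2 le_rfl).1
        refine le_trans ?_ hM
        calc ∑ i ∈ Finset.range prm.ell, ρ ^ 2 * (‖X (i + 1) - X i‖ + ‖X' (i + 1) - X' i‖) ^ 2
            ≤ ∑ i ∈ Finset.range prm.ell, (2 * ρ ^ 2 * ‖X (i + 1) - X i‖ ^ 2 +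
                2 * ρ ^ 2 * ‖X' (i + 1) - X' i‖ ^ 2) := by
              refine Finset.sum_le_sum fun i _ => ?_
              nlinarith [mul_nonneg (sq_nonneg ρ)
                (sq_nonneg (‖X (i + 1) - X i‖ - ‖X' (i + 1) - X' i‖))]
          _ ≤ 2 * ρ ^ 2 * ((prm.ell + 1) * prm.Dbar) + 2 * ρ ^ 2 * ((prm.ell + 1) * prm.Dbar) := by
              rw [Finset.sum_add_distrib, ← Finset.mul_sum, ← Finset.mul_sum]
              gcongr
          _ = _ := by ring)
      hal
      (fun n hn hVn => by
        rw [hw0, hW] at hVn ⊢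
        exact hω n (by omega) hVn)
      rfl hβ hsmall
    rw [hw0, hW] at hgrow
    have hle : ‖w prm.ell‖ ≤ 2 * R := by
      have : w prm.ell = (X prm.ell - x) - (X' prm.ell - x) := by simp only [hw]; abel
      rw [this]
      refine (norm_sub_le _ _).trans ?_
      have := hXR _ le_rfl
      have := hXR' _ le_rfl
      linarith
    have hGG : (1 + prm.etaH * εH) ^ prm.ell * |s| ≤ (1 + prm.etaH * γ) ^ prm.ell * |s| := by
      gcongr
    linarith
  refine (measure_mono hsub).trans ((measure_biUnion_finset_le _ _).trans ?_)
  have hterm : ∀ n ∈ Finset.range (prm.ell + 1), runLaw P d r (bad n) ≤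
      ENNReal.ofReal (2 * Real.exp (-(β ^ 2 * prm.b / (200 * L ^ 2)))) := by
    intro n _
    have hG0 : 0 < G := by rw [hG]; positivity
    refine (runLaw_pairErr_gt_le ho hf hρ hL.le hσ hd ha ha1 hb hr x v u u' n
      (by positivity) (by positivity)).trans_eq ?_
    congr 3
    field_simp
    ring
  refine (Finset.sum_le_sum hterm).trans (le_of_eq ?_)
  rw [Finset.sum_const, Finset.card_range, nsmul_eq_mul, ← ENNReal.ofReal_natCast,
    ← ENNReal.ofReal_mul (by positivity)]
  push_cast
  rfl

end

section

/-! ### A uniform perturbation is rarely stuck -/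

variable {d : ℕ} {Ξ : Type*} [MeasurableSpace Ξ] {P : Measure Ξ} [IsProbabilityMeasure P]
  {f : Point d → Ξ → ℝ} {L ρ σ : ℝ}

/-- The uniform distribution on a ball changes little under a small shift. -/
theorem uniformBall_le_add (hd : 0 < d) {r : ℝ} (hr : 0 < r) {v : Point d} (hv : ‖v‖ ≤ r)
    (A : Set (Point d)) :
    uniformBall d r A ≤ uniformBall d r ((fun u => u + v) ⁻¹' A) +
      ENNReal.ofReal (d * ‖v‖ / r) := by
  have : Nonempty (Fin d) := ⟨⟨0, hd⟩⟩
  set B := Metric.closedBall (0 : Point d) r with hB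
  have hBm : MeasurableSet B := measurableSet_closedBall
  have hB0 : volume B ≠ 0 := (Metric.measure_closedBall_pos volume (0 : Point d) hr).ne'
  have hBt : volume B ≠ ⊤ := (isCompact_closedBall (0 : Point d) r).measure_lt_top.ne
  set T : Point d → Point d := fun u => u + v with hT
  set B' := Metric.closedBall (0 : Point d) (r * (1 - ‖v‖ / r)) with hB'
  have hvr : ‖v‖ / r ≤ 1 := (div_le_one hr).2 hv
  have hB'eq : volume B' = ENNReal.ofReal ((1 - ‖v‖ / r) ^ d) * volume B := by
    rw [hB', mul_comm r, Measure.addHaar_closedBall_mul volume _ (by linarith) hr.le,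
      finrank_euclideanSpace_fin, hB]
  have hTB : volume (T ⁻¹' B) = volume B := measure_preimage_add_right volume v B
  have hsub : B' ⊆ T ⁻¹' B := by
    intro u hu
    rw [hB', mem_closedBall_zero_iff, mul_sub, mul_one, mul_div_cancel₀ _ hr.ne'] at hu
    rw [Set.mem_preimage, hB, mem_closedBall_zero_iff]
    exact (norm_add_le _ _).trans (by linarith)
  have hsub' : B' ⊆ B := by
    refine Metric.closedBall_subset_closedBall ?_
    have : 0 ≤ r * (‖v‖ / r) := by positivity
    linarith
  have hdiff : volume (T ⁻¹' B \ B) ≤ ENNReal.ofReal (d * ‖v‖ / r) * volume B := by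
    have h1 : volume (T ⁻¹' B \ B) ≤ volume (T ⁻¹' B \ B') :=
      measure_mono (Set.sdiff_subset_sdiff_right hsub')
    refine h1.trans ?_
    rw [measure_sdiff hsub measurableSet_closedBall.nullMeasurableSet
      ((measure_mono hsub').trans_lt hBt.lt_top).ne, hTB, hB'eq]
    rw [tsub_le_iff_right, ← add_mul, ← ENNReal.ofReal_add (by positivity)
      (pow_nonneg (by linarith) d)]
    refine le_mul_of_one_le_left' ?_
    rw [ENNReal.one_le_ofReal]
    have h2 := one_add_mul_le_pow (a := -(‖v‖ / r)) (by linarith) d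
    have h3 : d * ‖v‖ / r = d * (‖v‖ / r) := by ring
    rw [← sub_eq_add_neg] at h2
    linarith
  have hAB : volume (B ∩ A) ≤ volume (B ∩ T ⁻¹' A) + volume (T ⁻¹' B \ B) := by
    rw [← measure_preimage_add_right volume v (B ∩ A)]
    refine le_trans (measure_mono ?_) (measure_union_le _ _)
    rintro u ⟨hu1, hu2⟩
    by_cases hu : u ∈ B
    · exact Or.inl ⟨hu, hu2⟩
    · exact Or.inr ⟨hu1, hu⟩
  unfold uniformBall
  rw [ProbabilityTheory.cond_apply hBm, ProbabilityTheory.cond_apply hBm]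
  calc (volume B)⁻¹ * volume (B ∩ A)
      ≤ (volume B)⁻¹ * (volume (B ∩ T ⁻¹' A) + ENNReal.ofReal (d * ‖v‖ / r) * volume B) := by
        gcongr
        exact hAB.trans (by gcongr)
    _ = _ := by
        rw [mul_add, mul_comm (ENNReal.ofReal _), ← mul_assoc, ENNReal.inv_mul_cancel hB0 hBt,
          one_mul]

/-- If `J` events are pairwise unlikely to occur together, then their expected number is hardly
more than one. -/
theorem sum_measure_le_of_inter_le {Ω : Type*} [MeasurableSpace Ω] {Q : Measure Ω}
    [IsProbabilityMeasure Q] {J : ℕ} {T : ℕ → Set Ω} (hT : ∀ i, MeasurableSet (T i))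
    {τ : ENNReal} (h : ∀ i < J, ∀ j < J, i ≠ j → Q (T i ∩ T j) ≤ τ) :
    ∑ i ∈ Finset.range J, Q (T i) ≤ 1 + J * (J * (J * τ)) := by
  classical
  set N : Set Ω := ⋃ i ∈ Finset.range J, ⋃ j ∈ (Finset.range J).erase i, T i ∩ T j with hN
  have hNm : MeasurableSet N := Finset.measurableSet_biUnion _ fun i _ =>
    Finset.measurableSet_biUnion _ fun j _ => (hT i).inter (hT j)
  have hQN : Q N ≤ J * (J * τ) := by
    refine (measure_biUnion_finset_le _ _).trans ?_
    refine (Finset.sum_le_card_nsmul _ _ (J * τ) fun i hi => ?_).trans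
      (by rw [Finset.card_range, nsmul_eq_mul])
    refine (measure_biUnion_finset_le _ _).trans ?_
    refine (Finset.sum_le_card_nsmul _ _ τ fun j hj => ?_).trans ?_
    · obtain ⟨hj1, hj2⟩ := Finset.mem_erase.1 hj
      exact h i (Finset.mem_range.1 hi) j (Finset.mem_range.1 hj2) hj1.symm
    · rw [nsmul_eq_mul]
      gcongr
      exact (Finset.card_erase_le).trans (Finset.card_range J).le
  have hcount : ∀ ω, ∑ i ∈ Finset.range J, (T i).indicator (1 : Ω → ENNReal) ω ≤
      1 + J * N.indicator 1 ω := by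
    intro ω
    by_cases hω : ω ∈ N
    · rw [Set.indicator_of_mem hω]
      refine (Finset.sum_le_card_nsmul _ _ 1 fun i _ => ?_).trans ?_
      · exact Set.indicator_apply_le fun _ => le_rfl
      · simp
    · rw [Set.indicator_of_notMem hω, mul_zero, add_zero]
      by_cases hex : ∃ i ∈ Finset.range J, ω ∈ T i
      · obtain ⟨i, hi, hiT⟩ := hex
        rw [Finset.sum_eq_single_of_mem i hi]
        · exact Set.indicator_apply_le fun _ => le_rfl
        · intro j hj hji
          refine Set.indicator_of_notMem (fun hjT => hω ?_) _
          simp only [hN, Set.mem_iUnion]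
          exact ⟨i, hi, j, Finset.mem_erase.2 ⟨hji, hj⟩, hiT, hjT⟩
      · push Not at hex
        rw [Finset.sum_eq_zero fun i hi => Set.indicator_of_notMem (hex i hi) _]
        exact zero_le
  calc ∑ i ∈ Finset.range J, Q (T i)
      = ∫⁻ ω, ∑ i ∈ Finset.range J, (T i).indicator (1 : Ω → ENNReal) ω ∂Q := by
        rw [lintegral_finsetSum _ fun i _ => measurable_one.indicator (hT i)]
        simp [hT]
    _ ≤ ∫⁻ ω, (1 + J * N.indicator 1 ω) ∂Q := lintegral_mono hcount
    _ = 1 + J * Q N := by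
        rw [lintegral_add_left measurable_const,
          lintegral_const_mul _ (measurable_one.indicator hNm), lintegral_indicator_one hNm]
        simp
    _ ≤ _ := by gcongr

/-- If a set of perturbations contains, for most samples, at most one of the translates
`u, u + v, …, u + (J - 1) v`, then a uniform perturbation is unlikely to belong to it. -/
theorem uniformBall_prod_le {Ω : Type*} [MeasurableSpace Ω] {Q : Measure Ω}
    [IsProbabilityMeasure Q] (hd : 0 < d) {r : ℝ} (hr : 0 < r) {S : Set (Point d × Ω)}
    (hS : MeasurableSet S) {J : ℕ} (hJ : 0 < J) {v : Point d} (hv : J * ‖v‖ ≤ r) {τ : ENNReal}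
    (h : ∀ u : Point d, ‖u‖ ≤ r → ∀ i < J, ∀ j < J, i ≠ j →
      Q {ω | (u + (i : ℝ) • v, ω) ∈ S ∧ (u + (j : ℝ) • v, ω) ∈ S} ≤ τ) :
    (uniformBall d r).prod Q S ≤
      (J : ENNReal)⁻¹ + J * (J * τ) + ENNReal.ofReal (d * (J * ‖v‖) / r) := by
  have hprob := isProbabilityMeasure_uniformBall d hr
  set c := ENNReal.ofReal (d * (J * ‖v‖) / r) with hc
  set S' : ℕ → Set (Point d × Ω) := fun i => {q | (q.1 + (i : ℝ) • v, q.2) ∈ S} with hS'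
  have hS'm : ∀ i, MeasurableSet (S' i) := fun i =>
    ((measurable_fst.add_const _).prodMk measurable_snd) hS
  have h1 : ∀ i < J, (uniformBall d r).prod Q S ≤ (uniformBall d r).prod Q (S' i) + c := by
    intro i hi
    rw [Measure.prod_apply_symm hS, Measure.prod_apply_symm (hS'm i)]
    have hiv : ‖(i : ℝ) • v‖ ≤ J * ‖v‖ := by
      rw [norm_smul, Real.norm_of_nonneg (Nat.cast_nonneg i)]
      have : (i : ℝ) ≤ J := by exact_mod_cast hi.le
      gcongr
    calc ∫⁻ ω, uniformBall d r ((fun u => (u, ω)) ⁻¹' S) ∂Q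
        ≤ ∫⁻ ω, (uniformBall d r ((fun u => (u, ω)) ⁻¹' S' i) + c) ∂Q := by
          refine lintegral_mono fun ω => ?_
          refine (uniformBall_le_add hd hr (hiv.trans hv) _).trans ?_
          exact add_le_add le_rfl (ENNReal.ofReal_le_ofReal (by gcongr))
      _ = _ := by
          rw [lintegral_add_right _ measurable_const]
          simp
  have h2 : ∑ i ∈ Finset.range J, (uniformBall d r).prod Q (S' i) ≤ 1 + J * (J * (J * τ)) := by
    simp only [Measure.prod_apply (hS'm _)]
    rw [← lintegral_finsetSum _ fun i _ => measurable_measure_prodMk_left (hS'm i)]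
    calc _ ≤ ∫⁻ _u, (1 + J * (J * (J * τ))) ∂uniformBall d r := by
          refine lintegral_mono_ae ?_
          filter_upwards [ae_norm_le_uniformBall d r] with u hu
          exact sum_measure_le_of_inter_le (fun i => measurable_prodMk_left (hS'm i))
            fun i hi j hj hij => h u hu i hi j hj hij
      _ = _ := by simp
  have h3 : J * (uniformBall d r).prod Q S ≤ 1 + J * (J * (J * τ)) + J * c := by
    calc J * (uniformBall d r).prod Q S
        = ∑ _i ∈ Finset.range J, (uniformBall d r).prod Q S := by simp
      _ ≤ ∑ i ∈ Finset.range J, ((uniformBall d r).prod Q (S' i) + c) :=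
          Finset.sum_le_sum fun i hi => h1 i (Finset.mem_range.1 hi)
      _ ≤ _ := by
          rw [Finset.sum_add_distrib]
          simp only [Finset.sum_const, Finset.card_range, nsmul_eq_mul]
          gcongr
  have hJ0 : (J : ENNReal) ≠ 0 := by exact_mod_cast hJ.ne'
  have hJt : (J : ENNReal) ≠ ⊤ := ENNReal.natCast_ne_top J
  calc (uniformBall d r).prod Q S = (J : ENNReal)⁻¹ * (J * (uniformBall d r).prod Q S) := by
        rw [← mul_assoc, ENNReal.inv_mul_cancel hJ0 hJt, one_mul]
    _ ≤ (J : ENNReal)⁻¹ * (1 + J * (J * (J * τ)) + J * c) := by gcongr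
    _ = _ := by
        have e : ∀ z : ENNReal, (J : ENNReal)⁻¹ * (J * z) = z := fun z => by
          rw [← mul_assoc, ENNReal.inv_mul_cancel hJ0 hJt, one_mul]
        rw [mul_add, mul_add, mul_one, e, e]

theorem escPath_congr (prm : Params) (f : Point d → Ξ → ℝ) (x v u : Point d)
    {ω ω' : ℕ → Seed d Ξ} (h : ∀ n, (ω n).1 = (ω' n).1) (n : ℕ) :
    escPath prm f x v u ω n = escPath prm f x v u ω' n := by
  unfold escPath
  induction n with
  | zero => simp only [chain, escInit, h]
  | succ n ih => simp only [chain, escNext, h, ih]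

theorem isStuck_congr (prm : Params) (f : Point d → Ξ → ℝ) (x v u : Point d)
    {ω ω' : ℕ → Seed d Ξ} (h : ∀ n, (ω n).1 = (ω' n).1) :
    IsStuck prm f x v u ω ↔ IsStuck prm f x v u ω' := by
  simp only [IsStuck, escPath_congr prm f x v u h]

/-- For a sequence of independent pairs, the second component of the first pair may be replaced by
an independent copy in an event that otherwise depends on the first components only. -/
theorem infinitePi_prod_apply_eq {A B : Type*} [MeasurableSpace A] [MeasurableSpace B]
    (α : Measure A) [IsProbabilityMeasure α] (ν : Measure B) [IsProbabilityMeasure ν]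
    {S : Set (B × (ℕ → A × B))} (hSm : MeasurableSet S)
    (hS : ∀ u ω ω', (∀ n, (ω n).1 = (ω' n).1) → ((u, ω) ∈ S ↔ (u, ω') ∈ S)) :
    (Measure.infinitePi fun _ : ℕ => α.prod ν) {ω | ((ω 0).2, ω) ∈ S} =
      ν.prod (Measure.infinitePi fun _ : ℕ => α.prod ν) S := by
  set Q := Measure.infinitePi fun _ : ℕ => α.prod ν with hQ
  classical
  set g : B → (ℕ → A × B) → ENNReal := fun u ω => if (u, ω) ∈ S then 1 else 0 with hg
  have hgm : Measurable (Function.uncurry g) :=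
    Measurable.ite (p := fun q => q ∈ S) hSm measurable_const measurable_const
  have hgc : ∀ u ω ω', (∀ n, (ω n).1 = (ω' n).1) → g u ω = g u ω' := by
    intro u ω ω' h
    simp only [hg, hS u ω ω' h]
  have hpre : Measurable fun ω : ℕ → A × B => ((ω 0).2, ω) :=
    (measurable_snd.comp (measurable_pi_apply 0)).prodMk measurable_id
  have hcons : Measurable fun q : (B × (A × B)) × (ℕ → A × B) => (q.1.1, seqCons q.1.2 q.2) :=
    (measurable_fst.comp measurable_fst).prodMk (measurable_seqCons.comp
      ((measurable_snd.comp measurable_fst).prodMk measurable_snd))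
  have hGm : Measurable fun q : B × (A × B) => ∫⁻ ω, g q.1 (seqCons q.2 ω) ∂Q :=
    Measurable.lintegral_prod_right' (hgm.comp hcons)
  have hGc : ∀ (u u' : B) (ξ : A),
      ∫⁻ ω, g u (seqCons (ξ, u') ω) ∂Q = ∫⁻ ω, g u (seqCons (ξ, u) ω) ∂Q := by
    intro u u' ξ
    refine lintegral_congr fun ω => hgc u _ _ fun n => ?_
    cases n <;> rfl
  have hHm : Measurable fun q : A × B => ∫⁻ ω, g q.2 (seqCons (q.1, q.2) ω) ∂Q :=
    hGm.comp (measurable_snd.prodMk measurable_id)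
  have hl : Q {ω | ((ω 0).2, ω) ∈ S} =
      ∫⁻ u, ∫⁻ ξ, ∫⁻ ω, g u (seqCons (ξ, u) ω) ∂Q ∂α ∂ν := by
    have e : Q {ω | ((ω 0).2, ω) ∈ S} = ∫⁻ ω, g (ω 0).2 ω ∂Q := by
      have e0 : {ω : ℕ → A × B | ((ω 0).2, ω) ∈ S} =
          (fun ω : ℕ → A × B => ((ω 0).2, ω)) ⁻¹' S := rfl
      rw [e0, ← lintegral_indicator_one (hpre hSm)]
      refine lintegral_congr fun ω => ?_
      simp only [hg, Set.indicator_apply, Pi.one_apply]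
      rfl
    rw [e]
    have h1 := lintegral_seqCons (α.prod ν) (g := fun ω => g (ω 0).2 ω) (hgm.comp hpre)
    refine h1.trans ?_
    exact lintegral_prod_symm (fun q : A × B => ∫⁻ ω, g q.2 (seqCons (q.1, q.2) ω) ∂Q)
      hHm.aemeasurable
  have hr : ν.prod Q S = ∫⁻ u, ∫⁻ ω, g u ω ∂Q ∂ν := by
    refine Eq.trans ?_ (lintegral_prod (μ := ν) (ν := Q) (Function.uncurry g) hgm.aemeasurable)
    rw [← lintegral_indicator_one hSm]
    refine lintegral_congr fun q => ?_
    simp only [hg, Set.indicator_apply, Pi.one_apply, Function.uncurry]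
  rw [hl, hr]
  refine lintegral_congr fun u => ?_
  have hgu : Measurable (g u) := hgm.comp (measurable_const.prodMk measurable_id)
  rw [lintegral_seqCons (α.prod ν) hgu]
  have hGu : Measurable fun q : A × B => ∫⁻ ω, g u (seqCons q ω) ∂Q :=
    hGm.comp (measurable_const.prodMk measurable_id)
  rw [lintegral_prod (fun q : A × B => ∫⁻ ω, g u (seqCons q ω) ∂Q) hGu.aemeasurable]
  refine lintegral_congr fun ξ => ?_
  simp only [fun u' => hGc u u' ξ]
  simp

/-- The perturbation of the first seed is independent of the samples. -/
theorem runLaw_isStuck_eq (ho : IsStochasticObjective P f) (hf : IsSmoothLipschitz f L ρ)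
    (prm : Params) {r : ℝ} (hr : 0 < r) (x v : Point d) :
    runLaw P d r {ω | IsStuck prm f x v (ω 0).2 ω} =
      (uniformBall d r).prod (runLaw P d r) {q | IsStuck prm f x v q.1 q.2} := by
  have hu := isProbabilityMeasure_uniformBall d hr
  exact infinitePi_prod_apply_eq (Measure.infinitePi fun _ : ℕ => P) (uniformBall d r)
    (((measurable_const (a := x)).prodMk ((measurable_const (a := v)).prodMk
      measurable_fst)).prodMk measurable_snd (measurableSet_isStuck prm ho hf))
    fun u ω ω' h => isStuck_congr prm f x v u h

/-- The parameters make an Escape phase of `ell` iterations from a strict saddle succeed: coupled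
phases that start at distance `s` separate beyond the radius `R` in which a stuck phase remains,
and the relative errors `ρ R` and `β` do not outweigh the instability. -/
structure Params.IsEscaping (prm : Params) (L ρ r εH R β s : ℝ) : Prop where
  a_pos : 0 < prm.a
  a_le_one : prm.a ≤ 1
  b_pos : 0 < prm.b
  etaH_pos : 0 < prm.etaH
  etaH_mul_le : prm.etaH * L ≤ 1 / 2
  Dbar_nonneg : 0 ≤ prm.Dbar
  radius_le : 2 * r + (prm.ell + 1) * Real.sqrt prm.Dbar ≤ R
  movement_le : 4 * ρ ^ 2 * ((prm.ell + 1) * prm.Dbar) ≤ L ^ 2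
  a_sq_mul_ell_le : prm.a ^ 2 * prm.ell ≤ 1
  β_nonneg : 0 ≤ β
  errors_le : prm.ell * prm.etaH * (3 / 2 * (ρ * R) + β) ≤ 1 / 2
  lt_growth : 4 * R < (1 + prm.etaH * εH) ^ prm.ell * s

/-- An Escape phase that starts near a strict saddle is unlikely to be stuck. -/
theorem runLaw_isStuck_le (ho : IsStochasticObjective P f)
    (hf : IsSmoothLipschitz f L ρ) (hρ : 0 ≤ ρ) (hL : 0 < L) (hσ : 0 < σ)
    (hd : HasBoundedDeviation P f σ) (hd0 : 0 < d) {prm : Params} {r εH R β s : ℝ} (hr : 0 < r)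
    (hε : 0 < εH) (hs : 0 < s) (hprm : εH < L → prm.IsEscaping L ρ r εH R β s)
    {J : ℕ} (hJ : 0 < J) (hJs : J * s ≤ r) {x : Point d} {μ : ℝ}
    (hμ : Module.End.HasEigenvalue
      ((hessian (objective P f) x : Point d →L[ℝ] Point d) : Point d →ₗ[ℝ] Point d) μ)
    (hμH : μ < -εH) (v : Point d) :
    runLaw P d r {ω | IsStuck prm f x v (ω 0).2 ω} ≤ (J : ENNReal)⁻¹ + J * (J * ENNReal.ofReal
      ((prm.ell + 1) * (2 * Real.exp (-(β ^ 2 * prm.b / (200 * L ^ 2)))))) +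
      ENNReal.ofReal (d * (J * s) / r) := by
  have hprob := isProbabilityMeasure_runLaw P d hr
  have hFs : IsSmooth (objective P f) L ρ := isSmooth_objective ho hf hL.le hρ hσ.le hd
  have hop : ∀ v, ‖hessian (objective P f) x v‖ ≤ L * ‖v‖ := fun v =>
    ((hessian (objective P f) x).le_opNorm v).trans (by
      gcongr; exact hFs.norm_hessian_le hL.le x)
  obtain ⟨γ, e, hγε, hγL, he1, he, hlow⟩ := exists_least_eigenvector
    (fun v w => hFs.hessian_symmetric x v w) hop hμ hμH
  replace hprm := hprm (hγε.trans_le hγL)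
  have hse : ‖s • e‖ = s := by rw [norm_smul, he1, mul_one, Real.norm_of_nonneg hs.le]
  have hS : MeasurableSet {q : Point d × (ℕ → Seed d Ξ) | IsStuck prm f x v q.1 q.2} :=
    ((measurable_const (a := x)).prodMk ((measurable_const (a := v)).prodMk
      measurable_fst)).prodMk measurable_snd (measurableSet_isStuck prm ho hf)
  rw [runLaw_isStuck_eq ho hf prm hr]
  have key := uniformBall_prod_le (Q := runLaw P d r) hd0 hr hS hJ (v := s • e)
    (by rwa [hse]) (τ := ENNReal.ofReal
      ((prm.ell + 1) * (2 * Real.exp (-(β ^ 2 * prm.b / (200 * L ^ 2)))))) ?_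
  · rwa [hse] at key
  intro u hu i hi j hj hij
  have hnorm : ∀ i < J, ‖u + (i : ℝ) • s • e‖ + (prm.ell + 1) * Real.sqrt prm.Dbar ≤ R := by
    intro i hi
    have h1 : ‖(i : ℝ) • s • e‖ ≤ r := by
      rw [norm_smul, hse, Real.norm_of_nonneg (Nat.cast_nonneg i)]
      refine le_trans ?_ hJs
      gcongr
    have h2 := norm_add_le u ((i : ℝ) • s • e)
    have := hprm.radius_le
    linarith
  have hij1 : (1 : ℝ) ≤ |(i : ℝ) - j| := by
    have h : (1 : ℤ) ≤ |(i : ℤ) - j| := Int.one_le_abs (sub_ne_zero.2 (by exact_mod_cast hij))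
    exact_mod_cast h
  have habs : s ≤ |((i : ℝ) - j) * s| := by
    rw [abs_mul, abs_of_pos hs]
    exact le_mul_of_one_le_left hs.le hij1
  have huu : (u + (i : ℝ) • s • e) - (u + (j : ℝ) • s • e) = (((i : ℝ) - j) * s) • e := by
    rw [add_sub_add_left_eq_sub, ← sub_smul, smul_smul]
  refine runLaw_both_stuck_le ho hf hρ hL hσ hd hprm.a_pos hprm.a_le_one hprm.b_pos hr hε hγε hγL
    he1 he hlow hprm.etaH_pos hprm.etaH_mul_le hprm.Dbar_nonneg (s := ((i : ℝ) - j) * s)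
    huu (abs_pos.1 (hs.trans_le habs)) (hnorm i hi) (hnorm j hj) hprm.movement_le
    hprm.a_sq_mul_ell_le hprm.β_nonneg hprm.errors_le (hprm.lt_growth.trans_le ?_)
  have := hprm.etaH_pos
  gcongr

/-- Markov property: an event about the state at time `n` and the later seeds, whose conditional
probability given the state is at most `c` on `p`, has probability at most `c` together with `p`.
The set `p` of states need not be measurable. -/
theorem measure_chain_shift_le {S Θ : Type*} [MeasurableSpace S] [MeasurableSpace Θ]
    (μ : Measure Θ) [IsProbabilityMeasure μ] {g₀ : Θ → S} {Φ : Θ → S → S} (hg₀ : Measurable g₀)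
    (hΦ : Measurable (Function.uncurry Φ)) (n : ℕ) {T : Set (S × (ℕ → Θ))} (hT : MeasurableSet T)
    {p : S → Prop} {c : ENNReal}
    (h : ∀ s, p s → (Measure.infinitePi fun _ : ℕ => μ) {ω | (s, ω) ∈ T} ≤ c) :
    (Measure.infinitePi fun _ : ℕ => μ) {ω | p (chain g₀ Φ ω n) ∧
      (chain g₀ Φ ω n, fun i => ω (n + 1 + i)) ∈ T} ≤ c := by
  set Q := Measure.infinitePi fun _ : ℕ => μ with hQ
  set U : Set S := {s | Q (Prod.mk s ⁻¹' T) ≤ c} with hU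
  have hUm : MeasurableSet U := measurableSet_le (measurable_measure_prodMk_left hT)
    measurable_const
  have hUT : MeasurableSet ((U ×ˢ Set.univ) ∩ T) := (hUm.prod MeasurableSet.univ).inter hT
  set g : S → (ℕ → Θ) → ENNReal := fun s ω => ((U ×ˢ Set.univ) ∩ T).indicator 1 (s, ω) with hg
  have hgm : Measurable (Function.uncurry g) := measurable_one.indicator hUT
  have hpair : Measurable fun ω : ℕ → Θ => (chain g₀ Φ ω n, fun i => ω (n + 1 + i)) :=
    (measurable_chain hg₀ hΦ n).prodMk (measurable_pi_lambda _ fun i => measurable_pi_apply _)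
  set V : Set (ℕ → Θ) := (fun ω : ℕ → Θ => (chain g₀ Φ ω n, fun i => ω (n + 1 + i))) ⁻¹'
    ((U ×ˢ Set.univ) ∩ T) with hV
  calc Q {ω | p (chain g₀ Φ ω n) ∧ (chain g₀ Φ ω n, fun i => ω (n + 1 + i)) ∈ T} ≤ Q V :=
        measure_mono fun ω hω => ⟨⟨h _ hω.1, trivial⟩, hω.2⟩
    _ = ∫⁻ ω, V.indicator 1 ω ∂Q := (lintegral_indicator_one (hpair hUT)).symm
    _ = ∫⁻ ω, g (chain g₀ Φ ω n) (fun i => ω (n + 1 + i)) ∂Q := rfl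
    _ = ∫⁻ ω, ∫⁻ ω', g (chain g₀ Φ ω n) ω' ∂Q ∂Q := lintegral_chain_shift μ hg₀ hΦ n hgm
    _ ≤ ∫⁻ _ω, c ∂Q := by
        refine lintegral_mono fun ω => ?_
        by_cases hs : chain g₀ Φ ω n ∈ U
        · refine le_trans ?_ hs
          have hm : MeasurableSet (Prod.mk (chain g₀ Φ ω n) ⁻¹' T) := measurable_prodMk_left hT
          rw [← lintegral_indicator_one hm]
          refine lintegral_mono fun ω' => ?_
          simp only [hg]
          refine Set.indicator_le_indicator_of_subset ?_ (fun _ => zero_le) _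
          exact Set.inter_subset_right
        · have : ∀ ω', g (chain g₀ Φ ω n) ω' = 0 := fun ω' =>
            Set.indicator_of_notMem (fun h' => hs h'.1.1) _
          simp [this]
    _ = c := by simp

/-- At a given time, it is unlikely that the run is near a strict saddle and the Escape phase that
starts there is stuck. -/
theorem runLaw_run_isStuck_le (ho : IsStochasticObjective P f)
    (hf : IsSmoothLipschitz f L ρ) (hρ : 0 ≤ ρ) (hL : 0 < L) (hσ : 0 < σ)
    (hd : HasBoundedDeviation P f σ) (hd0 : 0 < d) {prm : Params} {r εH R β s : ℝ} (hr : 0 < r)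
    (hε : 0 < εH) (hs : 0 < s) (hprm : εH < L → prm.IsEscaping L ρ r εH R β s)
    {J : ℕ} (hJ : 0 < J) (hJs : J * s ≤ r) (x₁ : Point d) (n : ℕ) :
    runLaw P d r {ω | (∃ μ < -εH, Module.End.HasEigenvalue
      ((hessian (objective P f) (run prm f x₁ ω n).x : Point d →L[ℝ] Point d) :
        Point d →ₗ[ℝ] Point d) μ) ∧
      IsStuck prm f (run prm f x₁ ω n).x (run prm f x₁ ω n).dir (ω (n + 1)).2
        (fun i => ω (n + 1 + i))} ≤ (J : ENNReal)⁻¹ + J * (J * ENNReal.ofReal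
      ((prm.ell + 1) * (2 * Real.exp (-(β ^ 2 * prm.b / (200 * L ^ 2)))))) +
      ENNReal.ofReal (d * (J * s) / r) := by
  have hprob := isProbabilityMeasure_seedLaw P d hr
  have hT : MeasurableSet {q : State d × (ℕ → Seed d Ξ) |
      IsStuck prm f q.1.x q.1.dir (q.2 0).2 q.2} := by
    have hu : Measurable fun q : State d × (ℕ → Seed d Ξ) => (q.2 0).2 :=
      measurable_snd.comp ((measurable_pi_apply 0).comp measurable_snd)
    exact ((measurable_state_x.comp measurable_fst).prodMk
      ((measurable_state_dir.comp measurable_fst).prodMk hu)).prodMk measurable_snd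
      (measurableSet_isStuck prm ho hf)
  have key := measure_chain_shift_le (seedLaw P d r) (measurable_initState prm ho hf x₁)
    (measurable_step prm ho hf) n hT (p := fun st => ∃ μ < -εH, Module.End.HasEigenvalue
      ((hessian (objective P f) st.x : Point d →L[ℝ] Point d) : Point d →ₗ[ℝ] Point d) μ)
    (fun st ⟨μ, hμH, hμ⟩ => runLaw_isStuck_le ho hf hρ hL hσ hd hd0 hr hε hs hprm hJ hJs hμ hμH
      st.dir)
  simp only [← run_eq_chain] at key
  exact key

end

section

/-! ### The decrease of the objective along a run -/

variable {d : ℕ} {Ξ : Type*} [MeasurableSpace Ξ] {P : Measure Ξ} [IsProbabilityMeasure P]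
  {f : Point d → Ξ → ℝ} {F : Point d → ℝ} {L ρ σ : ℝ}

/-- A perturbation of norm at most `r` hardly increases the objective where the estimated gradient
is small. -/
theorem IsSmooth.le_add_of_norm_le (hF : IsSmooth F L ρ) (hL : 0 ≤ L) {x u v : Point d} {e s r : ℝ}
    (he : ‖v - gradient F x‖ ≤ e) (hv : ‖v‖ ≤ s) (hu : ‖u‖ ≤ r) :
    F (x + u) ≤ F x + ((s + e) * r + L * r ^ 2) := by
  have h1 := hF.le_add_inner_add_sq hL x (x + u)
  rw [add_sub_cancel_left] at h1
  have h2 := real_inner_le_norm (gradient F x) u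
  have h3 : ‖gradient F x‖ ≤ s + e := by
    have := norm_sub_le v (v - gradient F x)
    rw [sub_sub_cancel] at this
    linarith
  have h4 : ‖gradient F x‖ * ‖u‖ ≤ (s + e) * r := by
    gcongr; exact (norm_nonneg _).trans h3
  have h5 : L * ‖u‖ ^ 2 ≤ L * r ^ 2 := by gcongr
  linarith

theorem IsSmooth.le_sub_smul (hF : IsSmooth F L ρ) (hL : 0 ≤ L) {x v : Point d} {e t : ℝ}
    (he : ‖v - gradient F x‖ ≤ e) (ht : 0 ≤ t) :
    F (x - t • v) ≤ F x - t * ‖v‖ ^ 2 + t * (e * ‖v‖) + L * (t * ‖v‖) ^ 2 := by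
  have h1 := hF.le_add_inner_add_sq hL x (x - t • v)
  rw [sub_sub_cancel_left, inner_neg_right, inner_smul_right, norm_neg, norm_smul,
    Real.norm_of_nonneg ht] at h1
  have h2 := real_inner_le_norm (v - gradient F x) v
  rw [inner_sub_left, real_inner_self_eq_norm_sq] at h2
  have h3 : ‖v - gradient F x‖ * ‖v‖ ≤ e * ‖v‖ := by gcongr
  have h4 : t * (‖v‖ ^ 2 - e * ‖v‖) ≤ t * inner ℝ (gradient F x) v := by
    gcongr; linarith
  linarith

/-- A normalized step decreases the objective. -/
theorem IsSmooth.le_sub_of_normalized (hF : IsSmooth F L ρ) (hL : 0 ≤ L) {x v : Point d}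
    {e s η : ℝ} (he : ‖v - gradient F x‖ ≤ e) (hη : 0 ≤ η) (hs : 0 ≤ s) (hv : s < ‖v‖) :
    F (x - (η / ‖v‖) • v) ≤ F x - η * (s - e - L * η) := by
  have hv0 : 0 < ‖v‖ := hs.trans_lt hv
  have h := hF.le_sub_smul hL he (t := η / ‖v‖) (by positivity)
  rw [div_mul_cancel₀ _ hv0.ne'] at h
  have e1 : η / ‖v‖ * ‖v‖ ^ 2 = η * ‖v‖ := by field_simp
  have e2 : η / ‖v‖ * (e * ‖v‖) = η * e := by field_simp
  have h3 : η * s ≤ η * ‖v‖ := by gcongr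
  rw [e1, e2] at h
  linarith

/-- A step of bounded step size decreases the objective, up to the error of the estimate. -/
theorem IsSmooth.le_sub_half (hF : IsSmooth F L ρ) (hL : 0 ≤ L) {x v : Point d} {e t : ℝ}
    (he : ‖v - gradient F x‖ ≤ e) (ht : 0 ≤ t) (hLt : L * t ≤ 1 / 4) :
    F (x - t • v) ≤ F x - t * ‖v‖ ^ 2 / 2 + t * e ^ 2 := by
  have h := hF.le_sub_smul hL he ht
  have h1 : e * ‖v‖ ≤ ‖v‖ ^ 2 / 4 + e ^ 2 := by nlinarith [sq_nonneg (‖v‖ / 2 - e)]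
  have h2 : t * (e * ‖v‖) ≤ t * (‖v‖ ^ 2 / 4 + e ^ 2) := by gcongr
  have h3 : L * (t * ‖v‖) ^ 2 ≤ 1 / 4 * (t * ‖v‖ ^ 2) := by
    calc L * (t * ‖v‖) ^ 2 = (L * t) * (t * ‖v‖ ^ 2) := by ring
      _ ≤ _ := by gcongr
  linarith

/-- The parameters make the objective decrease by `κ` per step on average, if the errors of the
estimates are at most `e`. The last two fields bound the gradient at the start of a completed
Escape phase through the first estimate in that phase. -/
structure Params.IsDecreasing (prm : Params) (L r e κ : ℝ) : Prop where
  eps_pos : 0 < prm.eps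
  eta_nonneg : 0 ≤ prm.eta
  etaH_pos : 0 < prm.etaH
  ell_pos : 0 < prm.ell
  Dbar_nonneg : 0 ≤ prm.Dbar
  κ_pos : 0 < κ
  descent_le : κ ≤ prm.eta * (prm.eps - e - L * prm.eta)
  mul_etaH_le : L * prm.etaH ≤ 1 / 4
  perturb_le : (prm.eps + e) * r + L * r ^ 2 ≤ κ
  error_le : prm.etaH * e ^ 2 ≤ κ
  le_Dbar : 8 * κ * prm.etaH ≤ prm.Dbar
  slack_nonneg : 0 ≤ prm.eps - e - L * r
  Dbar_le : 2 * prm.Dbar ≤ (prm.etaH * (prm.eps - e - L * r)) ^ 2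

/-- At time `m`, the run is in the descent phase and starts an Escape phase. -/
def StartsEscape (prm : Params) (f : Point d → Ξ → ℝ) (x₁ : Point d) (ω : ℕ → Seed d Ξ)
    (m : ℕ) : Prop :=
  (run prm f x₁ ω m).phase = Phase.descent ∧
    (run prm f x₁ ω (m + 1)).phase = Phase.escape 0 0 (run prm f x₁ ω m).x

/-- The path of the Escape phase that starts at time `m`. -/
def escPathFrom (prm : Params) (f : Point d → Ξ → ℝ) (x₁ : Point d) (ω : ℕ → Seed d Ξ)
    (m : ℕ) : ℕ → Point d × Point d :=
  escPath prm f (run prm f x₁ ω m).x (run prm f x₁ ω m).dir (ω (m + 1)).2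
    fun i => ω (m + 1 + i)

/-- The invariant of the run at time `n`: the potential has decreased by `κ` per step, where a
pending Escape phase is accounted for by its accumulated squared movement, and an Escape phase
follows its uncut path and has remained within budget so far. -/
def Invariant (prm : Params) (f : Point d → Ξ → ℝ) (F : Point d → ℝ) (κ : ℝ) (x₁ : Point d)
    (ω : ℕ → Seed d Ξ) (n : ℕ) : Prop :=
  match (run prm f x₁ ω n).phase with
  | Phase.descent => F (run prm f x₁ ω n).x + κ * n ≤ F x₁
  | Phase.escape k S anchor => ∃ m, n = m + 1 + k ∧ k ≤ prm.ell ∧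
      StartsEscape prm f x₁ ω m ∧ (run prm f x₁ ω m).x = anchor ∧
      ((run prm f x₁ ω n).x, (run prm f x₁ ω n).dir) = escPathFrom prm f x₁ ω m k ∧
      S = ∑ i ∈ Finset.range k, prm.etaH ^ 2 * ‖(escPathFrom prm f x₁ ω m i).2‖ ^ 2 ∧
      (∀ j < k, ∑ i ∈ Finset.range (j + 1),
        prm.etaH ^ 2 * ‖(escPathFrom prm f x₁ ω m i).2‖ ^ 2 ≤ ((j : ℝ) + 2) * prm.Dbar) ∧
      F (run prm f x₁ ω n).x + S / (2 * prm.etaH) + κ * m ≤ F x₁ + κ * (k + 1)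
  | Phase.halted out => ∃ m, m + 1 < n ∧ StartsEscape prm f x₁ ω m ∧
      (run prm f x₁ ω m).x = out ∧
      IsStuck prm f (run prm f x₁ ω m).x (run prm f x₁ ω m).dir (ω (m + 1)).2
        fun i => ω (m + 1 + i)

theorem invariant_zero (prm : Params) (f : Point d → Ξ → ℝ) (F : Point d → ℝ) (κ : ℝ)
    (x₁ : Point d) (ω : ℕ → Seed d Ξ) : Invariant prm f F κ x₁ ω 0 := by
  simp [Invariant, run, initState]

set_option maxHeartbeats 1000000 in
/-- A descent step gains `κ` by its length, a perturbation and each Escape iteration lose at most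
`κ`, and a cut Escape phase of `k + 2` steps has gained `4 κ (k + 2)` by its movement. -/
theorem invariant_succ (hF : IsSmooth F L ρ) (hL : 0 ≤ L) {prm : Params} {r e κ : ℝ}
    (hprm : prm.IsDecreasing L r e κ) {x₁ : Point d} {ω : ℕ → Seed d Ξ}
    (hω : ∀ n, ‖(ω n).2‖ ≤ r) {n : ℕ}
    (he : (∀ out, (run prm f x₁ ω n).phase ≠ Phase.halted out) →
      ‖(run prm f x₁ ω n).dir - gradient F (run prm f x₁ ω n).x‖ ≤ e)
    (ih : Invariant prm f F κ x₁ ω n) : Invariant prm f F κ x₁ ω (n + 1) := by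
  have hrun : run prm f x₁ ω (n + 1) = step prm f (ω (n + 1)) (run prm f x₁ ω n) := rfl
  unfold Invariant at ih
  have hη := hprm.etaH_pos
  rcases hph : (run prm f x₁ ω n).phase with _ | ⟨k, S, anc⟩ | out
  · simp only [hph] at ih
    have he' := he (by simp [hph])
    by_cases h : prm.eps < ‖(run prm f x₁ ω n).dir‖
    · have hstep : run prm f x₁ ω (n + 1) = moveTo prm f (ω (n + 1)) (run prm f x₁ ω n)
          ((run prm f x₁ ω n).x - (prm.eta / ‖(run prm f x₁ ω n).dir‖) •
            (run prm f x₁ ω n).dir) Phase.descent := by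
        rw [hrun, step]; simp only [hph, if_pos h]
      have hd := hF.le_sub_of_normalized hL he' hprm.eta_nonneg hprm.eps_pos.le h
      unfold Invariant
      rw [hstep]
      simp only [moveTo]
      push_cast
      have := hprm.descent_le
      linarith
    · have hstep : run prm f x₁ ω (n + 1) = moveTo prm f (ω (n + 1)) (run prm f x₁ ω n)
          ((run prm f x₁ ω n).x + (ω (n + 1)).2)
          (Phase.escape 0 0 (run prm f x₁ ω n).x) := by
        rw [hrun, step]; simp only [hph, if_neg h]
      have hd := hF.le_add_of_norm_le hL he' (not_lt.1 h) (hω (n + 1))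
      have hS : StartsEscape prm f x₁ ω n := ⟨hph, by rw [hstep]; rfl⟩
      unfold Invariant
      rw [hS.2]
      refine ⟨n, rfl, Nat.zero_le _, hS, rfl, ?_, by simp, by simp, ?_⟩
      · rw [hstep]; rfl
      · rw [hstep]
        simp only [moveTo]
        have := hprm.perturb_le
        push_cast
        rw [zero_div]
        linarith
  · simp only [hph] at ih
    obtain ⟨m, hn, hk, hS, hanc, hpath, hSsum, hbud, hpot⟩ := ih
    have he' := he (by simp [hph])
    have hv : (run prm f x₁ ω n).dir = (escPathFrom prm f x₁ ω m k).2 :=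
      congrArg Prod.snd hpath
    by_cases h1 : k < prm.ell
    · by_cases h2 : ((k : ℝ) + 2) * prm.Dbar < S + prm.etaH ^ 2 * ‖(run prm f x₁ ω n).dir‖ ^ 2
      · have hstep : run prm f x₁ ω (n + 1) = moveTo prm f (ω (n + 1)) (run prm f x₁ ω n)
            ((run prm f x₁ ω n).x - (Real.sqrt (((k : ℝ) + 2) * prm.Dbar - S) /
              ‖(run prm f x₁ ω n).dir‖) • (run prm f x₁ ω n).dir) Phase.descent := by
          rw [hrun, step]; simp only [hph, if_pos h1, if_pos h2]
        set w := (run prm f x₁ ω n).dir with hw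
        set s := Real.sqrt (((k : ℝ) + 2) * prm.Dbar - S) with hs
        -- Within budget, the step that is cut has a nonnegative remaining budget.
        have hcap : 0 ≤ ((k : ℝ) + 2) * prm.Dbar - S := by
          have hD := hprm.Dbar_nonneg
          rcases Nat.eq_zero_or_pos k with hk0 | hk0
          · subst hk0
            rw [hSsum]
            simp only [Finset.range_zero, Finset.sum_empty, sub_zero]
            positivity
          · have := hbud (k - 1) (by omega)
            rw [Nat.sub_add_cancel hk0, ← hSsum, Nat.cast_sub hk0] at this
            push_cast at this
            linarith
        have hs2 : s ^ 2 = ((k : ℝ) + 2) * prm.Dbar - S := Real.sq_sqrt hcap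
        have hs0 : 0 ≤ s := Real.sqrt_nonneg _
        have hlt : s < prm.etaH * ‖w‖ := by
          refine lt_of_pow_lt_pow_left₀ 2 (by positivity) ?_
          rw [hs2, mul_pow]; linarith
        have hw0 : 0 < ‖w‖ := by
          by_contra hcon
          have : ‖w‖ = 0 := le_antisymm (not_lt.1 hcon) (norm_nonneg _)
          rw [this, mul_zero] at hlt
          linarith
        have ht : s / ‖w‖ ≤ prm.etaH := (div_le_iff₀ hw0).2 hlt.le
        have ht0 : 0 ≤ s / ‖w‖ := by positivity
        have hd := hF.le_sub_half hL he' ht0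
          (le_trans (by gcongr) hprm.mul_etaH_le)
        have e1 : s ^ 2 / prm.etaH ≤ s / ‖w‖ * ‖w‖ ^ 2 := by
          have : s / ‖w‖ * ‖w‖ ^ 2 = s * ‖w‖ := by field_simp
          rw [this, div_le_iff₀ hη, sq, mul_assoc]
          gcongr
          rw [mul_comm]; exact hlt.le
        have e2 : s / ‖w‖ * e ^ 2 ≤ prm.etaH * e ^ 2 := by gcongr
        have e3 : s ^ 2 / prm.etaH / 2 + S / (2 * prm.etaH) =
            ((k : ℝ) + 2) * prm.Dbar / (2 * prm.etaH) := by
          rw [hs2]; field_simp; ring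
        have e4 : ((k : ℝ) + 2) * (4 * κ) ≤ ((k : ℝ) + 2) * prm.Dbar / (2 * prm.etaH) := by
          rw [le_div_iff₀ (by positivity), mul_assoc]
          have := hprm.le_Dbar
          gcongr
          linarith
        have := hprm.error_le
        have hκ := hprm.κ_pos
        have e5 : 0 ≤ κ * k := by positivity
        unfold Invariant
        rw [hstep]
        simp only [moveTo]
        have hnr : (n : ℝ) = m + 1 + k := by exact_mod_cast hn
        push_cast
        rw [hnr]
        linarith
      · have hstep : run prm f x₁ ω (n + 1) = moveTo prm f (ω (n + 1)) (run prm f x₁ ω n)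
            ((run prm f x₁ ω n).x - prm.etaH • (run prm f x₁ ω n).dir)
            (Phase.escape (k + 1) (S + prm.etaH ^ 2 * ‖(run prm f x₁ ω n).dir‖ ^ 2) anc) := by
          rw [hrun, step]; simp only [hph, if_pos h1, if_neg h2]
        have hd := hF.le_sub_half hL he' hη.le hprm.mul_etaH_le
        unfold Invariant
        rw [hstep]
        simp only [moveTo]
        have hsum : S + prm.etaH ^ 2 * ‖(run prm f x₁ ω n).dir‖ ^ 2 =
            ∑ i ∈ Finset.range (k + 1),
              prm.etaH ^ 2 * ‖(escPathFrom prm f x₁ ω m i).2‖ ^ 2 := by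
          rw [Finset.sum_range_succ, ← hSsum, hv]
        refine ⟨m, by omega, h1, hS, hanc, ?_, hsum, ?_, ?_⟩
        · have e1 : escPathFrom prm f x₁ ω m (k + 1) =
            escNext prm f (ω (m + 1 + (k + 1))) (escPathFrom prm f x₁ ω m k) := rfl
          rw [e1, ← hpath, hn]
          rfl
        · intro j hj
          rcases Nat.lt_succ_iff_lt_or_eq.1 hj with hj' | rfl
          · exact hbud j hj'
          · rw [← hsum]; exact not_lt.1 h2
        · have e1 : (S + prm.etaH ^ 2 * ‖(run prm f x₁ ω n).dir‖ ^ 2) / (2 * prm.etaH) =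
            S / (2 * prm.etaH) + prm.etaH * ‖(run prm f x₁ ω n).dir‖ ^ 2 / 2 := by
            field_simp
          have := hprm.error_le
          rw [e1]
          push_cast
          linarith
    · have hstep : run prm f x₁ ω (n + 1) =
          { run prm f x₁ ω n with phase := Phase.halted anc } := by
        rw [hrun, step]; simp only [hph, if_neg h1]
      unfold Invariant
      rw [hstep]
      refine ⟨m, by omega, hS, hanc, ?_⟩
      have hkl : k = prm.ell := le_antisymm hk (not_lt.1 h1)
      rw [← hkl.symm] at hbud
      exact fun j hj => hbud j (by omega)
  · simp only [hph] at ih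
    have hstep : run prm f x₁ ω (n + 1) = run prm f x₁ ω n := by
      rw [hrun, step]; simp only [hph]
    obtain ⟨m, hm, hrest⟩ := ih
    unfold Invariant
    rw [hstep, hph]
    exact ⟨m, by omega, hrest⟩

theorem evals_run_le (prm : Params) (f : Point d → Ξ → ℝ) (x₁ : Point d) (ω : ℕ → Seed d Ξ)
    (n : ℕ) : (run prm f x₁ ω n).evals ≤ prm.B + 2 * prm.b * n := by
  induction n with
  | zero => simp [run, initState]
  | succ n ih =>
    have hrun : run prm f x₁ ω (n + 1) = step prm f (ω (n + 1)) (run prm f x₁ ω n) := rfl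
    rw [hrun]
    have h : ∀ st : State d, (step prm f (ω (n + 1)) st).evals ≤ st.evals + 2 * prm.b := by
      rintro ⟨x, v, _ | ⟨k, S, anc⟩ | out, N⟩ <;> simp only [step] <;> (try split_ifs) <;>
        simp [moveTo]
    refine (h _).trans ?_
    rw [mul_add, mul_one]
    omega

/-- If the errors of the estimates are small up to time `T`, and no Escape phase is stuck at a
strict saddle, then the run has found an approximate local minimum by time `T`. -/
theorem findsWithin_of_good (hF : IsSmooth F L ρ) (hL : 0 ≤ L) {prm : Params} {r e κ Δ εH N : ℝ}
    (hprm : prm.IsDecreasing L r e κ) {x₁ : Point d} (hΔ : HasGap F x₁ Δ) {ω : ℕ → Seed d Ξ}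
    (hω : ∀ n, ‖(ω n).2‖ ≤ r) {T : ℕ} (hT : Δ / κ + 2 * (prm.ell + 1) < T)
    (hN : (prm.B : ℝ) + 2 * prm.b * T ≤ N)
    (he : ∀ n ≤ T, (∀ out, (run prm f x₁ ω n).phase ≠ Phase.halted out) →
      ‖(run prm f x₁ ω n).dir - gradient F (run prm f x₁ ω n).x‖ ≤ e)
    (hsaddle : ∀ n ≤ T, (∃ μ < -εH, Module.End.HasEigenvalue
      ((hessian F (run prm f x₁ ω n).x : Point d →L[ℝ] Point d) : Point d →ₗ[ℝ] Point d) μ) →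
      ¬ IsStuck prm f (run prm f x₁ ω n).x (run prm f x₁ ω n).dir (ω (n + 1)).2
        (fun i => ω (n + 1 + i))) :
    FindsWithin prm f x₁ (IsApproxLocalMin F prm.eps εH) N ω := by
  have hinv : ∀ n ≤ T, Invariant prm f F κ x₁ ω n := by
    intro n
    induction n with
    | zero => exact fun _ => invariant_zero prm f F κ x₁ ω
    | succ n ih => exact fun hn => invariant_succ hF hL hprm hω (he n (by omega)) (ih (by omega))
  have hκ := hprm.κ_pos
  have hgap : ∀ x, F x₁ ≤ F x + Δ := fun x => by
    have := ciInf_le hΔ.1 x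
    have := hΔ.2
    linarith
  have hT' : Δ + 2 * (prm.ell + 1) * κ < κ * T := by
    have := mul_lt_mul_of_pos_right hT hκ
    rwa [add_mul, div_mul_cancel₀ _ hκ.ne', mul_comm (T : ℝ)] at this
  have hell0 : (0 : ℝ) ≤ prm.ell := Nat.cast_nonneg _
  have h := hinv T le_rfl
  unfold Invariant at h
  rcases hph : (run prm f x₁ ω T).phase with _ | ⟨k, S, anc⟩ | out
  · simp only [hph] at h
    have := hgap (run prm f x₁ ω T).x
    have : 0 ≤ 2 * (prm.ell + 1) * κ := by positivity
    linarith
  · simp only [hph] at h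
    obtain ⟨m, hn, hk, -, -, -, hSsum, -, hpot⟩ := h
    have hS0 : 0 ≤ S / (2 * prm.etaH) := by
      have := hprm.etaH_pos
      have : 0 ≤ S := by rw [hSsum]; positivity
      positivity
    have h1 := hgap (run prm f x₁ ω T).x
    have hkr : (k : ℝ) ≤ prm.ell := by exact_mod_cast hk
    have h2 : κ * (k + 1) ≤ κ * (prm.ell + 1) := by gcongr
    have h3 : (T : ℝ) = m + 1 + k := by exact_mod_cast hn
    rw [h3] at hT'
    linarith
  · simp only [hph] at h
    obtain ⟨m, hm, hS, rfl, hstuck⟩ := h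
    refine ⟨T, _, hph, ⟨?_, fun μ hμ => ?_⟩, le_trans ?_ hN⟩
    · -- The first estimate of the phase is small, because the phase was not cut short.
      have hx : (run prm f x₁ ω (m + 1)).x = (run prm f x₁ ω m).x + (ω (m + 1)).2 ∧
          (run prm f x₁ ω (m + 1)).dir = (escPathFrom prm f x₁ ω m 0).2 := by
        have h := hinv (m + 1) (by omega)
        unfold Invariant at h
        simp only [hS.2] at h
        obtain ⟨m', hm', -, -, -, hpath, -⟩ := h
        obtain rfl : m' = m := by omega
        exact ⟨congrArg Prod.fst hpath, congrArg Prod.snd hpath⟩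
      have h1 := he (m + 1) (by omega) (by simp [hS.2])
      have h2 := hstuck 0 hprm.ell_pos
      simp only [zero_add, Finset.sum_range_one, Nat.cast_zero] at h2
      have h3 : ‖(run prm f x₁ ω (m + 1)).dir‖ ≤ prm.eps - e - L * r := by
        rw [hx.2]
        have hη := hprm.etaH_pos
        refine le_of_mul_le_mul_left ?_ hη
        refine abs_le_of_sq_le_sq' ?_ (mul_nonneg hη.le hprm.slack_nonneg) |>.2
        rw [mul_pow]
        exact h2.trans hprm.Dbar_le
      have h4 : ‖gradient F (run prm f x₁ ω m).x - gradient F (run prm f x₁ ω (m + 1)).x‖ ≤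
          L * r := by
        refine (hF.gradient_lipschitz _ _).trans ?_
        rw [hx.1, sub_add_cancel_left, norm_neg]
        gcongr
        exact hω _
      have h5 : gradient F (run prm f x₁ ω m).x =
          (gradient F (run prm f x₁ ω m).x - gradient F (run prm f x₁ ω (m + 1)).x) -
          ((run prm f x₁ ω (m + 1)).dir - gradient F (run prm f x₁ ω (m + 1)).x) +
          (run prm f x₁ ω (m + 1)).dir := by abel
      rw [h5]
      refine (norm_add_le _ _).trans ?_
      have := norm_sub_le
        (gradient F (run prm f x₁ ω m).x - gradient F (run prm f x₁ ω (m + 1)).x)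
        ((run prm f x₁ ω (m + 1)).dir - gradient F (run prm f x₁ ω (m + 1)).x)
      linarith
    · by_contra hlt
      exact hsaddle m (by omega) ⟨μ, not_le.1 hlt, hμ⟩ hstuck
    · exact_mod_cast evals_run_le prm f x₁ ω T

theorem ae_runLaw_norm_le (P : Measure Ξ) [IsProbabilityMeasure P] (d : ℕ) {r : ℝ} (hr : 0 < r) :
    ∀ᵐ ω ∂runLaw P d r, ∀ n, ‖(ω n).2‖ ≤ r := by
  have hu := isProbabilityMeasure_uniformBall d hr
  have hs := isProbabilityMeasure_seedLaw P d hr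
  rw [ae_all_iff]
  intro n
  have h1 : ∀ᵐ seed ∂seedLaw P d r, ‖seed.2‖ ≤ r := by
    have h := Measure.quasiMeasurePreserving_snd
      (μ := Measure.infinitePi fun _ : ℕ => P) (ν := uniformBall d r)
    exact h.ae (ae_norm_le_uniformBall d r)
  exact (measurePreserving_eval_infinitePi
    (fun _ : ℕ => seedLaw P d r) n).quasiMeasurePreserving.ae h1

/-- The probability of failure is at most the sum, over the times up to `T`, of the probabilities
of a large error of the estimate and of being stuck at a strict saddle. -/
theorem runLaw_not_findsWithin_le (ho : IsStochasticObjective P f)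
    (hf : IsSmoothLipschitz f L ρ) (hρ : 0 ≤ ρ) (hL : 0 < L) (hσ : 0 < σ)
    (hd : HasBoundedDeviation P f σ) (hd0 : 0 < d) {prm : Params}
    {r A e lam κ Δ εH R β s N : ℝ} (hr : 0 < r) (hε : 0 < εH) (hs : 0 < s) (hlam : 0 ≤ lam)
    (hbal : prm.IsBalanced L σ r A) (hdec : prm.IsDecreasing L r e κ)
    (hesc : εH < L → prm.IsEscaping L ρ r εH R β s) {J : ℕ} (hJ : 0 < J) (hJs : J * s ≤ r)
    {x₁ : Point d} (hΔ : HasGap (objective P f) x₁ Δ) {T : ℕ}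
    (hT : Δ / κ + 2 * (prm.ell + 1) < T) (hN : (prm.B : ℝ) + 2 * prm.b * T ≤ N) :
    runLaw P d r {ω | ¬ FindsWithin prm f x₁ (IsApproxLocalMin (objective P f) prm.eps εH) N ω} ≤
      (T + 1) * (ENNReal.ofReal (2 * Real.exp (lam ^ 2 * A - lam * e)) +
        ((J : ENNReal)⁻¹ + J * (J * ENNReal.ofReal
          ((prm.ell + 1) * (2 * Real.exp (-(β ^ 2 * prm.b / (200 * L ^ 2)))))) +
          ENNReal.ofReal (d * (J * s) / r))) := by
  set F := objective P f with hFdef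
  have hF : IsSmooth F L ρ := isSmooth_objective ho hf hL.le hρ hσ.le hd
  set E : ℕ → Set (ℕ → Seed d Ξ) := fun n =>
    {ω | (∀ out, (run prm f x₁ ω n).phase ≠ Phase.halted out) ∧
      e < ‖(run prm f x₁ ω n).dir - gradient F (run prm f x₁ ω n).x‖} with hE
  set G : ℕ → Set (ℕ → Seed d Ξ) := fun n =>
    {ω | (∃ μ < -εH, Module.End.HasEigenvalue
      ((hessian F (run prm f x₁ ω n).x : Point d →L[ℝ] Point d) : Point d →ₗ[ℝ] Point d) μ) ∧
      IsStuck prm f (run prm f x₁ ω n).x (run prm f x₁ ω n).dir (ω (n + 1)).2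
        (fun i => ω (n + 1 + i))} with hG
  have hnull : runLaw P d r {ω | ¬ ∀ n, ‖(ω n).2‖ ≤ r} = 0 := ae_runLaw_norm_le P d hr
  have hsub : {ω | ¬ FindsWithin prm f x₁ (IsApproxLocalMin F prm.eps εH) N ω} ⊆
      {ω | ¬ ∀ n, ‖(ω n).2‖ ≤ r} ∪ ⋃ n ∈ Finset.range (T + 1), (E n ∪ G n) := by
    intro ω hω
    by_contra hcon
    rw [Set.mem_union, not_or] at hcon
    obtain ⟨h1, h2⟩ := hcon
    have h1' : ∀ n, ‖(ω n).2‖ ≤ r := not_not.1 h1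
    simp only [Set.mem_iUnion, not_exists, Finset.mem_range, Set.mem_union, not_or] at h2
    refine hω (findsWithin_of_good hF hL.le hdec hΔ h1' hT hN (fun n hn halive => ?_)
      fun n hn hx hst => (h2 n (by omega)).2 ⟨hx, hst⟩)
    exact not_lt.1 fun hlt => (h2 n (by omega)).1 ⟨halive, hlt⟩
  refine (measure_mono hsub).trans ((measure_union_le _ _).trans ?_)
  rw [hnull, zero_add]
  refine (measure_biUnion_finset_le _ _).trans ?_
  refine (Finset.sum_le_card_nsmul _ _ _ fun n _ => (measure_union_le _ _).trans (add_le_add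
    (runLaw_error_ge_le ho hf hρ hL.le hσ hd hr hbal x₁ hlam e n)
    (runLaw_run_isStuck_le ho hf hρ hL hσ hd hd0 hr hε hs hesc hJ hJs x₁ n))).trans ?_
  rw [Finset.card_range, nsmul_eq_mul]
  push_cast
  rfl

end

section

/-! ### The prescribed parameters -/

/-- The prescribed choice of `b` and `ℓ` in the regime where the logarithmic factor `Λ` dominates
all the constants of the problem, and where `e^Λ` dominates the dimension and the inverses of the
tolerances. -/
structure Regime (d : ℕ) (L ρ σ Δ ε εH δ r Λ : ℝ) (b ℓ : ℕ) : Prop where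
  L_pos : 0 < L
  ρ_pos : 0 < ρ
  σ_pos : 0 < σ
  Δ_pos : 0 < Δ
  ε_pos : 0 < ε
  εH_pos : 0 < εH
  r_pos : 0 < r
  b_pos : 0 < b
  large : 20000 ≤ Λ
  sq_L_le : L ^ 2 ≤ Λ * (σ * ρ)
  L_le : L ≤ Λ
  L_div_ρ_le : 8 * L ≤ Λ * ρ
  σ_le : σ ≤ Λ
  σρ_le : σ * ρ ≤ Λ
  ΔL_le : 32 * (Δ * L) ≤ Λ * σ ^ 2
  σ_le_mul : σ ≤ Λ * (L * Δ)
  ε_le_one : ε ≤ 1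
  ε_le_σ : ε ≤ σ
  one_le_log : 1 ≤ Real.log (4 / δ)
  log_le : Real.log (4 / δ) ≤ Λ
  d_le : (d : ℝ) ≤ Real.exp Λ
  le_δ : Real.exp (-Λ) ≤ δ
  le_r : Real.exp (-Λ) ≤ r
  inv_ε_le : 1 / ε ≤ Real.exp (2 * Λ)
  inv_εH_le : 1 / εH ≤ Real.exp Λ
  le_b : Λ ^ 10 * (σ / ε + σ * ρ / εH ^ 2) ≤ b
  b_le : (b : ℝ) ≤ 2 * (Λ ^ 10 * (σ / ε + σ * ρ / εH ^ 2))
  le_ℓ : Λ ^ 5 * (L / εH) ≤ ℓ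
  ℓ_le : (ℓ : ℝ) ≤ Λ ^ 5 * (L / εH) + 1
  r_le : r ≤ σ / (2 * b * L)
  r_mul_ε_le : r * ε ≤ Λ ^ 2 * (1 / (Λ ^ 3 * L)) * σ ^ 2 / b ^ 2
  L_mul_sq_r_le : L * r ^ 2 ≤ 2 * (Λ ^ 2 * (1 / (Λ ^ 3 * L)) * σ ^ 2 / b ^ 2)

namespace Regime

variable {d : ℕ} {L ρ σ Δ ε εH δ r Λ : ℝ} {b ℓ : ℕ}

theorem Λ_pos (h : Regime d L ρ σ Δ ε εH δ r Λ b ℓ) : 0 < Λ := by linarith [h.large]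

theorem one_le_Λ (h : Regime d L ρ σ Δ ε εH δ r Λ b ℓ) : 1 ≤ Λ := by linarith [h.large]

/-- Powers of `Λ` may be raised, with a gain of a large constant. -/
theorem mul_pow_le (h : Regime d L ρ σ Δ ε εH δ r Λ b ℓ) {m n : ℕ} (hmn : m < n) :
    20000 * Λ ^ m ≤ Λ ^ n := by
  have h1 : Λ ^ (m + 1) ≤ Λ ^ n := pow_le_pow_right₀ h.one_le_Λ hmn
  have h2 : 20000 * Λ ^ m ≤ Λ * Λ ^ m :=
    mul_le_mul_of_nonneg_right h.large (pow_nonneg h.Λ_pos.le m)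
  rw [pow_succ] at h1
  linarith

theorem b_pos' (h : Regime d L ρ σ Δ ε εH δ r Λ b ℓ) : (0 : ℝ) < b := by exact_mod_cast h.b_pos

theorem mul_σ_le (h : Regime d L ρ σ Δ ε εH δ r Λ b ℓ) : Λ ^ 10 * σ ≤ b * ε := by
  have hε := h.ε_pos
  have h1 : Λ ^ 10 * (σ / ε) ≤ b := by
    refine le_trans ?_ h.le_b
    have := h.σ_pos; have := h.ρ_pos; have := h.εH_pos; have := h.Λ_pos
    gcongr
    exact le_add_of_nonneg_right (by positivity)
  rwa [← mul_div_assoc, div_le_iff₀ hε] at h1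

theorem mul_σρ_le (h : Regime d L ρ σ Δ ε εH δ r Λ b ℓ) : Λ ^ 10 * (σ * ρ) ≤ b * εH ^ 2 := by
  have hε : 0 < εH ^ 2 := pow_pos h.εH_pos 2
  have h1 : Λ ^ 10 * (σ * ρ / εH ^ 2) ≤ b := by
    refine le_trans ?_ h.le_b
    have := h.σ_pos; have := h.ε_pos; have := h.Λ_pos
    gcongr
    exact le_add_of_nonneg_left (by positivity)
  rwa [← mul_div_assoc, div_le_iff₀ hε] at h1

theorem pow_le_b (h : Regime d L ρ σ Δ ε εH δ r Λ b ℓ) : Λ ^ 10 ≤ b := by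
  have h1 := h.mul_σ_le
  have h2 : b * ε ≤ b * σ := by have := h.b_pos'; gcongr; exact h.ε_le_σ
  exact le_of_mul_le_mul_right (h1.trans h2) h.σ_pos

theorem pow_mul_sq_le (h : Regime d L ρ σ Δ ε εH δ r Λ b ℓ) : Λ ^ 9 * (L / εH) ^ 2 ≤ b := by
  have hε : 0 < εH ^ 2 := pow_pos h.εH_pos 2
  rw [div_pow, ← mul_div_assoc, div_le_iff₀ hε]
  refine le_trans ?_ h.mul_σρ_le
  have := h.Λ_pos
  calc Λ ^ 9 * L ^ 2 ≤ Λ ^ 9 * (Λ * (σ * ρ)) := by gcongr; exact h.sq_L_le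
    _ = _ := by ring

/-- The length of the Escape phase is dominated by the batch size. -/
theorem pow_mul_ℓ_le (h : Regime d L ρ σ Δ ε εH δ r Λ b ℓ) : 20000 * (Λ ^ 3 * (ℓ + 3)) ≤ b := by
  have h1 := h.pow_mul_sq_le
  have h2 := h.pow_le_b
  have h3 := h.ℓ_le
  have hΛ := h.Λ_pos
  set X := L / εH with hX
  have h4 : Λ ^ 3 * (ℓ + 3) ≤ Λ ^ 3 * (Λ ^ 5 * X + 1 + 3) := by gcongr
  have h5 : X ≤ (X ^ 2 + 1) / 2 := by nlinarith [sq_nonneg (X - 1)]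
  have h6 : Λ ^ 8 * X ≤ Λ ^ 8 * ((X ^ 2 + 1) / 2) := by gcongr
  have h7 := mul_le_mul_of_nonneg_right (h.mul_pow_le (m := 8) (n := 9) (by norm_num)) (sq_nonneg X)
  have h8 := h.mul_pow_le (m := 8) (n := 10) (by norm_num)
  have h9 := h.mul_pow_le (m := 3) (n := 8) (by norm_num)
  have h10 : 0 ≤ Λ ^ 8 := by positivity
  nlinarith

theorem weight_mul_b (h : Regime d L ρ σ Δ ε εH δ r Λ b ℓ) :
    56 ^ 2 * Real.log (4 / δ) / b * b = 3136 * Real.log (4 / δ) := by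
  rw [div_mul_cancel₀ _ h.b_pos'.ne']; norm_num

/-- With the prescribed parameters, the error of the estimate has variance proxy `(Λ σ / b)²`. -/
theorem isBalanced (h : Regime d L ρ σ Δ ε εH δ r Λ b ℓ) (ηH : ℝ) :
    (stormParams L σ δ ε ηH b ℓ).IsBalanced L σ r (Λ ^ 2 * σ ^ 2 / b ^ 2) := by
  have hb := h.b_pos'
  have hL := h.L_pos
  have hσ := h.σ_pos
  have hΛ := h.Λ_pos
  have hl := h.one_le_log
  have hlΛ := h.log_le
  have hlarge := h.large
  have hab := h.weight_mul_b
  have ha : 0 < 56 ^ 2 * Real.log (4 / δ) / b := by positivity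
  refine ⟨ha, h.b_pos, pow_pos h.b_pos 2, ?_, le_of_eq ?_, ?_, ?_, ?_, ?_⟩
  · simp only [stormParams]; positivity
  · simp only [stormParams]; field_simp; norm_num
  · simp only [stormParams]
    calc r ^ 2 ≤ (σ / (2 * b * L)) ^ 2 := by have := h.r_pos; gcongr; exact h.r_le
      _ = _ := by field_simp; norm_num
  · simp only [stormParams]
    rw [div_mul_eq_mul_div, div_le_one hb]
    have h1 := h.pow_mul_ℓ_le
    have h2 : Real.log (4 / δ) ≤ Λ ^ 3 := hlΛ.trans (by
      calc Λ = Λ ^ 1 := (pow_one Λ).symm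
        _ ≤ Λ ^ 3 := pow_le_pow_right₀ h.one_le_Λ (by norm_num))
    calc 56 ^ 2 * Real.log (4 / δ) * (ℓ + 2) ≤ 56 ^ 2 * Λ ^ 3 * (ℓ + 3) := by
          gcongr; norm_num
      _ ≤ 20000 * (Λ ^ 3 * (ℓ + 3)) := by
          have : 0 ≤ Λ ^ 3 * (ℓ + 3) := by positivity
          linarith
      _ ≤ b := h1
  · simp only [stormParams]
    push_cast
    rw [div_le_div_iff_of_pos_right (by positivity)]
    exact le_mul_of_one_le_left (by positivity) (one_le_pow₀ h.one_le_Λ)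
  · simp only [stormParams]
    set a := 56 ^ 2 * Real.log (4 / δ) / (b : ℝ) with hadef
    have e1 : (32 * L ^ 2 * (σ ^ 2 / (4 * (b : ℝ) ^ 2 * L ^ 2)) + 4 * a ^ 2 * σ ^ 2) / b =
        (8 + 4 * (a * b) ^ 2) * (σ ^ 2 / (b : ℝ) ^ 3) := by
      field_simp; ring
    have e2 : a * (Λ ^ 2 * σ ^ 2 / (b : ℝ) ^ 2) = ((a * b) * Λ ^ 2) * (σ ^ 2 / (b : ℝ) ^ 3) := by
      field_simp
    rw [e1, e2, hab]
    gcongr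
    set l := Real.log (4 / δ)
    have h1 : l * l ≤ l * Λ := by gcongr
    have h2 : 20000 * (l * Λ) ≤ Λ * (l * Λ) := by gcongr
    have h3 : 1 * 20000 ≤ l * Λ := by gcongr
    linarith

/-- The bound for the errors of the estimates. -/
def errBound (σ Λ : ℝ) (b : ℕ) : ℝ := Λ ^ 2 * σ / b

/-- The average decrease of the objective per step. -/
def decrease (L σ Λ : ℝ) (b : ℕ) : ℝ := Λ ^ 3 * σ ^ 2 / (32 * b ^ 2 * L)

theorem isDecreasing (h : Regime d L ρ σ Δ ε εH δ r Λ b ℓ) :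
    (stormParams L σ δ ε (1 / (Λ ^ 3 * L)) b ℓ).IsDecreasing L r (errBound σ Λ b)
      (decrease L σ Λ b) := by
  have hb := h.b_pos'
  have hL := h.L_pos
  have hσ := h.σ_pos
  have hΛ := h.Λ_pos
  have hε := h.ε_pos
  have hr := h.r_pos
  have hΛ1 := h.one_le_Λ
  have hbε := h.mul_σ_le
  -- `Λ³ σ / b` is much smaller than `ε`, and it dominates all the quantities compared with `ε`.
  have hq : 20000 * (Λ ^ 3 * σ / b) ≤ ε := by
    rw [← mul_div_assoc, div_le_iff₀ hb]
    have := mul_le_mul_of_nonneg_right (h.mul_pow_le (m := 3) (n := 10) (by norm_num)) hσ.le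
    linarith
  have hσb : σ / b ≤ Λ ^ 3 * σ / b := by
    gcongr; exact le_mul_of_one_le_left hσ.le (one_le_pow₀ hΛ1)
  have he : errBound σ Λ b ≤ Λ ^ 3 * σ / b := by
    unfold errBound; gcongr; norm_num
  have he0 : 0 ≤ errBound σ Λ b := by unfold errBound; positivity
  have hLη : L * (σ / (2 * b * L)) = σ / b / 2 := by field_simp
  have hLr : L * r ≤ σ / b / 2 := by
    rw [← hLη]; gcongr; exact h.r_le
  have hslack : ε / 2 ≤ ε - errBound σ Λ b - L * r := by linarith
  have hQ : Λ ^ 2 * (1 / (Λ ^ 3 * L)) * σ ^ 2 / (b : ℝ) ^ 2 = 1 / Λ * (σ ^ 2 / (b ^ 2 * L)) := by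
    field_simp
  have hw : 0 < σ ^ 2 / ((b : ℝ) ^ 2 * L) := by positivity
  have hκ : decrease L σ Λ b = Λ ^ 3 / 32 * (σ ^ 2 / (b ^ 2 * L)) := by
    unfold decrease; field_simp
  have hΛ3 : (20000 : ℝ) ≤ Λ ^ 3 := by simpa using h.mul_pow_le (m := 0) (n := 3) (by norm_num)
  have hinv : 1 / Λ ≤ 1 := by rw [div_le_one hΛ]; exact hΛ1
  refine ⟨hε, ?_, ?_, ?_, ?_, ?_, ?_, ?_, ?_, ?_, le_of_eq ?_, ?_, ?_⟩
  · simp only [stormParams]; positivity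
  · simp only [stormParams]; positivity
  · simp only [stormParams]
    have h1 := h.le_ℓ
    have h2 : 0 < Λ ^ 5 * (L / εH) := by have := h.εH_pos; positivity
    exact_mod_cast h2.trans_le h1
  · simp only [stormParams]; positivity
  · rw [hκ]; positivity
  · simp only [stormParams]
    rw [hLη]
    have h1 : ε / 2 ≤ ε - errBound σ Λ b - σ / b / 2 := by linarith
    calc decrease L σ Λ b = σ / (2 * b * L) * (Λ ^ 3 * σ / b / 16) := by
          unfold decrease; field_simp; norm_num
      _ ≤ σ / (2 * b * L) * (ε - errBound σ Λ b - σ / b / 2) := by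
          gcongr
          linarith
  · simp only [stormParams]
    have e1 : L * (1 / (Λ ^ 3 * L)) = 1 / Λ ^ 3 := by field_simp
    rw [e1]
    exact one_div_le_one_div_of_le (by norm_num) (by linarith)
  · simp only [stormParams]
    have h1 := h.r_mul_ε_le
    have h2 := h.L_mul_sq_r_le
    rw [hQ] at h1 h2
    have h3 : (ε + errBound σ Λ b) * r ≤ (2 * ε) * r := by gcongr; linarith
    have h4 : 1 / Λ * (σ ^ 2 / ((b : ℝ) ^ 2 * L)) ≤ 1 * (σ ^ 2 / ((b : ℝ) ^ 2 * L)) := by gcongr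
    have h5 : 4 * (σ ^ 2 / ((b : ℝ) ^ 2 * L)) ≤ Λ ^ 3 / 32 * (σ ^ 2 / (b ^ 2 * L)) := by
      gcongr; linarith
    rw [hκ]
    linarith
  · simp only [stormParams]
    have e1 : 1 / (Λ ^ 3 * L) * errBound σ Λ b ^ 2 = Λ * (σ ^ 2 / (b ^ 2 * L)) := by
      unfold errBound; field_simp
    rw [e1, hκ]
    gcongr
    have := h.mul_pow_le (m := 1) (n := 3) (by norm_num)
    rw [pow_one] at this
    linarith
  · simp only [stormParams]
    unfold decrease
    field_simp
    norm_num
  · simp only [stormParams]; linarith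
  · simp only [stormParams]
    calc 2 * (σ ^ 2 / (4 * (b : ℝ) ^ 2 * L ^ 2))
        = 2 * (1 / (Λ ^ 3 * L) * (Λ ^ 3 * σ / b / 2)) ^ 2 := by field_simp; norm_num
      _ ≤ (1 / (Λ ^ 3 * L) * (Λ ^ 3 * σ / b)) ^ 2 := by
          have : 0 ≤ (1 / (Λ ^ 3 * L) * (Λ ^ 3 * σ / b)) ^ 2 := by positivity
          linarith [show (1 / (Λ ^ 3 * L) * (Λ ^ 3 * σ / b / 2)) ^ 2 =
            (1 / (Λ ^ 3 * L) * (Λ ^ 3 * σ / b)) ^ 2 / 4 by ring]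
      _ ≤ _ := by
          gcongr
          have : 0 ≤ Λ ^ 3 * σ / b := by positivity
          linarith

theorem exp_half_le_one_add {y : ℝ} (h0 : 0 ≤ y) (h1 : y ≤ 1) : Real.exp (y / 2) ≤ 1 + y := by
  refine (Real.exp_bound_div_one_sub_of_interval (by linarith) (by linarith)).trans ?_
  rw [div_le_iff₀ (by linarith)]
  nlinarith

/-- The distance of coupled perturbations. -/
def couplingDist (r Λ : ℝ) : ℝ := r * Real.exp (-(70 * Λ))

theorem isEscaping (h : Regime d L ρ σ Δ ε εH δ r Λ b ℓ) (hεL : εH < L) :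
    (stormParams L σ δ ε (1 / (Λ ^ 3 * L)) b ℓ).IsEscaping L ρ r εH
      (2 * εH / (Λ ^ 5 * ρ)) (εH / (16 * Λ ^ 2)) (couplingDist r Λ) := by
  have hb := h.b_pos'
  have hL := h.L_pos
  have hρ := h.ρ_pos
  have hσ := h.σ_pos
  have hΛ := h.Λ_pos
  have hεH := h.εH_pos
  have hr := h.r_pos
  have hΛ1 := h.one_le_Λ
  have hlarge := h.large
  have hbal := h.isBalanced (1 / (Λ ^ 3 * L))
  have hsqrt : Real.sqrt (σ ^ 2 / (4 * (b : ℝ) ^ 2 * L ^ 2)) = σ / (2 * b * L) := by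
    rw [show σ ^ 2 / (4 * (b : ℝ) ^ 2 * L ^ 2) = (σ / (2 * b * L)) ^ 2 by field_simp; norm_num]
    exact Real.sqrt_sq (by positivity)
  have hX1 : 1 ≤ L / εH := (one_le_div hεH).2 hεL.le
  have hX : 20000 ≤ Λ ^ 5 * (L / εH) := by
    have : (20000 : ℝ) ≤ Λ ^ 5 := by simpa using h.mul_pow_le (m := 0) (n := 5) (by norm_num)
    calc (20000 : ℝ) ≤ Λ ^ 5 * 1 := by linarith
      _ ≤ _ := by gcongr
  have hℓ3 : (ℓ : ℝ) + 3 ≤ 2 * (Λ ^ 5 * (L / εH)) := by linarith [h.ℓ_le]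
  have hσb : σ / b ≤ εH ^ 2 / (Λ ^ 10 * ρ) := by
    rw [div_le_div_iff₀ hb (by positivity)]
    have := h.mul_σρ_le
    linarith
  have hΛ3 : (20000 : ℝ) ≤ Λ ^ 3 := by simpa using h.mul_pow_le (m := 0) (n := 3) (by norm_num)
  have ha1 : (stormParams L σ δ ε (1 / (Λ ^ 3 * L)) b ℓ).a ≤ 1 := by
    have h1 := hbal.a_mul_ell_le
    have h2 := hbal.a_pos
    have h3 : (0 : ℝ) ≤ (stormParams L σ δ ε (1 / (Λ ^ 3 * L)) b ℓ).ell := Nat.cast_nonneg _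
    nlinarith
  refine ⟨hbal.a_pos, ha1, h.b_pos, ?_, ?_, hbal.Dbar_nonneg, ?_, ?_, ?_, by positivity, ?_, ?_⟩
  · simp only [stormParams]; positivity
  · simp only [stormParams]
    have e1 : 1 / (Λ ^ 3 * L) * L = 1 / Λ ^ 3 := by field_simp
    rw [e1]
    exact one_div_le_one_div_of_le (by norm_num) (by linarith)
  · simp only [stormParams]
    rw [hsqrt]
    calc 2 * r + (ℓ + 1) * (σ / (2 * b * L)) ≤ (ℓ + 3) * (σ / (2 * b * L)) := by
          linarith [h.r_le]
      _ ≤ (2 * (Λ ^ 5 * (L / εH))) * (σ / (2 * b * L)) := by gcongr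
      _ = Λ ^ 5 / εH * (σ / b) := by field_simp
      _ ≤ Λ ^ 5 / εH * (εH ^ 2 / (Λ ^ 10 * ρ)) := by gcongr
      _ = εH / (Λ ^ 5 * ρ) := by field_simp
      _ ≤ 2 * εH / (Λ ^ 5 * ρ) := by gcongr; linarith
  · simp only [stormParams]
    calc 4 * ρ ^ 2 * ((ℓ + 1) * (σ ^ 2 / (4 * (b : ℝ) ^ 2 * L ^ 2)))
        = ρ ^ 2 / L ^ 2 * (ℓ + 1) * (σ / b) ^ 2 := by field_simp
      _ ≤ ρ ^ 2 / L ^ 2 * (2 * (Λ ^ 5 * (L / εH))) * (εH ^ 2 / (Λ ^ 10 * ρ)) ^ 2 := by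
          gcongr; linarith
      _ = 2 / Λ ^ 15 * (εH ^ 3 / L) := by field_simp
      _ ≤ 1 * (L ^ 3 / L) := by
          gcongr
          rw [div_le_one (by positivity)]
          have : (20000 : ℝ) ≤ Λ ^ 15 := by
            simpa using h.mul_pow_le (m := 0) (n := 15) (by norm_num)
          linarith
      _ = L ^ 2 := by field_simp
  · have h1 := hbal.a_mul_ell_le
    have h2 := hbal.a_pos
    have h3 : (0 : ℝ) ≤ (stormParams L σ δ ε (1 / (Λ ^ 3 * L)) b ℓ).ell := Nat.cast_nonneg _
    have h4 : (stormParams L σ δ ε (1 / (Λ ^ 3 * L)) b ℓ).a *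
      (stormParams L σ δ ε (1 / (Λ ^ 3 * L)) b ℓ).ell ≤ 1 := by linarith
    calc _ = (stormParams L σ δ ε (1 / (Λ ^ 3 * L)) b ℓ).a *
        ((stormParams L σ δ ε (1 / (Λ ^ 3 * L)) b ℓ).a *
        (stormParams L σ δ ε (1 / (Λ ^ 3 * L)) b ℓ).ell) := by ring
      _ ≤ 1 * 1 := by gcongr
      _ = 1 := one_mul 1
  · simp only [stormParams]
    calc ℓ * (1 / (Λ ^ 3 * L)) * (3 / 2 * (ρ * (2 * εH / (Λ ^ 5 * ρ))) + εH / (16 * Λ ^ 2))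
        ≤ (2 * (Λ ^ 5 * (L / εH))) * (1 / (Λ ^ 3 * L)) *
          (3 / 2 * (ρ * (2 * εH / (Λ ^ 5 * ρ))) + εH / (16 * Λ ^ 2)) := by
          gcongr; linarith
      _ = 6 / Λ ^ 3 + 1 / 8 := by field_simp; ring
      _ ≤ 1 / 8 + 1 / 8 := by
          have : 6 / Λ ^ 3 ≤ 1 / 8 := by
            rw [div_le_iff₀ (by positivity)]
            linarith
          linarith
      _ ≤ 1 / 2 := by norm_num
  · simp only [stormParams]
    set y := 1 / (Λ ^ 3 * L) * εH with hy
    have hy0 : 0 ≤ y := by positivity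
    have hy1 : y ≤ 1 := by
      rw [hy, one_div_mul_eq_div, div_le_one (by positivity)]
      calc εH ≤ 1 * L := by linarith
        _ ≤ Λ ^ 3 * L := by gcongr; linarith
    have h1 : Real.exp (Λ ^ 2 / 2) ≤ (1 + y) ^ ℓ := by
      calc Real.exp (Λ ^ 2 / 2) ≤ Real.exp (ℓ * (y / 2)) := by
            apply Real.exp_le_exp.2
            have : Λ ^ 2 / 2 = (Λ ^ 5 * (L / εH)) * (y / 2) := by
              rw [hy]; field_simp
            rw [this]
            gcongr
            exact h.le_ℓ
        _ = Real.exp (y / 2) ^ ℓ := by rw [Real.exp_nat_mul]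
        _ ≤ (1 + y) ^ ℓ := by gcongr; exact exp_half_le_one_add hy0 hy1
    have h2 : 4 * (2 * εH / (Λ ^ 5 * ρ)) ≤ Real.exp Λ := by
      have h3 : 8 * εH ≤ Λ * ρ := by linarith [h.L_div_ρ_le]
      calc 4 * (2 * εH / (Λ ^ 5 * ρ)) = 8 * εH / (Λ ^ 5 * ρ) := by ring
        _ ≤ 1 := by
          rw [div_le_one (by positivity)]
          refine h3.trans ?_
          gcongr
          calc Λ = Λ ^ 1 := (pow_one Λ).symm
            _ ≤ Λ ^ 5 := pow_le_pow_right₀ hΛ1 (by norm_num)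
        _ ≤ Real.exp Λ := Real.one_le_exp hΛ.le
    unfold couplingDist
    calc 4 * (2 * εH / (Λ ^ 5 * ρ)) ≤ Real.exp Λ := h2
      _ < Real.exp (Λ ^ 2 / 2 + (-Λ + -(70 * Λ))) := by
          apply Real.exp_lt_exp.2; nlinarith
      _ = Real.exp (Λ ^ 2 / 2) * (Real.exp (-Λ) * Real.exp (-(70 * Λ))) := by
          rw [Real.exp_add, Real.exp_add]
      _ ≤ (1 + y) ^ ℓ * (r * Real.exp (-(70 * Λ))) := by
          gcongr
          exact h.le_r

end Regime

end

section

/-! ### The number of steps and the probability of failure -/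

namespace Regime

variable {d : ℕ} {L ρ σ Δ ε εH δ r Λ : ℝ} {b ℓ : ℕ}

/-- A number of steps after which the run has halted. -/
def horizon (L σ Δ Λ : ℝ) (b ℓ : ℕ) : ℕ := ⌊Δ / decrease L σ Λ b + 2 * (ℓ + 1)⌋₊ + 1

theorem lt_horizon (L σ Δ Λ : ℝ) (b ℓ : ℕ) :
    Δ / decrease L σ Λ b + 2 * (ℓ + 1) < horizon L σ Δ Λ b ℓ := by
  unfold horizon
  push_cast
  exact Nat.lt_floor_add_one _

theorem div_decrease (h : Regime d L ρ σ Δ ε εH δ r Λ b ℓ) :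
    Δ / decrease L σ Λ b = 32 * (Δ * L) * b ^ 2 / (Λ ^ 3 * σ ^ 2) := by
  have := h.b_pos'; have := h.L_pos; have := h.σ_pos; have := h.Λ_pos
  unfold decrease
  field_simp

theorem horizon_le (h : Regime d L ρ σ Δ ε εH δ r Λ b ℓ) :
    (horizon L σ Δ Λ b ℓ : ℝ) ≤ 32 * (Δ * L) * b ^ 2 / (Λ ^ 3 * σ ^ 2) + 2 * (ℓ + 1) + 1 := by
  have h0 : 0 ≤ Δ / decrease L σ Λ b + 2 * ((ℓ : ℝ) + 1) := by
    rw [h.div_decrease]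
    have := h.Δ_pos; have := h.L_pos; have := h.Λ_pos
    positivity
  rw [← h.div_decrease]
  unfold horizon
  push_cast
  have := Nat.floor_le h0
  linarith

/-- The total cost is of the order `σ L Δ (1/ε + ρ/εH²)³`, up to powers of `Λ`. -/
theorem cost_le (h : Regime d L ρ σ Δ ε εH δ r Λ b ℓ) :
    (b : ℝ) ^ 2 + 2 * b * horizon L σ Δ Λ b ℓ ≤ evalBound 1 28 Λ L ρ σ Δ ε εH := by
  have hb := h.b_pos'
  have hL := h.L_pos
  have hρ := h.ρ_pos
  have hσ := h.σ_pos
  have hΔ := h.Δ_pos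
  have hΛ := h.Λ_pos
  have hε := h.ε_pos
  have hεH := h.εH_pos
  set y := 1 / ε with hy
  set z := ρ / εH ^ 2 with hz
  have hy1 : 1 ≤ y := (one_le_div hε).2 h.ε_le_one
  have hz0 : 0 < z := by positivity
  have hY1 : 1 ≤ y + z := by linarith
  have hY0 : 0 < y + z := by linarith
  have hcube : (y + z) ^ 3 ≤ 4 * (y ^ 3 + z ^ 3) := by
    nlinarith [mul_nonneg hY0.le (sq_nonneg (y - z))]
  have hbY : (b : ℝ) ≤ 2 * Λ ^ 10 * σ * (y + z) := by
    refine h.b_le.trans (le_of_eq ?_)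
    rw [hy, hz]; ring
  have hevals : evalBound 1 28 Λ L ρ σ Δ ε εH = Λ ^ 28 * (σ * L * Δ) * (y ^ 3 + z ^ 3) := by
    rw [evalBound, hy, hz]; field_simp
  set M := σ * L * Δ * (y + z) ^ 3 with hM
  have hM0 : 0 < M := by positivity
  have hb2 : (b : ℝ) ^ 2 ≤ 4 * Λ ^ 21 * M := by
    calc (b : ℝ) ^ 2 ≤ (2 * Λ ^ 10 * σ * (y + z)) ^ 2 := by gcongr
      _ = 4 * Λ ^ 20 * σ * (y + z) ^ 2 * σ := by ring
      _ ≤ 4 * Λ ^ 20 * σ * (y + z) ^ 3 * (Λ * (L * Δ)) := by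
          gcongr ?_ * ?_
          · gcongr
            norm_num
          · exact h.σ_le_mul
      _ = 4 * Λ ^ 21 * M := by rw [hM]; ring
  have hb3 : 2 * b * (32 * (Δ * L) * b ^ 2 / (Λ ^ 3 * σ ^ 2)) ≤ 512 * Λ ^ 27 * M := by
    calc 2 * b * (32 * (Δ * L) * b ^ 2 / (Λ ^ 3 * σ ^ 2))
        = 64 * (Δ * L) / (Λ ^ 3 * σ ^ 2) * (b : ℝ) ^ 3 := by ring
      _ ≤ 64 * (Δ * L) / (Λ ^ 3 * σ ^ 2) * (2 * Λ ^ 10 * σ * (y + z)) ^ 3 := by gcongr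
      _ = 512 * Λ ^ 27 * M := by rw [hM]; field_simp; ring
  have hbℓ : 2 * b * (2 * ((ℓ : ℝ) + 1) + 1) ≤ (b : ℝ) ^ 2 := by
    have h1 := h.pow_mul_ℓ_le
    have h2 : (1 : ℝ) * (ℓ + 3) ≤ Λ ^ 3 * (ℓ + 3) := by
      gcongr; exact one_le_pow₀ h.one_le_Λ
    have h3 : 2 * (2 * ((ℓ : ℝ) + 1) + 1) ≤ b := by linarith [Nat.cast_nonneg (α := ℝ) ℓ]
    nlinarith
  have hT : 2 * b * (horizon L σ Δ Λ b ℓ : ℝ) ≤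
      2 * b * (32 * (Δ * L) * b ^ 2 / (Λ ^ 3 * σ ^ 2) + 2 * (ℓ + 1) + 1) := by
    gcongr; exact h.horizon_le
  have e1 := mul_le_mul_of_nonneg_right (h.mul_pow_le (m := 21) (n := 28) (by norm_num)) hM0.le
  have e2 := mul_le_mul_of_nonneg_right (h.mul_pow_le (m := 27) (n := 28) (by norm_num)) hM0.le
  have e3 : Λ ^ 28 * M ≤ 4 * evalBound 1 28 Λ L ρ σ Δ ε εH := by
    rw [hevals, hM]
    calc Λ ^ 28 * (σ * L * Δ * (y + z) ^ 3) ≤ Λ ^ 28 * (σ * L * Δ * (4 * (y ^ 3 + z ^ 3))) := by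
          gcongr
      _ = _ := by ring
  have e4 : 0 ≤ Λ ^ 28 * M := by positivity
  linarith

theorem pow_le_exp (h : Regime d L ρ σ Δ ε εH δ r Λ b ℓ) (n : ℕ) :
    Λ ^ n ≤ Real.exp (n * Λ) := by
  rw [Real.exp_nat_mul]
  exact pow_le_pow_left₀ h.Λ_pos.le (by linarith [Real.add_one_le_exp Λ]) n

theorem const_le_exp (h : Regime d L ρ σ Δ ε εH δ r Λ b ℓ) : 20000 ≤ Real.exp Λ :=
  by
  linarith [Real.add_one_le_exp Λ, h.large]

theorem ℓ_le_exp (h : Regime d L ρ σ Δ ε εH δ r Λ b ℓ) : (ℓ : ℝ) + 1 ≤ Real.exp (8 * Λ) := by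
  have h1 : Λ ^ 5 * (L / εH) ≤ Real.exp (7 * Λ) := by
    have := h.Λ_pos
    have := h.εH_pos
    calc Λ ^ 5 * (L / εH) = (Λ ^ 5 * L) * (1 / εH) := by ring
      _ ≤ (Λ ^ 5 * Λ) * Real.exp Λ := by
          gcongr
          · exact h.L_le
          · exact h.inv_εH_le
      _ = Λ ^ 6 * Real.exp Λ := by ring
      _ ≤ Real.exp ((6 : ℕ) * Λ) * Real.exp Λ := by gcongr; exact h.pow_le_exp 6
      _ = Real.exp (7 * Λ) := by rw [← Real.exp_add]; congr 1; push_cast; ring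
  have h2 : 1 ≤ Real.exp (7 * Λ) := Real.one_le_exp (by linarith [h.Λ_pos])
  calc (ℓ : ℝ) + 1 ≤ 20000 * Real.exp (7 * Λ) := by linarith [h.ℓ_le]
    _ ≤ Real.exp Λ * Real.exp (7 * Λ) := by gcongr; exact h.const_le_exp
    _ = Real.exp (8 * Λ) := by rw [← Real.exp_add]; congr 1; ring

theorem b_le_exp (h : Regime d L ρ σ Δ ε εH δ r Λ b ℓ) : (b : ℝ) ≤ Real.exp (14 * Λ) := by
  have hΛ := h.Λ_pos
  have hε := h.ε_pos
  have hεH := h.εH_pos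
  have h1 : σ / ε ≤ Λ * Real.exp (2 * Λ) := by
    rw [div_eq_mul_one_div]
    have := h.σ_pos
    gcongr
    · exact h.σ_le
    · exact h.inv_ε_le
  have h2 : σ * ρ / εH ^ 2 ≤ Λ * Real.exp (2 * Λ) := by
    calc σ * ρ / εH ^ 2 = σ * ρ * (1 / εH) ^ 2 := by ring
      _ ≤ Λ * Real.exp Λ ^ 2 := by
          gcongr
          · exact h.σρ_le
          · exact h.inv_εH_le
      _ = Λ * Real.exp (2 * Λ) := by rw [← Real.exp_nat_mul]; norm_num
  calc (b : ℝ) ≤ 2 * (Λ ^ 10 * (Λ * Real.exp (2 * Λ) + Λ * Real.exp (2 * Λ))) := by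
        refine h.b_le.trans ?_
        gcongr
    _ = 4 * (Λ ^ 11 * Real.exp (2 * Λ)) := by ring
    _ ≤ Real.exp Λ * (Real.exp ((11 : ℕ) * Λ) * Real.exp (2 * Λ)) := by
        gcongr
        · linarith [h.const_le_exp]
        · exact h.pow_le_exp 11
    _ = Real.exp (14 * Λ) := by rw [← Real.exp_add, ← Real.exp_add]; congr 1; push_cast; ring

theorem horizon_le_exp (h : Regime d L ρ σ Δ ε εH δ r Λ b ℓ) :
    (horizon L σ Δ Λ b ℓ : ℝ) + 1 ≤ Real.exp (32 * Λ) := by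
  have hΛ := h.Λ_pos
  have hσ := h.σ_pos
  have h1 : 32 * (Δ * L) * b ^ 2 / (Λ ^ 3 * σ ^ 2) ≤ Real.exp (30 * Λ) := by
    calc 32 * (Δ * L) * b ^ 2 / (Λ ^ 3 * σ ^ 2) ≤ Λ * σ ^ 2 * b ^ 2 / (Λ ^ 3 * σ ^ 2) := by
          refine div_le_div_of_nonneg_right ?_ (by positivity)
          exact mul_le_mul_of_nonneg_right h.ΔL_le (by positivity)
      _ = (b : ℝ) ^ 2 / Λ ^ 2 := by field_simp
      _ ≤ (b : ℝ) ^ 2 := div_le_self (by positivity) (one_le_pow₀ h.one_le_Λ)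
      _ ≤ Real.exp (14 * Λ) ^ 2 := by gcongr; exact h.b_le_exp
      _ = Real.exp (28 * Λ) := by rw [← Real.exp_nat_mul]; congr 1; push_cast; ring
      _ ≤ Real.exp (30 * Λ) := Real.exp_le_exp.2 (by linarith)
  have h2 : (ℓ : ℝ) + 1 ≤ Real.exp (30 * Λ) :=
    h.ℓ_le_exp.trans (Real.exp_le_exp.2 (by linarith))
  have h3 : 1 ≤ Real.exp (30 * Λ) := Real.one_le_exp (by linarith)
  calc (horizon L σ Δ Λ b ℓ : ℝ) + 1 ≤ 20000 * Real.exp (30 * Λ) := by linarith [h.horizon_le]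
    _ ≤ Real.exp Λ * Real.exp (30 * Λ) := by gcongr; exact h.const_le_exp
    _ = Real.exp (31 * Λ) := by rw [← Real.exp_add]; congr 1; ring
    _ ≤ Real.exp (32 * Λ) := Real.exp_le_exp.2 (by linarith)

/-- The number of coupled perturbations. -/
def couplings (Λ : ℝ) : ℕ := ⌈Real.exp (34 * Λ)⌉₊

theorem couplings_pos (Λ : ℝ) : 0 < couplings Λ := Nat.ceil_pos.2 (Real.exp_pos _)

theorem couplings_le (h : Regime d L ρ σ Δ ε εH δ r Λ b ℓ) :
    (couplings Λ : ℝ) ≤ Real.exp (35 * Λ) := by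
  have h1 := (Nat.ceil_lt_add_one (Real.exp_pos (34 * Λ)).le).le
  have h2 : 1 ≤ Real.exp (34 * Λ) := Real.one_le_exp (by linarith [h.Λ_pos])
  calc (couplings Λ : ℝ) ≤ 20000 * Real.exp (34 * Λ) := by unfold couplings; linarith
    _ ≤ Real.exp Λ * Real.exp (34 * Λ) := by gcongr; exact h.const_le_exp
    _ = Real.exp (35 * Λ) := by rw [← Real.exp_add]; congr 1; ring

theorem couplings_mul_le (h : Regime d L ρ σ Δ ε εH δ r Λ b ℓ) :
    couplings Λ * couplingDist r Λ ≤ r * Real.exp (-(35 * Λ)) := by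
  have hr := h.r_pos
  calc couplings Λ * couplingDist r Λ ≤ Real.exp (35 * Λ) * (r * Real.exp (-(70 * Λ))) := by
        unfold couplingDist; gcongr; exact h.couplings_le
    _ = r * (Real.exp (35 * Λ) * Real.exp (-(70 * Λ))) := by ring
    _ = r * Real.exp (-(35 * Λ)) := by rw [← Real.exp_add]; congr 2; ring

/-- The total probability of failure. -/
theorem failure_le (h : Regime d L ρ σ Δ ε εH δ r Λ b ℓ) :
    (horizon L σ Δ Λ b ℓ + 1 : ENNReal) *
      (ENNReal.ofReal (2 * Real.exp ((b / (2 * σ)) ^ 2 * (Λ ^ 2 * σ ^ 2 / b ^ 2) -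
        b / (2 * σ) * errBound σ Λ b)) +
        ((couplings Λ : ENNReal)⁻¹ + couplings Λ * (couplings Λ * ENNReal.ofReal
          ((ℓ + 1) * (2 * Real.exp (-((εH / (16 * Λ ^ 2)) ^ 2 * b / (200 * L ^ 2)))))) +
          ENNReal.ofReal (d * (couplings Λ * couplingDist r Λ) / r))) ≤ ENNReal.ofReal δ := by
  have hb := h.b_pos'
  have hL := h.L_pos
  have hσ := h.σ_pos
  have hΛ := h.Λ_pos
  have hεH := h.εH_pos
  have hr := h.r_pos
  have hlarge := h.large
  have hc := h.const_le_exp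
  have hJ0 : (0 : ℝ) < couplings Λ := by exact_mod_cast couplings_pos Λ
  set t := Real.exp (-(34 * Λ)) with ht
  have ht0 : 0 < t := Real.exp_pos _
  have h1 : 2 * Real.exp ((b / (2 * σ)) ^ 2 * (Λ ^ 2 * σ ^ 2 / b ^ 2) -
        b / (2 * σ) * errBound σ Λ b) ≤ t := by
    have e1 : (b / (2 * σ)) ^ 2 * (Λ ^ 2 * σ ^ 2 / b ^ 2) - b / (2 * σ) * errBound σ Λ b =
        -(Λ ^ 2 / 4) := by
      unfold errBound; field_simp; norm_num
    rw [e1]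
    calc 2 * Real.exp (-(Λ ^ 2 / 4)) ≤ Real.exp Λ * Real.exp (-(35 * Λ)) := by
          gcongr
          · linarith
          · nlinarith
      _ = t := by rw [← Real.exp_add, ht]; congr 1; ring
  have h2 : (1 : ℝ) / couplings Λ ≤ t := by
    rw [ht, Real.exp_neg, ← one_div]
    exact one_div_le_one_div_of_le (Real.exp_pos _) (Nat.le_ceil _)
  have h3 : couplings Λ * (couplings Λ *
      ((ℓ + 1) * (2 * Real.exp (-((εH / (16 * Λ ^ 2)) ^ 2 * b / (200 * L ^ 2)))))) ≤ t := by
    have e1 : Λ ^ 2 ≤ (εH / (16 * Λ ^ 2)) ^ 2 * b / (200 * L ^ 2) := by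
      have e2 := h.pow_mul_sq_le
      have e3 : Λ ^ 5 / 51200 =
          (εH / (16 * Λ ^ 2)) ^ 2 * (Λ ^ 9 * (L / εH) ^ 2) / (200 * L ^ 2) := by
        field_simp; norm_num
      calc Λ ^ 2 ≤ Λ ^ 5 / 51200 := by
            have e4 := h.mul_pow_le (m := 2) (n := 4) (by norm_num)
            have e5 := h.mul_pow_le (m := 4) (n := 5) (by norm_num)
            have : 0 ≤ Λ ^ 2 := by positivity
            linarith
        _ ≤ _ := by rw [e3]; gcongr
    calc couplings Λ * (couplings Λ *
          ((ℓ + 1) * (2 * Real.exp (-((εH / (16 * Λ ^ 2)) ^ 2 * b / (200 * L ^ 2))))))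
        ≤ Real.exp (35 * Λ) * (Real.exp (35 * Λ) *
          (Real.exp (8 * Λ) * (Real.exp Λ * Real.exp (-(114 * Λ))))) := by
          gcongr
          · exact h.couplings_le
          · exact h.couplings_le
          · exact h.ℓ_le_exp
          · linarith
          · nlinarith
      _ = Real.exp (-(35 * Λ)) := by
          simp only [← Real.exp_add]; congr 1; ring
      _ ≤ t := Real.exp_le_exp.2 (by linarith)
  have h4 : d * (couplings Λ * couplingDist r Λ) / r ≤ t := by
    rw [div_le_iff₀ hr]
    calc d * (couplings Λ * couplingDist r Λ) ≤ Real.exp Λ * (r * Real.exp (-(35 * Λ))) := by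
          refine mul_le_mul h.d_le h.couplings_mul_le ?_ (Real.exp_pos _).le
          unfold couplingDist; positivity
      _ = Real.exp Λ * Real.exp (-(35 * Λ)) * r := by ring
      _ = t * r := by rw [← Real.exp_add, ht]; congr 2; ring
  have hJ : (couplings Λ : ENNReal) = ENNReal.ofReal (couplings Λ) :=
    (ENNReal.ofReal_natCast _).symm
  have hT : (horizon L σ Δ Λ b ℓ + 1 : ENNReal) ≤ ENNReal.ofReal (Real.exp (32 * Λ)) := by
    have : (horizon L σ Δ Λ b ℓ + 1 : ENNReal) =
        ENNReal.ofReal ((horizon L σ Δ Λ b ℓ : ℝ) + 1) := by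
      rw [ENNReal.ofReal_add (by positivity) zero_le_one, ENNReal.ofReal_natCast,
        ENNReal.ofReal_one]
    rw [this]
    exact ENNReal.ofReal_le_ofReal h.horizon_le_exp
  rw [hJ, ← ENNReal.ofReal_inv_of_pos hJ0, ← ENNReal.ofReal_mul hJ0.le,
    ← ENNReal.ofReal_mul hJ0.le]
  have hsum : 4 * t * Real.exp (32 * Λ) ≤ δ := by
    refine le_trans ?_ h.le_δ
    calc 4 * t * Real.exp (32 * Λ) ≤ Real.exp Λ * t * Real.exp (32 * Λ) := by gcongr; linarith
      _ = Real.exp (-Λ) := by rw [ht, ← Real.exp_add, ← Real.exp_add]; congr 1; ring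
  calc _ ≤ ENNReal.ofReal (Real.exp (32 * Λ)) * (ENNReal.ofReal t + (ENNReal.ofReal t +
        ENNReal.ofReal t + ENNReal.ofReal t)) := by
        gcongr
        rwa [← one_div]
    _ = ENNReal.ofReal (4 * t * Real.exp (32 * Λ)) := by
        simp only [← ENNReal.ofReal_add ht0.le ht0.le,
          ← ENNReal.ofReal_add (add_nonneg ht0.le ht0.le) ht0.le,
          ← ENNReal.ofReal_add ht0.le (add_nonneg (add_nonneg ht0.le ht0.le) ht0.le)]
        rw [← ENNReal.ofReal_mul (Real.exp_pos _).le]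
        congr 1
        ring
    _ ≤ ENNReal.ofReal δ := ENNReal.ofReal_le_ofReal hsum

/-- In the regime of the prescribed parameters, the run finds an approximate local minimum. -/
theorem runLaw_not_findsWithin_le (h : Regime d L ρ σ Δ ε εH δ r Λ b ℓ) (hd0 : 0 < d)
    {Ξ : Type*} [MeasurableSpace Ξ] {P : Measure Ξ} [IsProbabilityMeasure P]
    {f : Point d → Ξ → ℝ} {x₁ : Point d} (ho : IsStochasticObjective P f)
    (hf : IsSmoothLipschitz f L ρ) (hd : HasBoundedDeviation P f σ)
    (hΔ : HasGap (objective P f) x₁ Δ) :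
    runLaw P d r {ω | ¬ FindsWithin (stormParams L σ δ ε (1 / (Λ ^ 3 * L)) b ℓ) f x₁
      (IsApproxLocalMin (objective P f) ε εH) (evalBound 1 28 Λ L ρ σ Δ ε εH) ω} ≤
        ENNReal.ofReal δ := by
  have hσ := h.σ_pos
  have hJs : couplings Λ * couplingDist r Λ ≤ r := by
    refine h.couplings_mul_le.trans (mul_le_of_le_one_right h.r_pos.le ?_)
    exact Real.exp_le_one_iff.2 (by linarith [h.Λ_pos])
  refine (LENA.runLaw_not_findsWithin_le ho hf h.ρ_pos.le h.L_pos h.σ_pos hd hd0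
    (lam := b / (2 * σ)) h.r_pos h.εH_pos (mul_pos h.r_pos (Real.exp_pos _)) (by positivity)
    (h.isBalanced _) h.isDecreasing h.isEscaping (couplings_pos Λ) hJs hΔ
    (T := horizon L σ Δ Λ b ℓ) (lt_horizon L σ Δ Λ b ℓ) ?_).trans h.failure_le
  refine le_trans (le_of_eq ?_) h.cost_le
  simp [stormParams]

/-- A lower bound for the logarithmic factor which makes it dominate all the constants. -/
def logThreshold (L ρ σ Δ : ℝ) : ℝ :=
  20000 + L ^ 2 / (σ * ρ) + L + 8 * L / ρ + σ + σ * ρ + 32 * (Δ * L) / σ ^ 2 + σ / (L * Δ) + σ / L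

set_option maxHeartbeats 1000000 in
/-- For small `ε`, the prescribed parameters are in the regime: the bound for `r` forces `b ≠ 0`
and `r ≤ σ / (2 L)`, so that `Λ ≥ log (4 / (ε r))` is large. -/
theorem of_le_maxRadius (hL : 0 < L) (hρ : 0 < ρ) (hσ : 0 < σ) (hΔ : 0 < Δ)
    (hd : 0 < d) (hε : 0 < ε) (hε1 : ε ≤ 1) (hεσ : ε ≤ σ) (hεL : ε ≤ 2 * L / σ)
    (hεΛ : ε ≤ 8 * L / σ * Real.exp (-logThreshold L ρ σ Δ)) (hεH : 0 < εH) (hδ : 0 < δ)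
    (hδ1 : δ < 1) (hr : 0 < r) (hΛ : Λ = logFactor d δ ε εH r)
    (hb : b = miniBatch 1 10 Λ ρ σ ε εH)
    (hℓ : ℓ = escapeLength 1 2 Λ (escapeStep 1 3 Λ L) εH)
    (hrmax : r ≤ maxRadius L σ δ ε (escapeStep 1 3 Λ L) b) :
    Regime d L ρ σ Δ ε εH δ r Λ b ℓ := by
  have hη : escapeStep 1 3 Λ L = 1 / (Λ ^ 3 * L) := by rw [escapeStep, one_mul]
  rw [hη] at hrmax hℓ
  have hr1 : r ≤ σ / (2 * b * L) := hrmax.trans (min_le_left _ _)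
  have hr2 := hrmax.trans ((min_le_right _ _).trans (min_le_left _ _))
  have hr3 := hrmax.trans ((min_le_right _ _).trans (min_le_right _ _))
  have hb0 : 0 < b := by
    rcases Nat.eq_zero_or_pos b with h0 | h0
    · rw [h0] at hr1
      simp only [Nat.cast_zero, mul_zero, zero_mul, div_zero] at hr1
      linarith
    · exact h0
  have hb1 : (1 : ℝ) ≤ b := by exact_mod_cast hb0
  have hrσ : r ≤ σ / (2 * L) := by
    refine hr1.trans ?_
    gcongr
    linarith
  have hεr : ε * r ≤ 1 := by
    calc ε * r ≤ (2 * L / σ) * (σ / (2 * L)) := by gcongr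
      _ = 1 := by field_simp
  have hεr0 : 0 < ε * r := by positivity
  have hd1 : (1 : ℝ) ≤ d := by exact_mod_cast hd
  have hinv : 0 < 1 / εH := by positivity
  have hexp : Real.exp Λ * (δ * (ε * r)) = 4 * d * (1 + 1 / εH) := by
    rw [hΛ, logFactor, Real.exp_log (by positivity)]
    field_simp
  have hE := Real.exp_pos Λ
  have hδεr : δ * (ε * r) ≤ 1 := by
    calc δ * (ε * r) ≤ 1 * 1 := by gcongr
      _ = 1 := one_mul 1
  have hexp_ge : 4 * d * (1 + 1 / εH) ≤ Real.exp Λ := by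
    rw [← hexp]; exact mul_le_of_le_one_right hE.le hδεr
  have hfour : 4 ≤ 4 * (d : ℝ) * (1 + 1 / εH) := by nlinarith
  have h4 : 4 ≤ Real.exp Λ * (δ * (ε * r)) := hexp ▸ hfour
  have hthr : logThreshold L ρ σ Δ ≤ Λ := by
    rw [← Real.exp_le_exp]
    refine le_of_mul_le_mul_right ?_ hεr0
    calc Real.exp (logThreshold L ρ σ Δ) * (ε * r)
        ≤ Real.exp (logThreshold L ρ σ Δ) *
          ((8 * L / σ * Real.exp (-logThreshold L ρ σ Δ)) * (σ / (2 * L))) := by gcongr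
      _ = 4 := by
          rw [Real.exp_neg]
          field_simp
          norm_num
      _ ≤ Real.exp Λ * (δ * (ε * r)) := h4
      _ ≤ Real.exp Λ * (ε * r) := by
          exact mul_le_mul_of_nonneg_left (mul_le_of_le_one_left hεr0.le hδ1.le) hE.le
  have t1 : 0 < L ^ 2 / (σ * ρ) := by positivity
  have t2 : 0 < 8 * L / ρ := by positivity
  have t3 : 0 < σ * ρ := by positivity
  have t4 : 0 < 32 * (Δ * L) / σ ^ 2 := by positivity
  have t5 : 0 < σ / (L * Δ) := by positivity
  have t6 : 0 < σ / L := by positivity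
  unfold logThreshold at hthr
  have hΛ0 : 0 < Λ := by linarith
  have hΛ1 : 1 ≤ Λ := by linarith
  have hσL : σ / L ≤ Λ := by linarith
  have hrΛ : r ≤ Real.exp Λ := by
    have : σ / (2 * L) = σ / L / 2 := by field_simp
    linarith [Real.add_one_le_exp Λ]
  have hlog1 : 1 ≤ Real.log (4 / δ) := by
    rw [Real.le_log_iff_exp_le (by positivity), le_div_iff₀ hδ]
    have := Real.exp_one_lt_d9
    nlinarith
  have hlog : Real.log (4 / δ) ≤ Λ := by
    rw [Real.log_le_iff_le_exp (by positivity), div_le_iff₀ hδ]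
    refine h4.trans ?_
    gcongr
    exact mul_le_of_le_one_right hδ.le hεr
  have hv1 : 1 ≤ Λ ^ 10 * (σ / ε + σ * ρ / εH ^ 2) := by
    have h1 : 1 ≤ σ / ε := (one_le_div hε).2 hεσ
    have h2 : 0 < σ * ρ / εH ^ 2 := by positivity
    exact one_le_mul_of_one_le_of_one_le (one_le_pow₀ hΛ1) (by linarith)
  rw [miniBatch, one_mul] at hb
  have hℓ' : ℓ = ⌈Λ ^ 5 * (L / εH)⌉₊ := by
    rw [hℓ, escapeLength]
    congr 1
    field_simp
  have hr2' : r * ε ≤ Real.log (4 / δ) ^ 2 * (1 / (Λ ^ 3 * L)) * σ ^ 2 / b ^ 2 := by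
    calc r * ε ≤ (Real.log (4 / δ) ^ 2 * (1 / (Λ ^ 3 * L)) * σ ^ 2 / (ε * (b : ℝ) ^ 2)) * ε := by
          gcongr
      _ = _ := by field_simp
  have hr3' : L * r ^ 2 ≤ 2 * (Real.log (4 / δ) ^ 2 * (1 / (Λ ^ 3 * L)) * σ ^ 2 / b ^ 2) := by
    have h1 := (Real.le_sqrt' hr).1 hr3
    calc L * r ^ 2 ≤ L * (2 * Real.log (4 / δ) ^ 2 * (1 / (Λ ^ 3 * L)) * σ ^ 2 /
          ((b : ℝ) ^ 2 * L)) := by gcongr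
      _ = _ := by field_simp
  exact
    { L_pos := hL, ρ_pos := hρ, σ_pos := hσ, Δ_pos := hΔ, ε_pos := hε, εH_pos := hεH,
      r_pos := hr, b_pos := hb0
      large := by linarith
      sq_L_le := by rw [← div_le_iff₀ t3]; linarith
      L_le := by linarith
      L_div_ρ_le := by rw [← div_le_iff₀ hρ]; linarith
      σ_le := by linarith
      σρ_le := by linarith
      ΔL_le := by rw [← div_le_iff₀ (by positivity)]; linarith
      σ_le_mul := by rw [← div_le_iff₀ (by positivity)]; linarith
      ε_le_one := hε1, ε_le_σ := hεσ, one_le_log := hlog1, log_le := hlog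
      d_le := by nlinarith
      le_δ := by
        rw [Real.exp_neg, inv_le_iff_one_le_mul₀ hE]
        have : δ * (ε * r) ≤ δ := mul_le_of_le_one_right hδ.le hεr
        nlinarith
      le_r := by
        rw [Real.exp_neg, inv_le_iff_one_le_mul₀ hE]
        have : δ * (ε * r) ≤ 1 * (1 * r) := by gcongr
        nlinarith
      inv_ε_le := by
        rw [div_le_iff₀ hε, two_mul, Real.exp_add]
        have h1 : δ * (ε * r) ≤ 1 * (ε * Real.exp Λ) := by gcongr
        have h2 : Real.exp Λ * (δ * (ε * r)) ≤ Real.exp Λ * (1 * (ε * Real.exp Λ)) := by gcongr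
        linarith
      inv_εH_le := by nlinarith
      le_b := by rw [hb]; exact Nat.le_ceil _
      b_le := by
        rw [hb]
        have := (Nat.ceil_lt_add_one (zero_le_one.trans hv1)).le
        linarith
      le_ℓ := by rw [hℓ']; exact Nat.le_ceil _
      ℓ_le := by rw [hℓ']; exact (Nat.ceil_lt_add_one (by positivity)).le
      r_le := hr1
      r_mul_ε_le := hr2'.trans (by gcongr)
      L_mul_sq_r_le := hr3'.trans (by gcongr) }

end Regime

end

end LENA

end

theorem theorem2 :
    ∃ (C : ℝ) (p q k m : ℕ), 0 < C ∧
      ∀ (L ρ σ Δ : ℝ), 0 < L → 0 < ρ → 0 < σ → 0 < Δ →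
      ∃ ε₀ : ℝ, 0 < ε₀ ∧
        ∀ (d : ℕ), 0 < d →
        ∀ (Ξ : Type*) [MeasurableSpace Ξ] (P : MeasureTheory.Measure Ξ)
          [MeasureTheory.IsProbabilityMeasure P]
          (f : LENA.Point d → Ξ → ℝ) (x₁ : LENA.Point d),
          LENA.IsStochasticObjective P f →
          LENA.IsSmoothLipschitz f L ρ →
          LENA.HasBoundedDeviation P f σ →
          LENA.HasGap (LENA.objective P f) x₁ Δ →
        ∀ (ε εH δ r : ℝ), 0 < ε → ε ≤ ε₀ → 0 < εH → 0 < δ → δ < 1 → 0 < r →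
        ∀ (Λ : ℝ), Λ = LENA.logFactor d δ ε εH r →
        ∀ (b : ℕ), b = LENA.miniBatch C p Λ ρ σ ε εH →
        ∀ (ηH : ℝ), ηH = LENA.escapeStep C q Λ L →
        ∀ (ℓ : ℕ), ℓ = LENA.escapeLength C k Λ ηH εH →
          r ≤ LENA.maxRadius L σ δ ε ηH b →
          LENA.runLaw P d r
              {ω | ¬ LENA.FindsWithin (LENA.stormParams L σ δ ε ηH b ℓ) f x₁
                (LENA.IsApproxLocalMin (LENA.objective P f) ε εH)
                (LENA.evalBound C m Λ L ρ σ Δ ε εH) ω}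
            ≤ ENNReal.ofReal δ := by
  refine ⟨1, 10, 3, 2, 28, one_pos, fun L ρ σ Δ hL hρ hσ hΔ => ?_⟩
  refine ⟨min (min 1 σ) (min (2 * L / σ)
    (8 * L / σ * Real.exp (-LENA.Regime.logThreshold L ρ σ Δ))), by positivity, ?_⟩
  rintro d hd Ξ _ P _ f x₁ ho hf hdev hgap ε εH δ r hε hεle hεH hδ hδ1 hr Λ hΛ b hb ηH rfl ℓ hℓ
    hrmax
  simp only [le_min_iff] at hεle
  obtain ⟨⟨hε1, hεσ⟩, hεL, hεΛ⟩ := hεle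
  have h := LENA.Regime.of_le_maxRadius hL hρ hσ hΔ hd hε hε1 hεσ hεL hεΛ hεH hδ hδ1 hr hΛ hb hℓ
    hrmax
  have hη : LENA.escapeStep 1 3 Λ L = 1 / (Λ ^ 3 * L) := by rw [LENA.escapeStep, one_mul]
  rw [hη]
  exact h.runLaw_not_findsWithin_le hd ho hf hdev hgap
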